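/- Conventions. All graphs are finite and simple. A bicyclic graph is a connected graph with $N$ vertices and $N+1$ edges. $G_1\vee G_2$ is the join, and $K_0$ is the graph with no vertices. For a graph $G$ with adjacency matrix $A(G)$ and diagonal degree matrix $D(G)$, and for a real number $\alpha\ge 0$, let $\Theta(G,\alpha)$ be the largest eigenvalue of $A(G)+\alpha D(G)$. A graph in a class of graphs is $\Theta_\alpha$-maximal if $\Theta(\cdot,\alpha)$ attains its maximum over the class at it. For $0\le t\le n-4$, a $t$-cone bicyclic graph with $n$ vertices is a graph $K_t\vee H$ with $H$ a bicyclic graph on $n-t$ vertices. Let $\pi=(d_1\ge d_2\ge\dots\ge d_n)$ be the degree sequence of some $t$-cone bicyclic graph, let $\mathscr B(\pi,t)$ be the class of all $t$-cone bicyclic graphs with degree sequence $\pi$, and put $d_j^*=d_j-t$ for $t+1\le j\le n$. $C(p,q)$ is obtained from two cycles $C_p$ and $C_q$ by identifying a vertex of one with a vertex of the other. $\theta(p,r,q)$ is obtained from three disjoint paths with $p$, $r$ and $q$ edges by identifying their initial vertices and identifying their terminal vertices. The basic graph of a graph is what remains after recursively deleting vertices of degree one. A connected graph $G$ is a BFS-graph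 if its vertices have an ordering $u_1\prec u_2\prec\cdots$ such that, with $h(v)=\operatorname{dist}_G(v,u_1)$: degrees are non-increasing and $h$ is non-decreasing along the ordering; and whenever $v\in N(u)\setminus N(x)$, $y\in N(x)\setminus N(u)$, $h(u)=h(x)=h(v)-1=h(y)-1$ and $u\prec x$, then $v\prec y$. Theorem. Let $\alpha\ge0$ be real and let $n,t,\pi$ be as above. Then $\mathscr B(\pi,t)$ has, up to isomorphism, exactly one $\Theta_\alpha$-maximal graph $B_\pi^{(t)}$. The sequence $\pi$ satisfies one of (4.2.1)–(4.2.4) below, and $B_\pi^{(t)}$ is, up to isomorphism, the graph given there. (4.2.1) $t\le n-5$, $d^*_{t+1}=4$ and $d^*_{t+2}=\dots=d^*_n=2$. Then $B_\pi^{(t)}=K_t\vee C(3,n-t-2)$. (4.2.2) $t\le n-4$, $d^*_{t+1}=d^*_{t+2}=3$ and $d^*_{t+3}=\dots=d^*_n=2$. Then $B_\pi^{(t)}=K_t\vee\theta(n-t-2,1,2)$. (4.2.3) $t\le n-6$, $d^*_{t+1}\ge5$, $d^*_{t+2}=d^*_{t+3}=d^*_{t+4}=d^*_{t+5}=2\ge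 d^*_{t+6}\ge\dots\ge d^*_n=1$. Then $B_\pi^{(t)}=K_t\vee B^\star$, where $B^\star$ is the graph on $n-t$ vertices obtained from $C(3,3)$ by attaching, at its vertex of degree four, $d^*_{t+1}-4$ pendant paths whose lengths differ pairwise by at most one. (4.2.4) $t\le n-5$, $d^*_{t+1}\ge d^*_{t+2}\ge3$, $d^*_{t+3}\ge d^*_{t+4}\ge2$ and $d^*_{t+5}\ge\dots\ge d^*_n=1$. Then $B_\pi^{(t)}=K_t\vee B_{\pi^*}$, where $B_{\pi^*}$ is the following graph on the vertices $w_0,w_1,\dots,w_{n-t-1}$. Process $w_0,w_1,w_2,\dots$ in this order, and join $w_i$ to the next $c_i$ vertices in the list that have not yet been joined to an earlier vertex in this way, where $c_0=d^*_{t+1}$, $c_1=d^*_{t+2}-3$, $c_2=d^*_{t+3}-2$, $c_3=d^*_{t+4}-2$ and $c_i=d^*_{t+1+i}-1$ for $i\ge4$ (so $w_0$ is joined to $w_1,\dots,w_{c_0}$). Finally add the edges $w_1w_2$ and $w_1w_3$. The graph $B_{\pi^*}$ is a bicyclic BFS-graph whose basic graph is isomorphic to $\theta(2,1,2)$. -/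

import Mathlib

namespace ConeGraph

/-! ### Cyclomatic classes, joins, and cone graphs -/

/-- A `c`-cyclic graph: a connected simple graph with `m` edges and `N` vertices such that
`m = N + c - 1` (written without subtraction). -/
def IsCyclic {V : Type*} (c : ℕ) (G : SimpleGraph V) : Prop :=
  G.Connected ∧ G.edgeSet.ncard + 1 = Nat.card V + c

/-- The join `G ∨ H`: disjoint union plus all edges between the two vertex sets. -/
def join {V W : Type*} (G : SimpleGraph V) (H : SimpleGraph W) : SimpleGraph (V ⊕ W) :=
  (G ⊕g H) ⊔ completeBipartiteGraph V W

/-- The cone `K_t ∨ H`. -/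
def cone {W : Type*} (t : ℕ) (H : SimpleGraph W) : SimpleGraph (Fin t ⊕ W) :=
  join (⊤ : SimpleGraph (Fin t)) H

/-- `G` (on `n` vertices) is a `t`-cone `c`-cyclic graph. -/
def IsConeCyclic (n t c : ℕ) (G : SimpleGraph (Fin n)) : Prop :=
  ∃ H : SimpleGraph (Fin (n - t)), IsCyclic c H ∧ Nonempty (G ≃g cone t H)

open Classical in
/-- The degrees of `G`, listed in a suitable order of the vertices, are `π`. -/
def HasDegreeSequence {n : ℕ} (G : SimpleGraph (Fin n)) (π : Fin n → ℕ) : Prop :=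
  ∃ σ : Equiv.Perm (Fin n), ∀ i, G.degree (σ i) = π i

/-- The class `Γ(π, t; c)` of `t`-cone `c`-cyclic graphs with degree sequence `π`. -/
def coneClass (n t c : ℕ) (π : Fin n → ℕ) : Set (SimpleGraph (Fin n)) :=
  {G | IsConeCyclic n t c G ∧ HasDegreeSequence G π}

/-! ### The general spectral radius -/

open Classical in
/-- The general matrix `M_α(G) = A(G) + α D(G)`. -/
noncomputable def generalMatrix {n : ℕ} (α : ℝ) (G : SimpleGraph (Fin n)) :
    Matrix (Fin n) (Fin n) ℝ :=
  G.adjMatrix ℝ + α • G.degMatrix ℝ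

/-- The general spectral radius `Θ(G, α)`: the largest eigenvalue of `M_α(G)`. -/
noncomputable def generalSpectralRadius {n : ℕ} (α : ℝ) (G : SimpleGraph (Fin n)) : ℝ :=
  sSup {μ : ℝ | Module.End.HasEigenvalue (Matrix.toLin' (generalMatrix α G)) μ}

/-- `G` is a `Θ_α`-maximal graph of the class `𝒢`. -/
def IsThetaMaximal {n : ℕ} (α : ℝ) (𝒢 : Set (SimpleGraph (Fin n)))
    (G : SimpleGraph (Fin n)) : Prop :=
  G ∈ 𝒢 ∧ ∀ G' ∈ 𝒢, generalSpectralRadius α G' ≤ generalSpectralRadius α G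

/-! ### The reduced degree sequence and its four types -/

/-- The reduced sequence `π* = (d_{t+1} - t, …, d_n - t)`, indexed from `0`:
`reducedSeq n t π i = d_{t+1+i} - t` for `i < n - t` (and `0` outside that range). -/
def reducedSeq (n t : ℕ) (π : Fin n → ℕ) (i : ℕ) : ℕ :=
  if h : t + i < n then π ⟨t + i, h⟩ - t else 0

/-- Type 1: `π* = (4, 2, …, 2)`, at least five entries. -/
def IsType1 (n t : ℕ) (d : ℕ → ℕ) : Prop :=
  t + 5 ≤ n ∧ d 0 = 4 ∧ ∀ i, 1 ≤ i → i < n - t → d i = 2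

/-- Type 2: `π* = (3, 3, 2, …, 2)`, at least four entries. -/
def IsType2 (n t : ℕ) (d : ℕ → ℕ) : Prop :=
  t + 4 ≤ n ∧ d 0 = 3 ∧ d 1 = 3 ∧ ∀ i, 2 ≤ i → i < n - t → d i = 2

/-- Type 3: first entry at least `5`, the next four equal to `2`, the following ones
non-increasing and at most `2`, the last one `1`. -/
def IsType3 (n t : ℕ) (d : ℕ → ℕ) : Prop :=
  t + 6 ≤ n ∧ 5 ≤ d 0 ∧ (∀ i, 1 ≤ i → i ≤ 4 → d i = 2) ∧ d 5 ≤ 2 ∧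
    (∀ i j, 5 ≤ i → i ≤ j → j < n - t → d j ≤ d i) ∧ d (n - t - 1) = 1

/-- Type 4: the first two entries at least `3`, the next two at least `2`, the following ones
non-increasing, the last one `1`. -/
def IsType4 (n t : ℕ) (d : ℕ → ℕ) : Prop :=
  t + 5 ≤ n ∧ d 1 ≤ d 0 ∧ 3 ≤ d 1 ∧ d 3 ≤ d 2 ∧ 2 ≤ d 3 ∧
    (∀ i j, 4 ≤ i → i ≤ j → j < n - t → d j ≤ d i) ∧ d (n - t - 1) = 1

/-! ### The graphs `C(p, q)` and `θ(p, r, q)` -/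

/-- The vertices `a, o, o + 1, …, o + ℓ - 2, b` (for `k = 0, …, ℓ`) of a path of length `ℓ`
from `a` to `b` with fresh interior vertices numbered from `o` on. For `a = b` this is a
closed walk around a cycle of length `ℓ` through `a`. -/
def pathVertex (a b o ℓ k : ℕ) : ℕ :=
  if k = 0 then a else if k = ℓ then b else o + k - 1

/-- `u` and `v` are consecutive on the path described by `pathVertex a b o ℓ`. -/
def pathRel (a b o ℓ u v : ℕ) : Prop :=
  ∃ k < ℓ, u = pathVertex a b o ℓ k ∧ v = pathVertex a b o ℓ (k + 1)

/-- `C(p, q)` for `p, q ≥ 3`: the cycles `0, 1, …, p - 1` and `0, p, …, p + q - 2`, which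
share exactly the vertex `0`. -/
def twoCycles (p q : ℕ) : SimpleGraph (Fin (p + q - 1)) :=
  SimpleGraph.fromRel fun u v => pathRel 0 0 1 p u v ∨ pathRel 0 0 p q u v

/-- `θ(p, r, q)`: three paths of lengths `p`, `r`, `q` from the vertex `0` to the vertex `1`,
with pairwise disjoint interiors. -/
def thetaGraph (p r q : ℕ) : SimpleGraph (Fin (p + r + q - 1)) :=
  SimpleGraph.fromRel fun u v =>
    pathRel 0 1 2 p u v ∨ pathRel 0 1 (p + 1) r u v ∨ pathRel 0 1 (p + r) q u v

/-! ### Attaching pendant paths -/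

/-- The relation whose symmetrization is `G` with pendant paths attached at `v`. The vertex
`Sum.inr ⟨j, k⟩` is the `(k + 1)`-st vertex of the `j`-th path, counted from `v`. -/
def attachRel {V : Type*} (G : SimpleGraph V) (v : V) {s : ℕ} (ℓ : Fin s → ℕ) :
    V ⊕ (Σ j : Fin s, Fin (ℓ j)) → V ⊕ (Σ j : Fin s, Fin (ℓ j)) → Prop
  | Sum.inl a, Sum.inl b => G.Adj a b
  | Sum.inl a, Sum.inr y => a = v ∧ y.2.val = 0
  | Sum.inr x, Sum.inr y => x.1 = y.1 ∧ y.2.val = x.2.val + 1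
  | Sum.inr _, Sum.inl _ => False

/-- `G` with `s` paths attached at `v`, the `j`-th having `ℓ j` new vertices. -/
def attachPaths {V : Type*} (G : SimpleGraph V) (v : V) {s : ℕ} (ℓ : Fin s → ℕ) :
    SimpleGraph (V ⊕ (Σ j : Fin s, Fin (ℓ j))) :=
  SimpleGraph.fromRel (attachRel G v ℓ)

/-- The partition of `M` into `s` almost equal parts. -/
def balancedLength (s M : ℕ) (j : Fin s) : ℕ :=
  M / s + if j.val < M % s then 1 else 0

theorem balancedLength_le_succ (s M : ℕ) (i j : Fin s) :
    balancedLength s M i ≤ balancedLength s M j + 1 := by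
  unfold balancedLength
  split_ifs <;> omega

theorem sum_balancedLength {s : ℕ} (hs : 0 < s) (M : ℕ) :
    ∑ j, balancedLength s M j = M := by
  have hc : (Finset.univ.filter fun j : Fin s => j.val < M % s).card = M % s := by
    rw [Fin.card_filter_val_lt]
    exact min_eq_right (Nat.mod_lt M hs).le
  simp only [balancedLength, Finset.sum_add_distrib, Finset.sum_const, Finset.card_univ,
    Fintype.card_fin, smul_eq_mul, Finset.sum_boole, hc, Nat.cast_id]
  exact Nat.div_add_mod M s

/-- `C(3, 3)` with `s` paths of almost equal lengths, having `M` new vertices altogether,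
attached at its vertex of degree four. -/
def bouquetWithPaths (s M : ℕ) :
    SimpleGraph (Fin (3 + 3 - 1) ⊕ (Σ j : Fin s, Fin (balancedLength s M j))) :=
  attachPaths (twoCycles 3 3) 0 (balancedLength s M)

/-! ### The breadth-first bicyclic graph `B_{π*}` -/

/-- The number of new vertices (in the next layer) that the `i`-th vertex is joined to in the
breadth-first construction: the root `0` gets `d 0` of them. Its first child `1` is already joined
to the root and to `2` and `3`; the vertices `2` and `3` are already joined to the root and
to `1`; every other vertex is already joined to its parent only. -/
def newNeighbors (d : ℕ → ℕ) : ℕ → ℕ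
  | 0 => d 0
  | 1 => d 1 - 3
  | 2 => d 2 - 2
  | 3 => d 3 - 2
  | (i + 4) => d (i + 4) - 1

/-- `B_{π*}` on `N` vertices for `π* = (d 0, …, d (N - 1))`. The vertices
`v_{0,1}; v_{1,1}, …, v_{1,s₁}; v_{2,1}, …` are numbered `0, 1, …, N - 1` layer by layer. So the
new neighbors of the vertex `u` form the block of `newNeighbors d u` consecutive numbers that
comes right after the root and the new neighbors of the earlier vertices. Besides these edges
there are the edges from `1` to `2` and from `1` to `3`. -/
def bfsBicyclic (N : ℕ) (d : ℕ → ℕ) : SimpleGraph (Fin N) :=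
  SimpleGraph.fromRel fun u v =>
    (u.val = 1 ∧ (v.val = 2 ∨ v.val = 3)) ∨
    (∑ i ∈ Finset.range u.val, newNeighbors d i < v.val ∧
      v.val ≤ ∑ i ∈ Finset.range (u.val + 1), newNeighbors d i)

/-! ### BFS-graphs and basic graphs -/

open Classical in
/-- `G` is a BFS-graph: it is connected and has an ordering of its vertices (given by the
position function `e`, with first vertex `r`) along which degrees do not increase, distances
from `r` do not decrease, and which satisfies the breadth-first condition. -/
def IsBFSGraph {N : ℕ} (G : SimpleGraph (Fin N)) : Prop :=
  G.Connected ∧ ∃ (e : Equiv.Perm (Fin N)) (r : Fin N), (∀ v, e r ≤ e v) ∧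
    (∀ u v, e u ≤ e v → G.degree v ≤ G.degree u ∧ G.dist u r ≤ G.dist v r) ∧
    ∀ u x v y, G.Adj u v → ¬ G.Adj x v → G.Adj x y → ¬ G.Adj u y →
      G.dist u r = G.dist x r → G.dist v r = G.dist u r + 1 → G.dist y r = G.dist u r + 1 →
      e u < e x → e v < e y

/-- Delete from `S` the vertices that are pendant in the subgraph induced on `S`. -/
def pruneStep {V : Type*} (G : SimpleGraph V) (S : Set V) : Set V :=
  {v ∈ S | (G.neighborSet v ∩ S).ncard ≠ 1}

/-- The vertices left after recursively deleting pendant vertices (`Nat.card V` rounds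
are enough for a finite graph). -/
def basicVertices {V : Type*} (G : SimpleGraph V) : Set V :=
  (pruneStep G)^[Nat.card V] Set.univ

/-- The basic graph of `G`. -/
def basicGraph {V : Type*} (G : SimpleGraph V) : SimpleGraph (basicVertices G) :=
  G.induce (basicVertices G)

end ConeGraph

/-! Fix a maximal graph `G`, a cone over `H`, and its positive Perron vector. Replace the base by
any connected graph `H'` whose degrees are those of `H` up to a permutation. The cone stays in the
class, so its quadratic form at the Perron vector of `G` cannot grow. If the form does not change,
the Perron vector is an eigenvector of the new cone as well. Only the base part of the form varies,
and `Extremal` records this for the restriction `x` of the Perron vector to the base.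

Two modifications exploit this. Moving neighbors from a vertex to one of smaller degree shows that a
larger degree forces a strictly larger entry of `x` (`Extremal.lt_of_card_nbrs_lt`). Replacing edges
`uv`, `ab` by `ub`, `av` changes the energy by `2 (x u - x a) (x b - x v)`, so a switch that keeps
the graph connected and does not lower the energy must have `x u = x a` and `x b = x v`
(`Extremal.switch_eq`). The counting lemma `exists_switchable` supplies connected switches. In an
order with decreasing `x`, the graph is then a breadth-first tree with two extra edges (`Shape`).

Ties in `x` are the main difficulty, and two graphs are used to handle them. The first is `H`,
isomorphic to the base of `G` and renumbered among equal entries so that it is breadth-first. The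
second is `K`, a graph with the same degrees and energy that maximizes in addition the energy of a
strictly decreasing weight. `K` need not be known to be isomorphic to `H`, but it is stable: no
connected switch moves edges toward smaller indices. Stability confines the extra edges of `K` to
the first few vertices (`StableShape`). Since `K` and `H` share their neighbor sums of `x`, and
entries of `x` determine degrees, these facts pass to `H` (`MaximalPair.exists_triangle`,
`MaximalPair.adj_of_three_three`, `MaximalPair.lt_three`, `MaximalPair.adj_one`).

The degree sum `2 N + 2` leaves only the four types. In each type the degrees and the position of
the extra edges determine the breadth-first graph, and counting children identifies it with the
stated one. Existence holds because the class is finite, and uniqueness because every maximal graph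
is isomorphic to the same model. -/

namespace ConeGraph

open SimpleGraph Finset

/-! ### Edge switches and connectedness. -/

section Modifications

variable {V : Type*}

/-- The star with center `u` and set of leaves `S`. -/
def starOn (u : V) (S : Finset V) : SimpleGraph V := SimpleGraph.fromRel fun i j => i = u ∧ j ∈ S

theorem starOn_adj {u : V} {S : Finset V} (hu : u ∉ S) {i j : V} :
    (starOn u S).Adj i j ↔ (i = u ∧ j ∈ S) ∨ (j = u ∧ i ∈ S) := by
  simp only [starOn, fromRel_adj]
  grind

theorem connected_of_adj_reachable {H K : SimpleGraph V} (hH : H.Connected)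
    (h : ∀ i j, H.Adj i j → K.Reachable i j) : K.Connected := by
  have hne := hH.nonempty
  refine ⟨fun a b => ?_⟩
  obtain ⟨p⟩ := hH.preconnected a b
  induction p with
  | nil => exact Reachable.refl _
  | cons hadj _ ih => exact (h _ _ hadj).trans ih

/-- The pair of edges `uv`, `ab`. -/
def twoEdges (u v a b : V) : SimpleGraph V := starOn u {v} ⊔ starOn a {b}

theorem twoEdges_adj {u v a b : V} (h1 : u ≠ v) (h2 : a ≠ b) {i j : V} :
    (twoEdges u v a b).Adj i j ↔
      (i = u ∧ j = v) ∨ (j = u ∧ i = v) ∨ (i = a ∧ j = b) ∨ (j = a ∧ i = b) := by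
  unfold twoEdges
  rw [sup_adj, starOn_adj (by simpa using h1), starOn_adj (by simpa using h2)]
  simp only [mem_singleton]
  tauto

theorem disjoint_starOn_starOn {u v a b : V} (h1 : u ≠ v) (h2 : a ≠ b) (hua : u ≠ a) (hvb : v ≠ b)
    (hva : v ≠ a) :
    Disjoint (starOn u {v}) (starOn a ({b} : Finset V)) := by
  rw [SimpleGraph.disjoint_left]
  intro i j
  rw [starOn_adj (by simpa using h1), starOn_adj (by simpa using h2)]
  simp only [mem_singleton]
  grind

/-- Replace the edges `uv`, `ab` by `ub`, `av`. -/
def switch (H : SimpleGraph V) (u v a b : V) : SimpleGraph V :=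
  H \ twoEdges u v a b ⊔ twoEdges u b a v

/-- The edges `uv`, `ab` can be replaced by the non-edges `ub`, `av`. -/
structure Switchable (H : SimpleGraph V) (u v a b : V) : Prop where
  uv : H.Adj u v
  ab : H.Adj a b
  ub : ¬ H.Adj u b
  av : ¬ H.Adj a v
  ne_ub : u ≠ b
  ne_av : a ≠ v
  ne_ua : u ≠ a
  ne_vb : v ≠ b

namespace Switchable

variable {H : SimpleGraph V} {u v a b : V}

theorem removed_le (h : Switchable H u v a b) : twoEdges u v a b ≤ H := by
  intro i j hij
  rw [twoEdges_adj h.uv.ne h.ab.ne] at hij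
  have := h.uv; have := h.ab; have := h.uv.symm; have := h.ab.symm
  grind

theorem added_disjoint (h : Switchable H u v a b) : Disjoint H (twoEdges u b a v) := by
  rw [SimpleGraph.disjoint_left]
  intro i j hij hij'
  rw [twoEdges_adj h.ne_ub h.ne_av] at hij'
  have := h.ub; have := h.av; have := hij.symm
  grind

/-- If `u` and `a`, or `v` and `b`, stay joined, then that path together with the new edges `ub` and
`av` reconnects the ends of both deleted edges. -/
theorem connected (h : Switchable H u v a b) (hH : H.Connected)
    (hr : (H \ twoEdges u v a b).Reachable u a ∨ (H \ twoEdges u v a b).Reachable v b) :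
    (switch H u v a b).Connected := by
  have hle : H \ twoEdges u v a b ≤ switch H u v a b := le_sup_left
  have h1 : (switch H u v a b).Adj u b :=
    Or.inr ((twoEdges_adj h.ne_ub h.ne_av).mpr (by tauto))
  have h2 : (switch H u v a b).Adj a v :=
    Or.inr ((twoEdges_adj h.ne_ub h.ne_av).mpr (by tauto))
  have h3 : (switch H u v a b).Reachable u v ∧ (switch H u v a b).Reachable a b := by
    rcases hr with hr | hr
    · exact ⟨(hr.mono hle).trans h2.reachable, (hr.mono hle).symm.trans h1.reachable⟩
    · exact ⟨h1.reachable.trans (hr.mono hle).symm, h2.reachable.trans (hr.mono hle)⟩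
  refine connected_of_adj_reachable hH fun i j hij => ?_
  by_cases he : (twoEdges u v a b).Adj i j
  · rw [twoEdges_adj h.uv.ne h.ab.ne] at he
    rcases he with ⟨rfl, rfl⟩ | ⟨rfl, rfl⟩ | ⟨rfl, rfl⟩ | ⟨rfl, rfl⟩
    · exact h3.1
    · exact h3.1.symm
    · exact h3.2
    · exact h3.2.symm
  · exact (Adj.reachable (show (H \ twoEdges u v a b).Adj i j from
      (sdiff_adj _ _ _ _).mpr ⟨hij, he⟩)).mono hle

end Switchable

/-- The last edge of a path to `y`: the rest of the path avoids `y`. -/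
theorem exists_adj_reachable_avoiding {G : SimpleGraph V} {s y : V} (h : G.Reachable s y)
    (hs : s ≠ y) : ∃ q, G.Adj y q ∧ ∀ K : SimpleGraph V,
      (∀ i j, G.Adj i j → i ≠ y → j ≠ y → K.Adj i j) → K.Reachable q s := by
  classical
  obtain ⟨p, hp⟩ := h.symm.exists_isPath
  cases p with
  | nil => exact absurd rfl hs
  | cons hadj p =>
    rw [Walk.cons_isPath_iff] at hp
    refine ⟨_, hadj, fun K hK => ?_⟩
    refine ⟨p.transfer K fun e he => ?_⟩
    induction e with
    | _ i j =>
      have hi := p.fst_mem_support_of_mem_edges he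
      have hj := p.snd_mem_support_of_mem_edges he
      exact hK i j (p.adj_of_mem_edges he) (fun h => hp.2 (h ▸ hi)) (fun h => hp.2 (h ▸ hj))

/-- Follow a walk to `u` until it first uses the edge `uv`. -/
theorem reachable_or_of_deleted {H : SimpleGraph V} (hH : H.Connected) (u v w : V) :
    (H \ starOn u {v}).Reachable w u ∨ (H \ starOn u {v}).Reachable w v := by
  obtain ⟨p⟩ := hH.preconnected w u
  induction p with
  | nil => exact Or.inl (Reachable.refl _)
  | @cons i j k hadj p ih =>
    by_cases he : (starOn k {v}).Adj i j
    · by_cases hkv : k = v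
      · subst hkv
        simp [starOn] at he
        grind
      · rw [starOn_adj (by simpa using hkv)] at he
        simp only [mem_singleton] at he
        rcases he with ⟨rfl, rfl⟩ | ⟨rfl, rfl⟩
        · exact Or.inl (Reachable.refl _)
        · exact Or.inr (Reachable.refl _)
    · have : (H \ starOn k {v}).Adj i j := (sdiff_adj _ _ _ _).mpr ⟨hadj, he⟩
      exact ih.imp this.reachable.trans this.reachable.trans

end Modifications

/-! ### Neighbor sums, energy, and the existence of switches. -/

section Basics

variable {V : Type*} [Fintype V]

open Classical in
/-- The finite set of neighbors of `v` in `H`. -/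
noncomputable def nbrs (H : SimpleGraph V) (v : V) : Finset V :=
  univ.filter fun w => H.Adj v w

@[simp] theorem mem_nbrs {H : SimpleGraph V} {v w : V} : w ∈ nbrs H v ↔ H.Adj v w := by
  classical
  simp [nbrs]

theorem card_nbrs (H : SimpleGraph V) (v : V) [Fintype (H.neighborSet v)] :
    #(nbrs H v) = H.degree v := by
  classical
  rw [← card_neighborFinset_eq_degree]
  congr 1
  ext w
  simp

/-- The sum of `x` over the neighbors of `v`. -/
noncomputable def nbrSum (H : SimpleGraph V) (x : V → ℝ) (v : V) : ℝ := ∑ w ∈ nbrs H v, x w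

theorem nbrSum_one (H : SimpleGraph V) (v : V) : nbrSum H (fun _ => 1) v = #(nbrs H v) := by
  simp [nbrSum]

theorem nbrSum_sup {H K : SimpleGraph V} (h : Disjoint H K) (x : V → ℝ) (v : V) :
    nbrSum (H ⊔ K) x v = nbrSum H x v + nbrSum K x v := by
  classical
  unfold nbrSum
  rw [← sum_union]
  · congr 1
    ext w
    simp
  · rw [Finset.disjoint_left]
    intro w hw hw'
    rw [mem_nbrs] at hw hw'
    rw [SimpleGraph.disjoint_left] at h
    exact h _ _ hw hw'

/-- Additivity of neighbor sums is the only bookkeeping needed for edge modifications: the constant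
vector `1` gives degrees, and summation against `x` gives energies. -/
theorem nbrSum_modify {H R A : SimpleGraph V} (hR : R ≤ H) (hA : Disjoint H A) (x : V → ℝ)
    (v : V) : nbrSum (H \ R ⊔ A) x v = nbrSum H x v - nbrSum R x v + nbrSum A x v := by
  have h1 : Disjoint (H \ R) A := hA.mono_left sdiff_le
  have h2 : Disjoint (H \ R) R := disjoint_sdiff_self_left
  have h3 : H \ R ⊔ R = H := by rw [sdiff_sup_self]; exact sup_eq_left.mpr hR
  rw [nbrSum_sup h1]
  have := nbrSum_sup h2 x v
  rw [h3] at this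
  rw [this]
  ring

open Classical in
theorem nbrSum_starOn {u : V} {S : Finset V} (hu : u ∉ S) (x : V → ℝ) (i : V) :
    nbrSum (starOn u S) x i = (if i = u then ∑ w ∈ S, x w else 0) + if i ∈ S then x u else 0 := by
  unfold nbrSum
  by_cases hi : i = u
  · subst hi
    have : nbrs (starOn i S) i = S := by
      ext w
      simp only [mem_nbrs, starOn_adj hu]
      grind
    simp [this, hu]
  · by_cases hS : i ∈ S
    · have : nbrs (starOn u S) i = {u} := by
        ext w
        simp only [mem_nbrs, starOn_adj hu, mem_singleton]
        grind
      simp [this, hi, hS]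
    · have : nbrs (starOn u S) i = ∅ := by
        ext w
        simp only [mem_nbrs, starOn_adj hu]
        grind
      simp [this, hi, hS]

/-- The bilinear energy `∑ xᵥ (A x)ᵥ`. -/
noncomputable def energy (H : SimpleGraph V) (x : V → ℝ) : ℝ := ∑ v, x v * nbrSum H x v

theorem energy_starOn {u : V} {S : Finset V} (hu : u ∉ S) (x : V → ℝ) :
    energy (starOn u S) x = 2 * (x u * ∑ w ∈ S, x w) := by
  classical
  simp only [energy, nbrSum_starOn hu, mul_add, sum_add_distrib, mul_ite, mul_zero]
  simp [← sum_mul]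
  ring

theorem energy_sup {H K : SimpleGraph V} (h : Disjoint H K) (x : V → ℝ) :
    energy (H ⊔ K) x = energy H x + energy K x := by
  simp only [energy, nbrSum_sup h, mul_add, sum_add_distrib]

theorem energy_modify {H R A : SimpleGraph V} (hR : R ≤ H) (hA : Disjoint H A) (x : V → ℝ) :
    energy (H \ R ⊔ A) x = energy H x - energy R x + energy A x := by
  simp only [energy, nbrSum_modify hR hA, mul_add, mul_sub, sum_add_distrib, sum_sub_distrib]

namespace Switchable

variable {H : SimpleGraph V} {u v a b : V}

theorem nbrSum_eq [DecidableEq V] (h : Switchable H u v a b) (x : V → ℝ) (i : V) :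
    nbrSum (switch H u v a b) x i = nbrSum H x i + (if i = u then x b - x v else 0) +
      (if i = v then x a - x u else 0) + (if i = a then x v - x b else 0) +
      if i = b then x u - x a else 0 := by
  have h1 := h.uv.ne
  have h2 := h.ab.ne
  have h3 := h.ne_ub
  have h4 := h.ne_av
  have h5 := h.ne_ua
  have h6 := h.ne_vb
  unfold switch
  rw [nbrSum_modify h.removed_le h.added_disjoint]
  unfold twoEdges
  rw [nbrSum_sup (disjoint_starOn_starOn h1 h2 h5 h6 h4.symm),
    nbrSum_sup (disjoint_starOn_starOn h3 h4 h5 h6.symm h2.symm),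
    nbrSum_starOn (by simpa using h1), nbrSum_starOn (by simpa using h2),
    nbrSum_starOn (by simpa using h3), nbrSum_starOn (by simpa using h4)]
  simp only [mem_singleton, sum_singleton]
  split_ifs <;> ring

/-- The four edge terms `x u x b + x a x v - x u x v - x a x b` factor, so the sign of the change is
read off from two comparisons. -/
theorem energy_eq (h : Switchable H u v a b) (x : V → ℝ) :
    energy (switch H u v a b) x = energy H x + 2 * ((x u - x a) * (x b - x v)) := by
  have h1 := h.uv.ne
  have h2 := h.ab.ne
  have h3 := h.ne_ub
  have h4 := h.ne_av
  have h5 := h.ne_ua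
  have h6 := h.ne_vb
  unfold switch
  rw [energy_modify h.removed_le h.added_disjoint]
  unfold twoEdges
  rw [energy_sup (disjoint_starOn_starOn h1 h2 h5 h6 h4.symm),
    energy_sup (disjoint_starOn_starOn h3 h4 h5 h6.symm h2.symm),
    energy_starOn (by simpa using h1), energy_starOn (by simpa using h2),
    energy_starOn (by simpa using h3), energy_starOn (by simpa using h4)]
  simp only [sum_singleton]
  ring

theorem card_nbrs_eq (h : Switchable H u v a b) (i : V) :
    #(nbrs (switch H u v a b) i) = #(nbrs H i) := by
  classical
  have := h.nbrSum_eq (fun _ => 1) i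
  simp only [nbrSum_one, sub_self, ite_self, add_zero] at this
  exact_mod_cast this

end Switchable

/-- This allows `u` to exchange its neighbor `v` for `y` without changing degrees or losing
connectedness. If `v` and `y` stay joined without `uv`, then `c` is chosen so that some path between
them survives. Otherwise `y` lies on the side of `u`, and `c` is the vertex next to `y` on a path
from `u`. -/
theorem exists_switchable {H : SimpleGraph V} (hH : H.Connected) {u v y : V} (huv : H.Adj u v)
    (huy : ¬ H.Adj u y) (hyu : y ≠ u) (hyv : y ≠ v) (hd : #(nbrs H v) ≤ #(nbrs H y)) :
    ∃ c, Switchable H u v c y ∧ ((H \ twoEdges u v c y).Reachable u c ∨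
      (H \ twoEdges u v c y).Reachable v y) := by
  classical
  have hsw : ∀ c, H.Adj y c → ¬ H.Adj v c → c ≠ v → Switchable H u v c y := fun c h1 h2 h3 =>
    ⟨huv, h1.symm, huy, fun h => h2 h.symm, hyu.symm, h3,
      fun h => huy (h ▸ h1.symm), hyv.symm⟩
  have hK : ∀ c, H.Adj y c → ∀ i j, H.Adj i j → ¬ (i = u ∧ j = v) → ¬ (i = v ∧ j = u) →
      ¬ (i = c ∧ j = y) → ¬ (i = y ∧ j = c) → (H \ twoEdges u v c y).Adj i j := by
    intro c hc i j hij h1 h2 h3 h4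
    refine (sdiff_adj _ _ _ _).mpr ⟨hij, ?_⟩
    rw [twoEdges_adj huv.ne hc.ne']
    tauto
  have h1uv : ∀ i j, (H \ starOn u {v}).Adj i j ↔
      H.Adj i j ∧ ¬ (i = u ∧ j = v) ∧ ¬ (i = v ∧ j = u) := by
    intro i j
    rw [sdiff_adj, starOn_adj (by simpa using huv.ne)]
    simp only [mem_singleton]
    tauto
  -- Without such a `c`, every neighbor of `y` other than `v` is a neighbor of `v`, while `u` is a
  -- neighbor of `v` only. This contradicts the degree inequality.
  have hex : ∃ c, H.Adj y c ∧ ¬ H.Adj v c ∧ c ≠ v := by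
    by_contra! hcon
    have hsub : (nbrs H y).erase v ⊆ ((nbrs H v).erase y).erase u := by
      intro c hc
      rw [mem_erase, mem_nbrs] at hc
      rw [mem_erase, mem_erase, mem_nbrs]
      refine ⟨fun h => huy (h ▸ hc.2.symm), hc.2.ne', ?_⟩
      by_contra h
      exact hc.1 (hcon c hc.2 h)
    have h2 := card_le_card hsub
    have hu : u ∈ (nbrs H v).erase y := by
      rw [mem_erase, mem_nbrs]
      exact ⟨hyu.symm, huv.symm⟩
    rw [card_erase_of_mem hu] at h2
    have hpos := card_pos.mpr ⟨u, hu⟩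
    by_cases hvy : H.Adj v y
    · rw [card_erase_of_mem (by simpa using hvy.symm)] at h2
      rw [card_erase_of_mem (by simpa using hvy)] at h2 hpos
      omega
    · rw [erase_eq_of_notMem (by simpa using fun h => hvy h.symm),
        erase_eq_of_notMem (by simpa using hvy)] at h2
      rw [erase_eq_of_notMem (by simpa using hvy)] at hpos
      omega
  by_cases hreach : (H \ starOn u {v}).Reachable v y
  · by_cases hvy : H.Adj v y
    · obtain ⟨c, hc1, hc2, hc3⟩ := hex
      refine ⟨c, hsw c hc1 hc2 hc3, Or.inr (Adj.reachable ?_)⟩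
      refine hK c hc1 v y hvy ?_ ?_ ?_ ?_ <;> grind
    by_cases hw : ∃ w, H.Adj v w ∧ H.Adj w y
    · obtain ⟨w, hw1, hw2⟩ := hw
      obtain ⟨c, hc1, hc2, hc3⟩ := hex
      have hwu : w ≠ u := by rintro rfl; exact huy hw2
      have hwc : w ≠ c := by rintro rfl; exact hc2 hw1
      refine ⟨c, hsw c hc1 hc2 hc3, Or.inr ((Adj.reachable (v := w) ?_).trans (Adj.reachable ?_))⟩
      · refine hK c hc1 v w hw1 ?_ ?_ ?_ ?_ <;> grind
      · refine hK c hc1 w y hw2 ?_ ?_ ?_ ?_ <;> grind [SimpleGraph.Adj.ne]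
    · push Not at hw
      obtain ⟨q, hq1, hq2⟩ := exists_adj_reachable_avoiding hreach hyv.symm
      obtain ⟨w, hw1, -⟩ := exists_adj_reachable_avoiding hreach.symm hyv
      -- A second neighbor of `v` raises the degree of `y` to at least two, so `c` can avoid the
      -- vertex `q` through which the path enters `y`.
      have h2 : 1 < #(nbrs H v) := by
        rw [one_lt_card]
        refine ⟨u, by simpa using huv.symm, w, by simpa using ((h1uv _ _).mp hw1).1, ?_⟩
        rintro rfl
        exact ((h1uv _ _).mp hw1).2.2 ⟨rfl, rfl⟩
      obtain ⟨c, hc1, hc2⟩ := exists_mem_ne (lt_of_lt_of_le h2 hd) q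
      rw [mem_nbrs] at hc1
      have hcv : ¬ H.Adj v c := fun h => hw c h hc1.symm
      have hcv' : c ≠ v := by rintro rfl; exact hvy hc1.symm
      refine ⟨c, hsw c hc1 hcv hcv', Or.inr ?_⟩
      have hq3 := (h1uv _ _).mp hq1
      refine (hq2 _ fun i j hij hi hj => ?_).symm.trans (Adj.reachable ?_)
      · have := (h1uv _ _).mp hij
        refine hK c hc1 i j this.1 ?_ ?_ ?_ ?_ <;> grind
      · refine hK c hc1 q y hq3.1.symm ?_ ?_ ?_ ?_ <;> grind
  · have hu : (H \ starOn u {v}).Reachable u y :=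
      ((reachable_or_of_deleted hH u v y).resolve_right fun h => hreach h.symm).symm
    obtain ⟨c, hc1, hc2⟩ := exists_adj_reachable_avoiding hu hyu.symm
    have hc3 := ((h1uv _ _).mp hc1).1
    have hcu : c ≠ u := by rintro rfl; exact huy hc3.symm
    have hcv : c ≠ v := by rintro rfl; exact hreach hc1.symm.reachable
    have hcv' : ¬ H.Adj v c := by
      intro h
      refine hreach ((Adj.reachable (v := c) ?_).trans hc1.symm.reachable)
      rw [h1uv]
      grind
    refine ⟨c, hsw c hc3 hcv' hcv, Or.inl (hc2 _ fun i j hij hi hj => ?_).symm⟩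
    have := (h1uv _ _).mp hij
    refine hK c hc3 i j this.1 ?_ ?_ ?_ ?_ <;> grind

end Basics

end ConeGraph

namespace ConeGraph

open SimpleGraph Finset

/-! ### The largest eigenvalue of a real symmetric matrix. -/

section Spectral

variable {ι : Type*} [Fintype ι] [DecidableEq ι]

theorem hasEigenvalue_toLin'_iff (A : Matrix ι ι ℝ) (μ : ℝ) :
    Module.End.HasEigenvalue (Matrix.toLin' A) μ ↔ ∃ z : ι → ℝ, z ≠ 0 ∧ A.mulVec z = μ • z := by
  constructor
  · intro h
    obtain ⟨z, hz⟩ := h.exists_hasEigenvector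
    exact ⟨z, hz.2, by simpa using hz.apply_eq_smul⟩
  · rintro ⟨z, hz, h⟩
    exact Module.End.hasEigenvalue_of_hasEigenvector (x := z)
      ⟨Module.End.mem_eigenspace_iff.mpr (by simpa using h), hz⟩

/-- The spectrum is finite and nonempty, so the supremum is attained. An eigenvalue of the shifted
matrix is this supremum minus an eigenvalue of `A`, hence nonnegative. -/
theorem sSup_eigenvalues_spec [Nonempty ι] {A : Matrix ι ι ℝ} (hA : A.IsHermitian) :
    Module.End.HasEigenvalue (Matrix.toLin' A)
      (sSup {μ : ℝ | Module.End.HasEigenvalue (Matrix.toLin' A) μ}) ∧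
    ((sSup {μ : ℝ | Module.End.HasEigenvalue (Matrix.toLin' A) μ}) •
      (1 : Matrix ι ι ℝ) - A).PosSemidef := by
  set E : Set ℝ := {μ : ℝ | Module.End.HasEigenvalue (Matrix.toLin' A) μ}
  have hfin : E.Finite := Module.End.finite_hasEigenvalue _
  have hne : E.Nonempty := by
    obtain ⟨i⟩ := ‹Nonempty ι›
    refine ⟨hA.eigenvalues i, ?_⟩
    change Module.End.HasEigenvalue _ _
    rw [hasEigenvalue_toLin'_iff]
    refine ⟨hA.eigenvectorBasis i, ?_, hA.mulVec_eigenvectorBasis i⟩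
    intro h
    exact hA.eigenvectorBasis.orthonormal.ne_zero i (by ext j; exact congrFun h j)
  refine ⟨hne.csSup_mem hfin, ?_⟩
  have hB : (sSup E • (1 : Matrix ι ι ℝ) - A).IsHermitian := by
    refine Matrix.IsHermitian.sub ?_ hA
    ext i j
    simp [Matrix.one_apply, eq_comm]
  rw [hB.posSemidef_iff_eigenvalues_nonneg]
  intro i
  have h1 := hB.mulVec_eigenvectorBasis i
  have h2 : sSup E - hB.eigenvalues i ∈ E := by
    change Module.End.HasEigenvalue _ _
    rw [hasEigenvalue_toLin'_iff]
    refine ⟨hB.eigenvectorBasis i, ?_, ?_⟩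
    · intro h
      exact hB.eigenvectorBasis.orthonormal.ne_zero i (by ext j; exact congrFun h j)
    · rw [Matrix.sub_mulVec, Matrix.smul_mulVec, Matrix.one_mulVec] at h1
      rw [sub_smul, ← h1]
      abel
  have := le_csSup hfin.bddAbove h2
  simp only [Pi.zero_apply]
  linarith

end Spectral

/-! ### The variational principle for the general spectral radius and the Perron vector. -/

section ThetaBasics

variable {n : ℕ}

theorem generalMatrix_isHermitian (α : ℝ) (G : SimpleGraph (Fin n)) :
    (generalMatrix α G).IsHermitian := by
  classical
  ext i j
  simp only [generalMatrix, Matrix.conjTranspose_apply, Matrix.add_apply, adjMatrix_apply,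
    Matrix.smul_apply, degMatrix, Matrix.diagonal_apply, star_trivial]
  by_cases h : i = j
  · subst h; simp
  · simp [h, Ne.symm h, G.adj_comm]

/-- The `v`-th entry of `(A(H) + α D(H)) x`. -/
noncomputable def localSum {V : Type*} [Fintype V] (α : ℝ) (H : SimpleGraph V) (x : V → ℝ)
    (v : V) : ℝ := nbrSum H x v + α * #(nbrs H v) * x v

theorem generalMatrix_mulVec (α : ℝ) (G : SimpleGraph (Fin n)) (z : Fin n → ℝ) (v : Fin n) :
    (generalMatrix α G).mulVec z v = localSum α G z v := by
  classical
  unfold generalMatrix localSum nbrSum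
  rw [Matrix.add_mulVec, Pi.add_apply, Matrix.smul_mulVec, Pi.smul_apply, degMatrix,
    Matrix.mulVec_diagonal]
  congr 1
  · rw [adjMatrix_mulVec_apply]
    congr 1
    ext w
    simp
  · rw [card_nbrs, smul_eq_mul, mul_assoc]

theorem generalSpectralRadius_spec (α : ℝ) (G : SimpleGraph (Fin n)) (hn : 0 < n) :
    (∃ z : Fin n → ℝ, z ≠ 0 ∧ ∀ v, localSum α G z v = generalSpectralRadius α G * z v) ∧
    ∀ z : Fin n → ℝ, ∑ v, z v * localSum α G z v ≤ generalSpectralRadius α G * ∑ v, z v * z v ∧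
      (∑ v, z v * localSum α G z v = generalSpectralRadius α G * ∑ v, z v * z v →
        ∀ v, localSum α G z v = generalSpectralRadius α G * z v) := by
  have : Nonempty (Fin n) := ⟨⟨0, hn⟩⟩
  obtain ⟨h1, h2⟩ := sSup_eigenvalues_spec (generalMatrix_isHermitian α G)
  change Module.End.HasEigenvalue _ (generalSpectralRadius α G) at h1
  change (generalSpectralRadius α G • (1 : Matrix (Fin n) (Fin n) ℝ) -
    generalMatrix α G).PosSemidef at h2
  set Θ := generalSpectralRadius α G
  have hmv : ∀ z : Fin n → ℝ, ∀ v, (Θ • (1 : Matrix (Fin n) (Fin n) ℝ) -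
      generalMatrix α G).mulVec z v = Θ * z v - localSum α G z v := by
    intro z v
    rw [Matrix.sub_mulVec, Pi.sub_apply, generalMatrix_mulVec, Matrix.smul_mulVec,
      Matrix.one_mulVec]
    simp
  have hq : ∀ z : Fin n → ℝ, star z ⬝ᵥ (Θ • (1 : Matrix (Fin n) (Fin n) ℝ) -
      generalMatrix α G).mulVec z = Θ * ∑ v, z v * z v - ∑ v, z v * localSum α G z v := by
    intro z
    simp only [dotProduct, hmv, star_trivial, mul_sum, ← sum_sub_distrib]
    exact sum_congr rfl fun v _ => by ring
  constructor
  · rw [hasEigenvalue_toLin'_iff] at h1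
    obtain ⟨z, hz, h⟩ := h1
    refine ⟨z, hz, fun v => ?_⟩
    rw [← generalMatrix_mulVec, h]
    rfl
  · intro z
    constructor
    · have := h2.dotProduct_mulVec_nonneg z
      rw [hq] at this
      linarith
    · intro h v
      have h3 := (h2.dotProduct_mulVec_zero_iff z).mp (by rw [hq, h, sub_self])
      have h4 := congrFun h3 v
      rw [hmv, Pi.zero_apply] at h4
      linarith

/-- Taking absolute values in an eigenvector does not decrease the quadratic form: the adjacency
part can only grow and the diagonal part is unchanged. Hence the absolute values again form an
eigenvector. -/
theorem exists_perron (α : ℝ) {G : SimpleGraph (Fin n)} (hG : G.Connected) :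
    ∃ z : Fin n → ℝ, (∀ v, 0 < z v) ∧
      ∀ v, localSum α G z v = generalSpectralRadius α G * z v := by
  have hn : 0 < n := by
    obtain ⟨v⟩ := hG.nonempty
    exact v.pos
  obtain ⟨⟨z, hz, h1⟩, h2⟩ := generalSpectralRadius_spec α G hn
  set Θ := generalSpectralRadius α G
  have h3 : ∀ v, localSum α G (fun w => |z w|) v = Θ * |z v| := by
    apply (h2 fun w => |z w|).2
    refine le_antisymm (h2 fun w => |z w|).1 ?_
    rw [mul_sum]
    refine sum_le_sum fun v _ => ?_
    have h4 : z v * localSum α G z v ≤ |z v| * localSum α G (fun w => |z w|) v := by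
      unfold localSum nbrSum
      rw [mul_add, mul_add]
      refine add_le_add ?_ (le_of_eq ?_)
      · rw [mul_sum, mul_sum]
        refine sum_le_sum fun w _ => ?_
        rw [← abs_mul]
        exact le_abs_self _
      · have := abs_mul_abs_self (z v)
        linear_combination (-α * #(nbrs G v)) * this
    rw [h1] at h4
    have := abs_mul_abs_self (z v)
    calc Θ * (|z v| * |z v|) = z v * (Θ * z v) := by rw [this]; ring
      _ ≤ _ := h4
  refine ⟨fun w => |z w|, ?_, h3⟩
  by_contra! hcon
  obtain ⟨v, hv⟩ := hcon
  have hv0 : z v = 0 := abs_nonpos_iff.mp hv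
  -- At a zero entry the eigenvalue equation says that a sum of nonnegative entries vanishes, so
  -- zeros spread along edges.
  have hstep : ∀ a b, G.Adj a b → z a = 0 → z b = 0 := by
    intro a b hab ha
    have h4 := h3 a
    simp only [localSum, nbrSum, ha, abs_zero, mul_zero, add_zero] at h4
    rw [sum_eq_zero_iff_of_nonneg fun w _ => abs_nonneg _] at h4
    exact abs_eq_zero.mp (h4 b (by simpa using hab))
  apply hz
  ext w
  obtain ⟨p⟩ := hG.preconnected v w
  induction p with
  | nil => exact hv0
  | cons hadj _ ih =>
    have := hstep _ _ hadj hv0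
    exact ih (by rw [this]; simp) this

end ThetaBasics

/-! ### Relabeling vertices. -/

section Iso

variable {V W : Type*}

theorem comap_connected (e : W ≃ V) {H : SimpleGraph V} (hH : H.Connected) :
    (H.comap e).Connected :=
  (SimpleGraph.Iso.connected_iff (SimpleGraph.Iso.comap e H)).mpr hH

variable [Fintype V] [Fintype W]

theorem nbrSum_comap (e : W ≃ V) (H : SimpleGraph V) (x : V → ℝ) (w : W) :
    nbrSum (H.comap e) (x ∘ e) w = nbrSum H x (e w) := by
  classical
  unfold nbrSum
  have : nbrs H (e w) = (nbrs (H.comap e) w).map e.toEmbedding := by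
    ext v
    simp only [mem_nbrs, mem_map_equiv, comap_adj, Equiv.apply_symm_apply]
  rw [this, sum_map]
  rfl

theorem card_nbrs_comap (e : W ≃ V) (H : SimpleGraph V) (w : W) :
    #(nbrs (H.comap e) w) = #(nbrs H (e w)) := by
  have := nbrSum_comap e H (fun _ => 1) w
  rw [show ((fun _ : V => (1 : ℝ)) ∘ e) = fun _ => 1 from rfl, nbrSum_one, nbrSum_one] at this
  exact_mod_cast this

theorem localSum_comap (α : ℝ) (e : W ≃ V) (H : SimpleGraph V) (x : V → ℝ) (w : W) :
    localSum α (H.comap e) (x ∘ e) w = localSum α H x (e w) := by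
  unfold localSum
  rw [nbrSum_comap, card_nbrs_comap]
  rfl

theorem sum_card_nbrs (H : SimpleGraph V) : ∑ v, #(nbrs H v) = 2 * H.edgeSet.ncard := by
  classical
  have := H.sum_degrees_eq_twice_card_edges
  rw [← coe_edgeFinset, Set.ncard_coe_finset, ← this]
  exact sum_congr rfl fun v _ => card_nbrs H v

end Iso

/-! ### Neighbor sums and degrees in a cone. -/

section Cone

variable {t : ℕ} {W : Type*}

@[simp] theorem cone_adj_inr_inr {H : SimpleGraph W} {a b : W} :
    (cone t H).Adj (Sum.inr a) (Sum.inr b) ↔ H.Adj a b := by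
  simp [cone, join]

@[simp] theorem cone_adj_inl_inl {H : SimpleGraph W} {a b : Fin t} :
    (cone t H).Adj (Sum.inl a) (Sum.inl b) ↔ a ≠ b := by
  simp [cone, join]

@[simp] theorem cone_adj_inl_inr {H : SimpleGraph W} {a : Fin t} {b : W} :
    (cone t H).Adj (Sum.inl a) (Sum.inr b) := by
  simp [cone, join]

@[simp] theorem cone_adj_inr_inl {H : SimpleGraph W} {a : Fin t} {b : W} :
    (cone t H).Adj (Sum.inr b) (Sum.inl a) := by
  simp [cone, join]

theorem cone_connected {H : SimpleGraph W} (hH : H.Connected) : (cone t H).Connected := by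
  obtain ⟨w⟩ := hH.nonempty
  have key : ∀ v, (cone t H).Reachable v (Sum.inr w) := by
    rintro (a | b)
    · exact cone_adj_inl_inr.reachable
    · exact (hH.preconnected b w).map ⟨Sum.inr, fun h => cone_adj_inr_inr.mpr h⟩
  have : Nonempty (Fin t ⊕ W) := ⟨Sum.inr w⟩
  exact ⟨fun a b => (key a).trans (key b).symm⟩

/-- Isomorphic graphs have isomorphic cones. -/
def coneIso {W' : Type*} {H : SimpleGraph W} {H' : SimpleGraph W'} (e : H ≃g H') :
    cone t H ≃g cone t H' where
  toEquiv := Equiv.sumCongr (Equiv.refl _) e.toEquiv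
  map_rel_iff' := by
    rintro (a | a) (b | b) <;> simp [e.map_adj_iff]

variable [Fintype W]

theorem nbrSum_cone_inr (H : SimpleGraph W) (z : Fin t ⊕ W → ℝ) (w : W) :
    nbrSum (cone t H) z (Sum.inr w) =
      ∑ a, z (Sum.inl a) + nbrSum H (z ∘ Sum.inr) w := by
  classical
  unfold nbrSum
  have : nbrs (cone t H) (Sum.inr w) = univ.disjSum (nbrs H w) := by
    ext (a | b) <;> simp
  rw [this, sum_disjSum]
  rfl

theorem nbrSum_cone_inl (H : SimpleGraph W) (z : Fin t ⊕ W → ℝ) (a : Fin t) :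
    nbrSum (cone t H) z (Sum.inl a) =
      ∑ b ∈ univ.erase a, z (Sum.inl b) + ∑ w, z (Sum.inr w) := by
  classical
  unfold nbrSum
  have : nbrs (cone t H) (Sum.inl a) = (univ.erase a).disjSum univ := by
    ext (a | b) <;> simp [eq_comm]
  rw [this, sum_disjSum]

theorem card_nbrs_cone_inr (H : SimpleGraph W) (w : W) :
    #(nbrs (cone t H) (Sum.inr w)) = t + #(nbrs H w) := by
  have := nbrSum_cone_inr (t := t) H (fun _ => 1) w
  rw [show ((fun _ : Fin t ⊕ W => (1 : ℝ)) ∘ Sum.inr) = fun _ => 1 from rfl, nbrSum_one,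
    nbrSum_one] at this
  simp at this
  exact_mod_cast this

theorem card_nbrs_cone_inl (H : SimpleGraph W) (a : Fin t) :
    #(nbrs (cone t H) (Sum.inl a)) = t - 1 + Fintype.card W := by
  have := nbrSum_cone_inl (t := t) H (fun _ => 1) a
  rw [nbrSum_one] at this
  simp only [sum_const, mem_univ, card_erase_of_mem, card_univ, Fintype.card_fin, nsmul_eq_mul,
    mul_one] at this
  exact_mod_cast this

theorem localSum_cone_inr (α : ℝ) (H : SimpleGraph W) (z : Fin t ⊕ W → ℝ) (w : W) :
    localSum α (cone t H) z (Sum.inr w) =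
      localSum α H (z ∘ Sum.inr) w + ∑ a, z (Sum.inl a) + α * t * z (Sum.inr w) := by
  unfold localSum
  rw [nbrSum_cone_inr, card_nbrs_cone_inr]
  push_cast
  simp only [Function.comp]
  ring

/-- An apex is adjacent to everything, so its row does not see the base graph. -/
theorem localSum_cone_inl (α : ℝ) (H H' : SimpleGraph W) (z : Fin t ⊕ W → ℝ) (a : Fin t) :
    localSum α (cone t H) z (Sum.inl a) = localSum α (cone t H') z (Sum.inl a) := by
  unfold localSum
  rw [nbrSum_cone_inl, nbrSum_cone_inl, card_nbrs_cone_inl, card_nbrs_cone_inl]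

end Cone

/-- `H` maximizes the generalized energy of the positive vector `x` among the connected graphs
whose degrees are those of `H` up to a permutation, and `x` satisfies the eigenvalue equations
of a cone over `H`. -/
structure Extremal {V : Type*} [Fintype V] (α : ℝ) (H : SimpleGraph V) (x : V → ℝ) : Prop where
  conn : H.Connected
  pos : ∀ v, 0 < x v
  eig : ∃ μ s : ℝ, 0 ≤ s ∧ ∀ v, localSum α H x v + s = μ * x v
  max : ∀ (H' : SimpleGraph V) (τ : Equiv.Perm V), H'.Connected →
    (∀ v, #(nbrs H' v) = #(nbrs H (τ v))) →
    ∑ v, x v * localSum α H' x v ≤ ∑ v, x v * localSum α H x v ∧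
    (∑ v, x v * localSum α H' x v = ∑ v, x v * localSum α H x v →
      ∀ v, localSum α H' x v = localSum α H x v)

/-- The vector is the Perron vector of `G` restricted to the base. Its form on a competing cone is
at most the competitor's spectral radius times its squared norm, hence at most its form on `G`.
Equality makes it an eigenvector of the competitor for the same eigenvalue. -/
theorem Extremal.of_isThetaMaximal {α : ℝ} {n t : ℕ} {π : Fin n → ℕ}
    {G : SimpleGraph (Fin n)} (hG : IsThetaMaximal α (coneClass n t 2 π) G)
    {H : SimpleGraph (Fin (n - t))} (hH : IsCyclic 2 H) (φ : G ≃g cone t H) :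
    ∃ x, Extremal α H x := by
  classical
  obtain ⟨⟨-, σ, hσ⟩, hmax⟩ := hG
  have hGc : G.Connected := φ.connected_iff.mpr (cone_connected hH.1)
  obtain ⟨z, hzpos, hz⟩ := exists_perron α hGc
  have hn : 0 < n := by
    obtain ⟨v⟩ := hGc.nonempty
    exact v.pos
  set Θ := generalSpectralRadius α G with hΘ
  set Z : Fin t ⊕ Fin (n - t) → ℝ := z ∘ φ.symm with hZ
  have hzZ : z = Z ∘ φ.toEquiv := by
    ext v
    exact congrArg z (φ.symm_apply_apply v).symm
  have hGco : G = (cone t H).comap φ.toEquiv := by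
    ext a b
    exact φ.map_adj_iff.symm
  have hls : ∀ (K : SimpleGraph (Fin (n - t))) (v : Fin n),
      localSum α ((cone t K).comap φ.toEquiv) z v = localSum α (cone t K) Z (φ v) := by
    intro K v
    conv_lhs => rw [hzZ]
    exact localSum_comap α φ.toEquiv _ Z v
  have hsum : ∀ K : SimpleGraph (Fin (n - t)),
      ∑ v, z v * localSum α ((cone t K).comap φ.toEquiv) z v =
      ∑ w, Z w * localSum α (cone t K) Z w := by
    intro K
    rw [← Equiv.sum_comp φ.toEquiv]
    refine sum_congr rfl fun v _ => ?_
    rw [hls, hzZ]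
    rfl
  have heig : ∀ w, localSum α (cone t H) Z w = Θ * Z w := by
    intro w
    have h1 := hls H (φ.symm w)
    rw [← hGco, hz, RelIso.apply_symm_apply] at h1
    exact h1.symm
  refine ⟨Z ∘ Sum.inr, hH.1, fun v => hzpos _, ⟨Θ - α * t, ∑ a, Z (Sum.inl a),
    sum_nonneg fun a _ => (hzpos _).le, fun v => ?_⟩, fun H' τ hc hdeg => ?_⟩
  · have := heig (Sum.inr v)
    rw [localSum_cone_inr] at this
    simp only [Function.comp] at this ⊢
    linarith
  · set G' := (cone t H').comap φ.toEquiv with hG'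
    -- Equal degree sums give equal edge counts, so the competitor is again bicyclic.
    have hedge : H'.edgeSet.ncard = H.edgeSet.ncard := by
      have h1 := sum_card_nbrs H'
      have h2 := sum_card_nbrs H
      rw [← Equiv.sum_comp τ] at h2
      simp only [hdeg] at h1
      omega
    have hmem : G' ∈ coneClass n t 2 π := by
      refine ⟨⟨H', ⟨hc, by rw [hedge]; exact hH.2⟩, ⟨SimpleGraph.Iso.comap φ.toEquiv _⟩⟩, ?_⟩
      let ρ : Equiv.Perm (Fin n) := (φ.toEquiv.trans
        ((Equiv.refl (Fin t)).sumCongr τ)).trans φ.toEquiv.symm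
      have hρ : ∀ v, #(nbrs G' v) = #(nbrs G (ρ v)) := by
        intro v
        rw [hGco, hG', card_nbrs_comap, card_nbrs_comap]
        change #(nbrs (cone t H') (φ v)) = #(nbrs (cone t H) (φ.toEquiv (φ.toEquiv.symm
          ((Equiv.refl (Fin t)).sumCongr τ (φ v)))))
        rw [Equiv.apply_symm_apply]
        rcases φ v with a | b
        · simp only [Equiv.sumCongr_apply, Equiv.coe_refl, Sum.map_inl, id, card_nbrs_cone_inl]
        · simp only [Equiv.sumCongr_apply, Sum.map_inr, card_nbrs_cone_inr, hdeg]
      refine ⟨σ.trans ρ.symm, fun i => ?_⟩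
      rw [← hσ i, ← card_nbrs, ← card_nbrs, hρ]
      simp
    have hle := hmax G' hmem
    obtain ⟨-, h2⟩ := generalSpectralRadius_spec α G' hn
    have hnorm : 0 ≤ ∑ v, z v * z v := sum_nonneg fun v _ => mul_self_nonneg _
    have hquad : ∑ v, z v * localSum α G' z v ≤ Θ * ∑ v, z v * z v :=
      (h2 z).1.trans (mul_le_mul_of_nonneg_right hle hnorm)
    have hGq : ∑ v, z v * localSum α G z v = Θ * ∑ v, z v * z v := by
      rw [mul_sum]
      exact sum_congr rfl fun v _ => by rw [hz]; ring
    -- The apex rows agree, and the apex contributions to the base rows cancel.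
    have hdiff : ∑ v, z v * localSum α G z v - ∑ v, z v * localSum α G' z v =
        ∑ v, (Z ∘ Sum.inr) v * localSum α H (Z ∘ Sum.inr) v -
        ∑ v, (Z ∘ Sum.inr) v * localSum α H' (Z ∘ Sum.inr) v := by
      conv_lhs => rw [hGco]
      rw [hsum, hsum, Fintype.sum_sum_type, Fintype.sum_sum_type]
      simp only [localSum_cone_inr]
      simp only [fun a => localSum_cone_inl α H' H Z a, Function.comp, mul_add, sum_add_distrib]
      ring
    constructor
    · linarith
    · intro heq v
      have hq : ∑ v, z v * localSum α G' z v = Θ * ∑ v, z v * z v := by linarith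
      have hpos : 0 < ∑ v, z v * z v :=
        sum_pos (fun v _ => mul_pos (hzpos v) (hzpos v)) ⟨⟨0, hn⟩, mem_univ _⟩
      have hΘ' : generalSpectralRadius α G' = Θ := by
        refine le_antisymm hle ?_
        have := (h2 z).1
        rw [hq] at this
        exact le_of_mul_le_mul_right this hpos
      have h3 := (h2 z).2 (by rw [hq, hΘ']) (φ.symm (Sum.inr v))
      rw [hΘ', hls, RelIso.apply_symm_apply, localSum_cone_inr] at h3
      have h4 := heig (Sum.inr v)
      rw [localSum_cone_inr] at h4
      have h5 : z (φ.symm (Sum.inr v)) = Z (Sum.inr v) := rfl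
      rw [h5] at h3
      linarith

end ConeGraph

namespace ConeGraph

open SimpleGraph Finset

/-! ### Degree and switching principles for extremal graphs. -/

section Extremal

variable {V : Type*} [Fintype V] {α : ℝ} {H : SimpleGraph V} {x : V → ℝ}

theorem sum_mul_localSum (α : ℝ) (H : SimpleGraph V) (x : V → ℝ) :
    ∑ v, x v * localSum α H x v = energy H x + α * ∑ v, #(nbrs H v) * (x v * x v) := by
  unfold localSum energy
  rw [mul_sum, ← sum_add_distrib]
  exact sum_congr rfl fun v _ => by ring

/-- The private neighbors of `u` exceed those of `v` by the degree difference. If `u` and `v` are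
adjacent or share a neighbor, that connection is never moved. Otherwise one neighbor `q` of `u` on a
path to `v` is kept back, which is affordable because `v` has a private neighbor. -/
theorem exists_movable {u v : V} (hH : H.Connected) (hd : #(nbrs H v) < #(nbrs H u)) :
    ∃ S : Finset V, #S + #(nbrs H v) = #(nbrs H u) ∧ (∀ w ∈ S, H.Adj u w ∧ ¬ H.Adj v w ∧ w ≠ v) ∧
      (H \ starOn u S).Reachable u v := by
  classical
  have huv : u ≠ v := by rintro rfl; exact lt_irrefl _ hd
  set A := (nbrs H u \ nbrs H v).erase v with hA
  have hAmem : ∀ w ∈ A, H.Adj u w ∧ ¬ H.Adj v w ∧ w ≠ v := by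
    intro w hw
    simp only [hA, mem_erase, mem_sdiff, mem_nbrs] at hw
    tauto
  have h1 := card_sdiff_add_card_inter (nbrs H u) (nbrs H v)
  have h2 := card_sdiff_add_card_inter (nbrs H v) (nbrs H u)
  rw [inter_comm] at h2
  have hK : ∀ S ⊆ A, ∀ i j, H.Adj i j → (i = u → j ∉ S) → (j = u → i ∉ S) →
      (H \ starOn u S).Adj i j := by
    intro S hS i j hij hi hj
    refine (sdiff_adj _ _ _ _).mpr ⟨hij, ?_⟩
    rw [starOn_adj fun h => (hAmem u (hS h)).1.ne rfl]
    tauto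
  by_cases hc : H.Adj u v ∨ ∃ w, H.Adj u w ∧ H.Adj w v
  · have hcard : #(nbrs H u) - #(nbrs H v) ≤ #A := by
      by_cases hadj : H.Adj u v
      · have h3 : v ∈ nbrs H u \ nbrs H v := by simpa using hadj
        have h4 : u ∈ nbrs H v \ nbrs H u := by simpa using hadj.symm
        rw [hA, card_erase_of_mem h3]
        have := card_pos.mpr ⟨u, h4⟩
        omega
      · rw [hA, erase_eq_of_notMem (by simpa using hadj)]
        omega
    obtain ⟨S, hS, hSc⟩ := exists_subset_card_eq hcard
    refine ⟨S, by omega, fun w hw => hAmem w (hS hw), ?_⟩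
    rcases hc with hc | ⟨w, hw1, hw2⟩
    · refine (hK S hS u v hc (fun _ h => (hAmem v (hS h)).2.2 rfl) fun h => absurd h huv.symm).reachable
    · refine (hK S hS u w hw1 (fun _ h => (hAmem w (hS h)).2.1 hw2.symm)
        fun h => absurd h hw1.ne').reachable.trans
        (hK S hS w v hw2 (fun h => absurd h hw1.ne') fun h => absurd h huv.symm).reachable
  · push Not at hc
    obtain ⟨q, hq1, hq2⟩ := exists_adj_reachable_avoiding (hH.preconnected v u) huv.symm
    have hcard : #(nbrs H u) - #(nbrs H v) ≤ #(A.erase q) := by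
      obtain ⟨w, hw, -⟩ := exists_adj_reachable_avoiding (hH.preconnected u v) huv
      have h4 : w ∈ nbrs H v \ nbrs H u := by
        simp only [mem_sdiff, mem_nbrs]
        exact ⟨hw, fun h => hc.2 w h hw.symm⟩
      have := card_pos.mpr ⟨w, h4⟩
      have h5 : #A = #(nbrs H u \ nbrs H v) := by
        rw [hA, erase_eq_of_notMem (by simpa using fun h => absurd h hc.1)]
      have := pred_card_le_card_erase (s := A) (a := q)
      omega
    obtain ⟨S, hS, hSc⟩ := exists_subset_card_eq hcard
    have hSA : S ⊆ A := hS.trans (erase_subset _ _)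
    refine ⟨S, by omega, fun w hw => hAmem w (hSA hw), ?_⟩
    refine (hK S hSA u q hq1 (fun _ h => (mem_erase.mp (hS h)).1 rfl)
      fun h => absurd h hq1.ne').reachable.trans (hq2 _ fun i j hij hi hj => ?_)
    exact hK S hSA i j hij (fun h => absurd h hi) fun h => absurd h hj

/-- Moving the excess neighbors of `u` to `v` interchanges the two degrees. If `x u ≤ x v`, the form
does not decrease, so by maximality the local sums are unchanged. But `v` has gained neighbors with
positive entries. -/
theorem Extremal.lt_of_card_nbrs_lt (hα : 0 ≤ α) (h : Extremal α H x) {u v : V}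
    (hd : #(nbrs H v) < #(nbrs H u)) : x v < x u := by
  classical
  by_contra! hle
  obtain ⟨S, hS1, hS2, hS3⟩ := exists_movable h.conn hd
  have huv : u ≠ v := by rintro rfl; exact lt_irrefl _ hd
  have huS : u ∉ S := fun hu => (hS2 u hu).1.ne rfl
  have hvS : v ∉ S := fun hv => (hS2 v hv).2.2 rfl
  have hR : starOn u S ≤ H := by
    intro i j hij
    rw [starOn_adj huS] at hij
    rcases hij with ⟨rfl, hj⟩ | ⟨rfl, hi⟩
    · exact (hS2 j hj).1
    · exact (hS2 i hi).1.symm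
  have hA : Disjoint H (starOn v S) := by
    rw [SimpleGraph.disjoint_left]
    intro i j hij hij'
    rw [starOn_adj hvS] at hij'
    rcases hij' with ⟨rfl, hj⟩ | ⟨rfl, hi⟩
    · exact (hS2 j hj).2.1 hij
    · exact (hS2 i hi).2.1 hij.symm
  set H' := H \ starOn u S ⊔ starOn v S with hH'
  have hns : ∀ (y : V → ℝ) i, nbrSum H' y i = nbrSum H y i - ((if i = u then ∑ w ∈ S, y w else 0) +
      if i ∈ S then y u else 0) + ((if i = v then ∑ w ∈ S, y w else 0) +
      if i ∈ S then y v else 0) := by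
    intro y i
    rw [hH', nbrSum_modify hR hA, nbrSum_starOn huS, nbrSum_starOn hvS]
  have hle' : H \ starOn u S ≤ H' := le_sup_left
  have hconn : H'.Connected := by
    refine connected_of_adj_reachable h.conn fun i j hij => ?_
    have hstar : ∀ w ∈ S, H'.Reachable u w := fun w hw => (hS3.mono hle').trans
      (Adj.reachable (Or.inr ((starOn_adj hvS).mpr (Or.inl ⟨rfl, hw⟩))))
    by_cases he : (starOn u S).Adj i j
    · rw [starOn_adj huS] at he
      rcases he with ⟨rfl, hj⟩ | ⟨rfl, hi⟩
      · exact hstar j hj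
      · exact (hstar i hi).symm
    · exact (Adj.reachable (show (H \ starOn u S).Adj i j from
        (sdiff_adj _ _ _ _).mpr ⟨hij, he⟩)).mono hle'
  have hdeg' : ∀ i, (#(nbrs H' i) : ℝ) = #(nbrs H i) - (if i = u then (#S : ℝ) else 0) +
      if i = v then (#S : ℝ) else 0 := by
    intro i
    have := hns (fun _ => 1) i
    simp only [nbrSum_one, sum_const, nsmul_eq_mul, mul_one] at this
    linarith
  have hS1' : (#S : ℝ) + #(nbrs H v) = #(nbrs H u) := by exact_mod_cast hS1
  have hdeg : ∀ i, #(nbrs H' i) = #(nbrs H (Equiv.swap u v i)) := by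
    intro i
    have h1 := hdeg' i
    have : (#(nbrs H' i) : ℝ) = #(nbrs H (Equiv.swap u v i)) := by
      by_cases hiu : i = u
      · subst hiu
        rw [Equiv.swap_apply_left, h1]
        simp only [if_pos, if_neg huv]
        linarith
      · by_cases hiv : i = v
        · subst hiv
          rw [Equiv.swap_apply_right, h1]
          simp only [if_pos, if_neg hiu]
          linarith
        · rw [Equiv.swap_apply_of_ne_of_ne hiu hiv, h1]
          simp [hiu, hiv]
    exact_mod_cast this
  have hSne : S.Nonempty := by
    rw [← card_pos]
    omega
  have hSpos : 0 < ∑ w ∈ S, x w := sum_pos (fun w _ => h.pos w) hSne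
  obtain ⟨h1, h2⟩ := h.max H' (Equiv.swap u v) hconn hdeg
  -- The second term of the gain is `α #S (x v ^ 2 - x u ^ 2)`, which comes from the changed
  -- degrees.
  have hen : ∑ w, x w * localSum α H' x w = ∑ w, x w * localSum α H x w +
      (2 * ((x v - x u) * ∑ w ∈ S, x w) + α * #S * ((x v + x u) * (x v - x u))) := by
    rw [sum_mul_localSum, sum_mul_localSum, hH', energy_modify hR hA, energy_starOn huS,
      energy_starOn hvS, ← hH']
    simp only [hdeg', add_mul, sub_mul, sum_add_distrib, sum_sub_distrib, ite_mul, zero_mul,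
      sum_ite_eq', mem_univ, if_true]
    ring
  have hnn : 0 ≤ 2 * ((x v - x u) * ∑ w ∈ S, x w) + α * #S * ((x v + x u) * (x v - x u)) := by
    have := h.pos u
    have := h.pos v
    have : 0 ≤ x v - x u := by linarith
    positivity
  have h3 := h2 (by linarith) v
  unfold localSum at h3
  rw [hns, hdeg'] at h3
  simp only [if_neg huv.symm, if_pos, if_neg hvS] at h3
  have : 0 ≤ α * #S * x v := by
    have := h.pos v
    positivity
  linarith

theorem Extremal.comap {W : Type*} [Fintype W] (h : Extremal α H x) (e : W ≃ V) :
    Extremal α (H.comap e) (x ∘ e) where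
  conn := comap_connected e h.conn
  pos w := h.pos _
  eig := by
    obtain ⟨μ, s, hs, h1⟩ := h.eig
    exact ⟨μ, s, hs, fun w => by rw [localSum_comap, h1]; rfl⟩
  max H' τ hc hd := by
    have hx : x = (x ∘ e) ∘ e.symm := by
      ext v
      simp
    have hls : ∀ v, localSum α (H'.comap e.symm) x v = localSum α H' (x ∘ e) (e.symm v) := by
      intro v
      conv_lhs => rw [hx]
      exact localSum_comap α e.symm H' (x ∘ e) v
    have h1 : ∑ v, x v * localSum α (H'.comap e.symm) x v =
        ∑ w, (x ∘ e) w * localSum α H' (x ∘ e) w := by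
      rw [← Equiv.sum_comp e]
      simp [hls]
    have h2 : ∑ v, x v * localSum α H x v =
        ∑ w, (x ∘ e) w * localSum α (H.comap e) (x ∘ e) w := by
      rw [← Equiv.sum_comp e]
      simp [localSum_comap]
    obtain ⟨h3, h4⟩ := h.max (H'.comap e.symm) ((e.symm.trans τ).trans e)
      (comap_connected e.symm hc) (fun v => by
        rw [card_nbrs_comap, hd, card_nbrs_comap]
        rfl)
    rw [h1, h2] at h3 h4
    refine ⟨h3, fun heq w => ?_⟩
    have := h4 heq (e w)
    rw [hls] at this
    rw [localSum_comap, ← this]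
    simp

/-- With equal degrees, equal energy means that `K` attains the same maximum. The equality clause
then gives the same local sums, so `K` inherits the eigenvalue equations and the extremality. -/
theorem Extremal.of_energy_eq (h : Extremal α H x) {K : SimpleGraph V} (hK : K.Connected)
    (hd : ∀ v, #(nbrs K v) = #(nbrs H v)) (he : energy K x = energy H x) :
    Extremal α K x ∧ ∀ v, nbrSum K x v = nbrSum H x v := by
  have h1 : ∑ v, x v * localSum α K x v = ∑ v, x v * localSum α H x v := by
    simp only [sum_mul_localSum, hd, he]
  have h2 := (h.max K (Equiv.refl V) hK hd).2 h1
  refine ⟨⟨hK, h.pos, ?_, fun H' τ hc hd' => ?_⟩, fun v => ?_⟩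
  · obtain ⟨μ, s, hs, h3⟩ := h.eig
    exact ⟨μ, s, hs, fun v => by rw [h2, h3]⟩
  · have := h.max H' τ hc fun v => by rw [hd', hd]
    rw [h1]
    simpa only [h2] using this
  · have := h2 v
    unfold localSum at this
    rw [hd] at this
    linarith

/-- Maximality makes the energy change zero, and then the neighbor sums cannot change. At `u` the
change is `x b - x v`, at `v` it is `x a - x u`. Both differences vanish, not only their product. -/
theorem Extremal.switch_eq (h : Extremal α H x) {u v a b : V} (hs : Switchable H u v a b)
    (hr : (H \ twoEdges u v a b).Reachable u a ∨ (H \ twoEdges u v a b).Reachable v b)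
    (hnn : 0 ≤ (x u - x a) * (x b - x v)) : x u = x a ∧ x b = x v := by
  classical
  have hc := hs.connected h.conn hr
  have hd := hs.card_nbrs_eq
  have h1 := (h.max _ (Equiv.refl V) hc hd).1
  simp only [sum_mul_localSum, hd, hs.energy_eq] at h1
  have h2 := (h.of_energy_eq hc hd (by rw [hs.energy_eq]; linarith)).2
  have hu := h2 u
  have hv := h2 v
  rw [hs.nbrSum_eq] at hu hv
  have h3 := hs.uv.ne
  have h4 := hs.ne_ub
  have h5 := hs.ne_av
  have h6 := hs.ne_ua
  have h7 := hs.ne_vb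
  simp [h3, h4, h6] at hu
  simp [h3.symm, h5.symm, h7] at hv
  constructor <;> linarith

/-- This is the source of the breadth-first structure. The larger entry at `y` gives `y` at least
the degree of `v`, so a connected switch exists, and it would increase the energy unless its fourth
vertex has a larger entry than `u`. -/
theorem Extremal.exists_adj_lt (hα : 0 ≤ α) (h : Extremal α H x) {u v y : V} (huv : H.Adj u v)
    (huy : ¬ H.Adj u y) (hyu : y ≠ u) (hlt : x v < x y) : ∃ c, H.Adj y c ∧ x u < x c := by
  have hyv : y ≠ v := by rintro rfl; exact lt_irrefl _ hlt
  have hd : #(nbrs H v) ≤ #(nbrs H y) := by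
    by_contra! hd
    exact (h.lt_of_card_nbrs_lt hα hd).not_gt hlt
  obtain ⟨c, hs, hr⟩ := exists_switchable h.conn huv huy hyu hyv hd
  refine ⟨c, hs.ab.symm, ?_⟩
  by_contra! hcu
  have := h.switch_eq hs hr (mul_nonneg (by linarith) (by linarith))
  linarith [this.2]

end Extremal

/-! ### Stable graphs and breadth-first orderings. -/

section Ordered

variable {N : ℕ} {α : ℝ} {H K : SimpleGraph (Fin N)} {x : Fin N → ℝ}

/-- No switch of two edges that preserves connectedness moves edges towards smaller indices. -/
def Stable (K : SimpleGraph (Fin N)) : Prop :=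
  ∀ u v a b, Switchable K u v a b → u < a → b < v →
    ¬ ((K \ twoEdges u v a b).Reachable u a ∨ (K \ twoEdges u v a b).Reachable v b)

/-- Among the connected graphs with the same degrees and the same energy of `x`, take one that
maximizes the energy of the weight `-i`. A switch toward smaller indices does not lower the energy
of `x`, so by `Extremal.switch_eq` it preserves it, and it would strictly raise the second energy.
-/
theorem Extremal.exists_stable (h : Extremal α H x) (hx : Antitone x) :
    ∃ K, Extremal α K x ∧ Stable K ∧ (∀ v, #(nbrs K v) = #(nbrs H v)) ∧
      ∀ v, nbrSum K x v = nbrSum H x v := by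
  classical
  let z : Fin N → ℝ := fun i => -(i.val : ℝ)
  let 𝒮 : Set (SimpleGraph (Fin N)) :=
    {K | K.Connected ∧ (∀ v, #(nbrs K v) = #(nbrs H v)) ∧ energy K x = energy H x}
  have hfin : 𝒮.Finite := Set.toFinite _
  obtain ⟨K, ⟨hK1, hK2, hK3⟩, hmax⟩ := Set.exists_max_image 𝒮 (fun K => energy K z) hfin
    ⟨H, h.conn, fun _ => rfl, rfl⟩
  obtain ⟨h1, h2⟩ := h.of_energy_eq hK1 hK2 hK3
  refine ⟨K, h1, ?_, hK2, h2⟩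
  intro u v a b hs hua hbv hr
  obtain ⟨h3, h4⟩ := h1.switch_eq hs hr
    (mul_nonneg (sub_nonneg.mpr (hx hua.le)) (sub_nonneg.mpr (hx hbv.le)))
  have h5 := hmax (switch K u v a b) ⟨hs.connected hK1 hr, fun w => by rw [hs.card_nbrs_eq, hK2],
    by rw [hs.energy_eq, hK3, h3]; ring⟩
  simp only [hs.energy_eq] at h5
  have h6 : 0 < z u - z a := by
    simp only [z]
    have : (u.val : ℝ) < a.val := by exact_mod_cast hua
    linarith
  have h7 : 0 < z b - z v := by
    simp only [z]
    have : (b.val : ℝ) < v.val := by exact_mod_cast hbv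
    linarith
  have := mul_pos h6 h7
  linarith

theorem Extremal.antitone_card (hα : 0 ≤ α) (h : Extremal α H x) (hx : Antitone x) :
    Antitone fun i => #(nbrs H i) := by
  intro i j hij
  by_contra! hd
  exact (h.lt_of_card_nbrs_lt hα hd).not_ge (hx hij)

theorem Stable.exists_adj_lt (hK : Stable K) (hc : K.Connected)
    (hd : Antitone fun i => #(nbrs K i)) {u v y : Fin N} (huv : K.Adj u v) (huy : ¬ K.Adj u y)
    (hyu : y ≠ u) (hlt : y < v) : ∃ c < u, K.Adj y c ∧ ¬ K.Adj v c := by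
  obtain ⟨c, hs, hr⟩ := exists_switchable hc huv huy hyu hlt.ne (hd hlt.le)
  refine ⟨c, ?_, hs.ab.symm, fun h => hs.av h.symm⟩
  by_contra! hcu
  exact hK u v c y hs (lt_of_le_of_ne hcu hs.ne_ua) hlt hr

/-- Every vertex but the first has an earlier neighbor, and the first neighbors are
non-decreasing along the ordering. -/
def BFSOrdered (K : SimpleGraph (Fin N)) : Prop :=
  (∀ i : Fin N, 0 < i.val → ∃ a < i, K.Adj a i) ∧
    ∀ i j a : Fin N, 0 < i.val → i < j → K.Adj a j → ∃ c ≤ a, K.Adj c i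

/-- A single forbidden configuration covers both clauses: `u` is adjacent to a vertex after `y`
although `y` has no neighbor up to `u`. The last assumption lets the tie-breaking argument treat the
first bad `y` only. -/
theorem bfsOrdered_of_forall (hc : K.Connected)
    (h : ∀ u v y : Fin N, K.Adj u v → 0 < y.val → y < v → y ≠ u → (∀ c ≤ u, ¬ K.Adj c y) →
      (∀ l < y, 0 < l.val → ∃ a < l, K.Adj a l) → False) : BFSOrdered K := by
  have h1 : ∀ i : Fin N, 0 < i.val → ∃ a < i, K.Adj a i := by
    intro i
    induction i using WellFoundedLT.induction with
    | _ i ih =>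
      intro hi
      by_contra! hno
      let z : Fin N := ⟨0, i.pos⟩
      obtain ⟨p⟩ := hc.preconnected z i
      -- A walk from the first vertex to `i` must leave the set of vertices before `i`. As `i` has
      -- no earlier neighbor, it leaves to a vertex after `i`.
      obtain ⟨d, -, hd1, hd2⟩ := p.exists_boundary_dart {l | l < i} (show z < i from hi)
        (lt_irrefl i)
      change d.fst < i at hd1
      change ¬ d.snd < i at hd2
      have hne : i ≠ d.snd := fun he => hno _ hd1 (he ▸ d.adj)
      exact h d.fst d.snd i d.adj hi (lt_of_le_of_ne (not_lt.mp hd2) hne) hd1.ne'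
        (fun c hc' => hno c (lt_of_le_of_lt hc' hd1)) ih
  refine ⟨h1, fun i j a hi hij haj => ?_⟩
  by_contra! hno
  refine h a j i haj hi hij ?_ hno fun l _ => h1 l
  rintro rfl
  obtain ⟨c, hc1, hc2⟩ := h1 i hi
  exact hno c hc1.le hc2

theorem Stable.bfsOrdered (hK : Stable K) (hc : K.Connected)
    (hd : Antitone fun i => #(nbrs K i)) : BFSOrdered K := by
  refine bfsOrdered_of_forall hc fun u v y huv _ hyv hyu hno _ => ?_
  obtain ⟨c, hc1, hc2, -⟩ := hK.exists_adj_lt hc hd huv (hno u le_rfl) hyu hyv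
  exact hno c hc1.le hc2.symm

/-- The index of the first neighbor (and `0` for the first vertex). -/
noncomputable def firstNbr (K : SimpleGraph (Fin N)) (i : Fin N) : ℕ :=
  if i.val = 0 then 0 else sInf {c | ∃ a : Fin N, a.val = c ∧ K.Adj a i}

theorem firstNbr_le {a i : Fin N} (h : K.Adj a i) (hi : 0 < i.val) : firstNbr K i ≤ a.val := by
  rw [firstNbr, if_neg hi.ne']
  exact Nat.sInf_le ⟨a, rfl, h⟩

theorem exists_firstNbr {a i : Fin N} (h : K.Adj a i) (hi : 0 < i.val) :
    ∃ c : Fin N, c.val = firstNbr K i ∧ K.Adj c i := by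
  rw [firstNbr, if_neg hi.ne']
  exact Nat.sInf_mem (s := {c | ∃ a : Fin N, a.val = c ∧ K.Adj a i}) ⟨_, a, rfl, h⟩

/-- Among the renumberings that preserve `x`, take one for which the sequence of first neighbors is
lexicographically least. Strict inequalities in `x` are handled by the switching principle, ties by
this minimality. -/
theorem Extremal.exists_bfsOrdered (hα : 0 ≤ α) (h : Extremal α H x) (hx : Antitone x) :
    ∃ e : Equiv.Perm (Fin N), x ∘ e = x ∧ BFSOrdered (H.comap e) := by
  classical
  obtain ⟨e, he, hmin⟩ := Finset.exists_min_image
    (univ.filter fun e : Equiv.Perm (Fin N) => x ∘ e = x)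
    (fun e => toLex fun i => firstNbr (H.comap e) i) ⟨Equiv.refl _, by simp⟩
  have hxe : x ∘ e = x := (mem_filter.mp he).2
  refine ⟨e, hxe, ?_⟩
  have hK : Extremal α (H.comap e) x := by
    have := h.comap e
    rwa [hxe] at this
  set K := H.comap e with hKdef
  refine bfsOrdered_of_forall hK.conn fun u v y huv hy hyv hyu hno hl => ?_
  have hle := hx hyv.le
  rcases hle.lt_or_eq with hlt | heq
  · obtain ⟨c, hc1, hc2⟩ := hK.exists_adj_lt hα huv (hno u le_rfl) hyu hlt
    refine hno c ?_ hc1.symm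
    by_contra! hcu
    exact (hx hcu.le).not_gt hc2
  -- In a tie, interchanging `y` and `v` leaves the first neighbors before `y` unchanged and lowers
  -- that of `y` to at most `u`.
  · let e' : Equiv.Perm (Fin N) := (Equiv.swap y v).trans e
    have hcomap : H.comap e' = K.comap (Equiv.swap y v) := rfl
    have hmem : e' ∈ univ.filter fun e : Equiv.Perm (Fin N) => x ∘ e = x := by
      refine mem_filter.mpr ⟨mem_univ _, ?_⟩
      ext i
      have : x (e (Equiv.swap y v i)) = x (Equiv.swap y v i) := congrFun hxe _
      change x (e (Equiv.swap y v i)) = x i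
      rw [this]
      rcases eq_or_ne i y with rfl | h1
      · rw [Equiv.swap_apply_left, heq]
      · rcases eq_or_ne i v with rfl | h2
        · rw [Equiv.swap_apply_right, heq]
        · rw [Equiv.swap_apply_of_ne_of_ne h1 h2]
    have hfix : ∀ i, i < y → Equiv.swap y v i = i := fun i hi =>
      Equiv.swap_apply_of_ne_of_ne hi.ne (hi.trans hyv).ne
    refine (hmin e' hmem).not_gt ?_
    rw [hcomap]
    refine ⟨y, fun l hly => ?_, ?_⟩
    · change firstNbr (K.comap (Equiv.swap y v)) l = firstNbr K l
      rcases Nat.eq_zero_or_pos l.val with hl0 | hl0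
      · simp [firstNbr, hl0]
      · obtain ⟨a, hal, ha⟩ := hl l hly hl0
        have ha' : (K.comap (Equiv.swap y v)).Adj a l := by
          rw [comap_adj, hfix l hly, hfix a (hal.trans hly)]
          exact ha
        refine le_antisymm ?_ ?_
        · obtain ⟨c, hc1, hc2⟩ := exists_firstNbr ha hl0
          have hcl : c < l := by
            have := firstNbr_le ha hl0
            rw [← hc1] at this
            exact lt_of_le_of_lt this hal
          rw [← hc1]
          refine firstNbr_le ?_ hl0
          rw [comap_adj, hfix l hly, hfix c (hcl.trans hly)]
          exact hc2
        · obtain ⟨c, hc1, hc2⟩ := exists_firstNbr ha' hl0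
          have hcl : c < l := by
            have := firstNbr_le ha' hl0
            rw [← hc1] at this
            exact lt_of_le_of_lt this hal
          rw [← hc1]
          refine firstNbr_le ?_ hl0
          rw [comap_adj, hfix l hly, hfix c (hcl.trans hly)] at hc2
          exact hc2
    · change firstNbr (K.comap (Equiv.swap y v)) y < firstNbr K y
      have h1 : firstNbr (K.comap (Equiv.swap y v)) y ≤ u.val := by
        refine firstNbr_le ?_ hy
        rw [comap_adj, Equiv.swap_apply_left, Equiv.swap_apply_of_ne_of_ne hyu.symm huv.ne]
        exact huv
      refine lt_of_le_of_lt h1 ?_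
      obtain ⟨c, hc⟩ : ∃ c, K.Adj c y := by
        have : Nontrivial (Fin N) := ⟨y, v, hyv.ne⟩
        obtain ⟨c, hc⟩ := hK.conn.preconnected.exists_adj_of_nontrivial y
        exact ⟨c, hc.symm⟩
      obtain ⟨c, hc1, hc2⟩ := exists_firstNbr hc hy
      rw [← hc1]
      by_contra! hcu
      exact hno c hcu hc2

end Ordered

end ConeGraph

namespace ConeGraph

open Finset

/-! ### Breadth-first trees with two extra edges -/

/-- The number of children of `i` in the tree with parent function `p`. -/
def childCount (N : ℕ) (p : ℕ → ℕ) (i : ℕ) : ℕ := #{j ∈ range N | 0 < j ∧ p j = i}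

/-- The number of vertices whose parent is less than `u`. -/
def childrenBefore (N : ℕ) (p : ℕ → ℕ) (u : ℕ) : ℕ := #{j ∈ range N | 0 < j ∧ p j < u}

/-- A breadth-first tree on `0, …, N - 1` with parent function `p` together with the two extra
edges `a₁b₁` and `a₂b₂`, having degrees `d`. -/
structure Shape (N : ℕ) (p d : ℕ → ℕ) (a₁ b₁ a₂ b₂ : ℕ) : Prop where
  p_lt : ∀ j, 0 < j → j < N → p j < j
  p_mono : ∀ i j, 0 < i → i ≤ j → j < N → p i ≤ p j
  p_lt₁ : p b₁ < a₁
  lt₁ : a₁ < b₁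
  lt_N₁ : b₁ < N
  p_lt₂ : p b₂ < a₂
  lt₂ : a₂ < b₂
  lt_N₂ : b₂ < N
  ne : ¬ (a₁ = a₂ ∧ b₁ = b₂)
  anti : ∀ i j, i ≤ j → j < N → d j ≤ d i
  deg : ∀ i < N, d i = childCount N p i + (if 0 < i then 1 else 0) + (if i = a₁ then 1 else 0) +
    (if i = b₁ then 1 else 0) + (if i = a₂ then 1 else 0) + (if i = b₂ then 1 else 0)

/-- Adjacency in a `Shape`. -/
def ShapeAdj (N : ℕ) (p : ℕ → ℕ) (a₁ b₁ a₂ b₂ i j : ℕ) : Prop :=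
  (i < j ∧ j < N ∧ (i = p j ∨ (i = a₁ ∧ j = b₁) ∨ (i = a₂ ∧ j = b₂))) ∨
  (j < i ∧ i < N ∧ (j = p i ∨ (j = a₁ ∧ i = b₁) ∨ (j = a₂ ∧ i = b₂)))

theorem shapeAdj_swap {N : ℕ} {p : ℕ → ℕ} {a₁ b₁ a₂ b₂ i j : ℕ} :
    ShapeAdj N p a₁ b₁ a₂ b₂ i j ↔ ShapeAdj N p a₂ b₂ a₁ b₁ i j := by
  unfold ShapeAdj
  tauto

theorem shapeAdj_comm {N : ℕ} {p : ℕ → ℕ} {a₁ b₁ a₂ b₂ i j : ℕ} :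
    ShapeAdj N p a₁ b₁ a₂ b₂ i j ↔ ShapeAdj N p a₁ b₁ a₂ b₂ j i := by
  unfold ShapeAdj
  tauto

namespace Shape

variable {N : ℕ} {p d : ℕ → ℕ} {a₁ b₁ a₂ b₂ : ℕ}

theorem swap (h : Shape N p d a₁ b₁ a₂ b₂) : Shape N p d a₂ b₂ a₁ b₁ where
  p_lt := h.p_lt
  p_mono := h.p_mono
  p_lt₁ := h.p_lt₂
  lt₁ := h.lt₂
  lt_N₁ := h.lt_N₂
  p_lt₂ := h.p_lt₁
  lt₂ := h.lt₁
  lt_N₂ := h.lt_N₁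
  ne := fun hh => h.ne ⟨hh.1.symm, hh.2.symm⟩
  anti := h.anti
  deg := fun i hi => by rw [h.deg i hi]; ring

/-- As `p` is monotone, the vertices with parent below `u` are exactly `1, …, childrenBefore N p u`.
So the counts of children determine `p`. -/
theorem p_lt_iff (h : Shape N p d a₁ b₁ a₂ b₂) {u j : ℕ} (hj : 0 < j) (hjN : j < N) :
    p j < u ↔ j ≤ childrenBefore N p u := by
  unfold childrenBefore
  constructor
  · intro hu
    have : Ioc 0 j ⊆ {j ∈ range N | 0 < j ∧ p j < u} := by
      intro i hi
      rw [mem_Ioc] at hi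
      rw [mem_filter, mem_range]
      exact ⟨by omega, hi.1, lt_of_le_of_lt (h.p_mono i j hi.1 hi.2 hjN) hu⟩
    simpa using card_le_card this
  · intro hle
    by_contra! hu
    have : {j ∈ range N | 0 < j ∧ p j < u} ⊆ Ioo 0 j := by
      intro i hi
      rw [mem_filter, mem_range] at hi
      rw [mem_Ioo]
      refine ⟨hi.2.1, ?_⟩
      by_contra! hji
      have := h.p_mono j i hj hji hi.1
      omega
    have := card_le_card this
    rw [Nat.card_Ioo] at this
    omega

theorem childrenBefore_succ (N : ℕ) (p : ℕ → ℕ) (u : ℕ) :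
    childrenBefore N p (u + 1) = childrenBefore N p u + childCount N p u := by
  unfold childrenBefore childCount
  rw [← card_union_of_disjoint]
  · congr 1
    ext j
    simp only [mem_filter, mem_union, mem_range]
    omega
  · rw [disjoint_left]
    intro j h1 h2
    rw [mem_filter] at h1 h2
    omega

theorem childrenBefore_zero (N : ℕ) (p : ℕ → ℕ) : childrenBefore N p 0 = 0 := by
  simp [childrenBefore]

theorem childrenBefore_lt (N : ℕ) (p : ℕ → ℕ) (u : ℕ) (hN : 0 < N) : childrenBefore N p u < N := by
  unfold childrenBefore
  have : {j ∈ range N | 0 < j ∧ p j < u} ⊆ Ioo 0 N := by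
    intro i hi
    rw [mem_filter, mem_range] at hi
    rw [mem_Ioo]
    exact ⟨hi.2.1, hi.1⟩
  have := card_le_card this
  rw [Nat.card_Ioo] at this
  omega

theorem p_eq_iff (h : Shape N p d a₁ b₁ a₂ b₂) {u j : ℕ} (hj : 0 < j) (hjN : j < N) :
    p j = u ↔ childrenBefore N p u < j ∧ j ≤ childrenBefore N p (u + 1) := by
  rw [← h.p_lt_iff hj hjN, ← not_le, ← h.p_lt_iff hj hjN]
  omega

theorem p_eq_of_le (h : Shape N p d a₁ b₁ a₂ b₂) {u j : ℕ} (hjN : j < N)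
    (h1 : childrenBefore N p u < j) (h2 : j ≤ childrenBefore N p u + childCount N p u) :
    p j = u :=
  (h.p_eq_iff (by omega) hjN).mpr ⟨h1, by rwa [childrenBefore_succ]⟩

theorem N_pos (h : Shape N p d a₁ b₁ a₂ b₂) : 0 < N := by
  have := h.lt_N₁
  omega

/-- A vertex with at least one child has `childrenBefore + 1` as its first child. -/
theorem exists_child (h : Shape N p d a₁ b₁ a₂ b₂) {u : ℕ} (hu : 0 < childCount N p u) :
    ∃ r, u < r ∧ r < N ∧ p r = u := by
  have h1 := childrenBefore_succ N p u
  have h2 := childrenBefore_lt N p (u + 1) h.N_pos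
  have h3 := (h.p_eq_iff (u := u) (j := childrenBefore N p u + 1) (by omega) (by omega)).mpr
    ⟨by omega, by omega⟩
  refine ⟨_, ?_, by omega, h3⟩
  have := h.p_lt (childrenBefore N p u + 1) (by omega) (by omega)
  omega

/-- The root lies on no extra edge, since the smaller end of such an edge exceeds the parent of the
larger one. -/
theorem childCount_zero (h : Shape N p d a₁ b₁ a₂ b₂) : childCount N p 0 = d 0 := by
  have h1 := h.deg 0 h.N_pos
  have := h.p_lt₁; have := h.p_lt₂; have := h.lt₁; have := h.lt₂
  simp only [lt_irrefl, if_false] at h1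
  split_ifs at h1 <;> omega

theorem childrenBefore_one (h : Shape N p d a₁ b₁ a₂ b₂) : childrenBefore N p 1 = d 0 := by
  rw [childrenBefore_succ N p 0, childrenBefore_zero, h.childCount_zero, zero_add]

theorem childrenBefore_mono (N : ℕ) (p : ℕ → ℕ) : Monotone (childrenBefore N p) :=
  monotone_nat_of_le_succ fun u => by rw [childrenBefore_succ]; omega

theorem p_eq_zero_iff (h : Shape N p d a₁ b₁ a₂ b₂) {j : ℕ} (hj : 0 < j) (hjN : j < N) :
    p j = 0 ↔ j ≤ d 0 := by
  rw [h.p_eq_iff hj hjN, childrenBefore_zero, h.childrenBefore_one]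
  omega

theorem childrenBefore_two (h : Shape N p d a₁ b₁ a₂ b₂) :
    childrenBefore N p 2 = d 0 + childCount N p 1 := by
  rw [childrenBefore_succ N p 1, h.childrenBefore_one]

theorem childrenBefore_three (h : Shape N p d a₁ b₁ a₂ b₂) :
    childrenBefore N p 3 = d 0 + childCount N p 1 + childCount N p 2 := by
  rw [childrenBefore_succ N p 2, h.childrenBefore_two]

theorem childrenBefore_four (h : Shape N p d a₁ b₁ a₂ b₂) :
    childrenBefore N p 4 = d 0 + childCount N p 1 + childCount N p 2 + childCount N p 3 := by
  rw [childrenBefore_succ N p 3, h.childrenBefore_three]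

theorem d_zero_lt (h : Shape N p d a₁ b₁ a₂ b₂) : d 0 < N := by
  rw [← h.childrenBefore_one]
  exact childrenBefore_lt N p 1 h.N_pos

/-- The degree of a vertex that is not on an extra edge. -/
theorem childCount_eq (h : Shape N p d a₁ b₁ a₂ b₂) {u : ℕ} (hu : 0 < u) (huN : u < N)
    (h1 : u ≠ a₁) (h2 : u ≠ b₁) (h3 : u ≠ a₂) (h4 : u ≠ b₂) : childCount N p u + 1 = d u := by
  rw [h.deg u huN]
  simp [hu, h1, h2, h3, h4]

theorem two_le_d_b₁ (h : Shape N p d a₁ b₁ a₂ b₂) : 2 ≤ d b₁ := by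
  have h1 := h.deg b₁ h.lt_N₁
  have := h.p_lt₁; have := h.lt₁
  rw [if_pos (show 0 < b₁ by omega), if_pos (show b₁ = b₁ from rfl)] at h1
  omega

theorem two_le_d (h : Shape N p d a₁ b₁ a₂ b₂) {i : ℕ} (hi : i ≤ b₁) : 2 ≤ d i :=
  h.two_le_d_b₁.trans (h.anti i b₁ hi h.lt_N₁)

/-- If all vertices in an interval have children, `childrenBefore` grows. -/
theorem le_childrenBefore {N : ℕ} {p : ℕ → ℕ} {s u k : ℕ}
    (hs : s + k ≤ childrenBefore N p s) (hsu : s ≤ u)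
    (h : ∀ i, s ≤ i → i < u → 0 < childCount N p i) : u + k ≤ childrenBefore N p u := by
  induction u, hsu using Nat.le_induction with
  | base => exact hs
  | succ u hu ih =>
    have h1 := ih fun i h1 h2 => h i h1 (by omega)
    have h2 := h u hu (by omega)
    rw [childrenBefore_succ]
    omega

end Shape

/-- The restrictions that stability puts on a `Shape`. -/
structure StableShape (N : ℕ) (p d : ℕ → ℕ) (a₁ b₁ a₂ b₂ : ℕ) : Prop
    extends Shape N p d a₁ b₁ a₂ b₂ where
  alpha₁ : ∀ r, r < N → a₁ < r → r ≠ b₁ → p r ≠ a₁ → p r < b₁ →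
    p r = p a₁ ∨ (p r = a₂ ∧ a₁ = b₂) ∨ (a₁ < p r ∧ a₁ = p (p r)) ∨ (a₁ = a₂ ∧ p r = b₂) ∨
      (r = a₂ ∧ b₁ = b₂) ∨ (b₁ = a₂ ∧ r = b₂)
  beta₁ : ∀ r, r < N → b₁ < r → p r < a₁ →
    p r = p b₁ ∨ (p r = a₂ ∧ b₁ = b₂) ∨ (a₁ = a₂ ∧ r = b₂)
  alpha₂ : ∀ r, r < N → a₂ < r → r ≠ b₂ → p r ≠ a₂ → p r < b₂ →
    p r = p a₂ ∨ (p r = a₁ ∧ a₂ = b₁) ∨ (a₂ < p r ∧ a₂ = p (p r)) ∨ (a₂ = a₁ ∧ p r = b₁) ∨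
      (r = a₁ ∧ b₂ = b₁) ∨ (b₂ = a₁ ∧ r = b₁)
  beta₂ : ∀ r, r < N → b₂ < r → p r < a₂ →
    p r = p b₂ ∨ (p r = a₁ ∧ b₂ = b₁) ∨ (a₂ = a₁ ∧ r = b₁)
  exists_lt : ∀ u v y, ShapeAdj N p a₁ b₁ a₂ b₂ u v → ¬ ShapeAdj N p a₁ b₁ a₂ b₂ u y →
    y < v → y ≠ u →
    ∃ c < u, ShapeAdj N p a₁ b₁ a₂ b₂ c y ∧ ¬ ShapeAdj N p a₁ b₁ a₂ b₂ c v

/-! ### Locating the extra edges of a stable graph. -/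

namespace StableShape

variable {N : ℕ} {p d : ℕ → ℕ} {a₁ b₁ a₂ b₂ : ℕ}

theorem swap (h : StableShape N p d a₁ b₁ a₂ b₂) : StableShape N p d a₂ b₂ a₁ b₁ where
  toShape := h.toShape.swap
  alpha₁ := h.alpha₂
  beta₁ := h.beta₂
  alpha₂ := h.alpha₁
  beta₂ := h.beta₁
  exists_lt := by
    intro u v y
    simp only [shapeAdj_swap (a₁ := a₂)]
    exact h.exists_lt u v y

/-- If `1` is on an extra edge then `1` and `2` are adjacent. -/
theorem shapeAdj_one_two (h : StableShape N p d a₁ b₁ a₂ b₂) (h1 : a₁ = 1) :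
    ShapeAdj N p a₁ b₁ a₂ b₂ 1 2 := by
  have h2 := h.p_lt₁
  have h3 := h.lt₁
  have h4 := h.lt_N₁
  by_contra hno
  have hb : 2 < b₁ := by
    rcases Nat.lt_or_ge 2 b₁ with hb | hb
    · exact hb
    · exact absurd (show ShapeAdj N p a₁ b₁ a₂ b₂ 1 2 from
        Or.inl ⟨by omega, by omega, Or.inr (Or.inl ⟨by omega, by omega⟩)⟩) hno
  obtain ⟨c, hc, -, hc2⟩ := h.exists_lt 1 b₁ 2
    (Or.inl ⟨by omega, h4, Or.inr (Or.inl ⟨h1.symm, rfl⟩)⟩) hno hb (by omega)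
  exact hc2 (Or.inl ⟨by omega, h4, Or.inl (by omega)⟩)

section NoExtraAtOne

/-- With no extra edge at `1`, the extra edges do not end among the children of the root. -/
theorem d_zero_lt_b₁ (h : StableShape N p d a₁ b₁ a₂ b₂) (h1 : 2 ≤ a₁) (h2 : 2 ≤ a₂)
    (hv : p (d 0 + 1) = 1) (hvN : d 0 + 1 < N) : d 0 < b₁ := by
  by_contra! hb
  have := h.lt₁; have := h.lt_N₁; have := h.lt₂
  have hpa : p a₁ = 0 := (h.p_eq_zero_iff (by omega) (by omega)).mpr (by omega)
  have hpb : p b₁ = 0 := (h.p_eq_zero_iff (by omega) (by omega)).mpr (by omega)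
  have e1 := h.alpha₁ (d 0 + 1) hvN (by omega) (by omega) (by omega) (by omega)
  have e2 := h.beta₁ (d 0 + 1) hvN (by omega) (by omega)
  omega

/-- If `a₁` were a child of the root, then by `alpha₁` the two children `d 0 + 1`, `d 0 + 2` of the
vertex `1` would have to be the exceptional vertices. One of `2`, `3` differs from `a₁` and has a
further child, for which no exception is left. -/
theorem d_zero_lt_a₁ (h : StableShape N p d a₁ b₁ a₂ b₂) (hd0 : 3 ≤ d 0) (hd3 : 2 ≤ d 3)
    (h1 : 2 ≤ a₁) (h2 : 2 ≤ a₂) (hv : p (d 0 + 1) = 1) (hv' : p (d 0 + 2) = 1)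
    (hvN : d 0 + 2 < N) (hb1 : d 0 < b₁) (hb2 : d 0 < b₂) : d 0 < a₁ := by
  by_contra! ha
  have := h.lt₁; have := h.lt_N₁; have := h.lt₂; have := h.lt_N₂
  have hpa : p a₁ = 0 := (h.p_eq_zero_iff (by omega) (by omega)).mpr (by omega)
  have e1 : d 0 + 1 = b₁ ∨ (d 0 + 1 = a₂ ∧ b₁ = b₂) ∨ (b₁ = a₂ ∧ d 0 + 1 = b₂) := by
    by_cases hb : d 0 + 1 = b₁
    · exact Or.inl hb
    · have := h.alpha₁ (d 0 + 1) (by omega) (by omega) hb (by omega) (by omega)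
      omega
  have e2 : d 0 + 2 = b₁ ∨ (d 0 + 2 = a₂ ∧ b₁ = b₂) ∨ (b₁ = a₂ ∧ d 0 + 2 = b₂) := by
    by_cases hb : d 0 + 2 = b₁
    · exact Or.inl hb
    · have := h.alpha₁ (d 0 + 2) (by omega) (by omega) hb (by omega) (by omega)
      omega
  have e3 : a₂ = d 0 + 1 ∧ b₂ = d 0 + 2 ∧ (b₁ = d 0 + 1 ∨ b₁ = d 0 + 2) := by omega
  obtain ⟨c, hc2, hc3, hca⟩ : ∃ c, 2 ≤ c ∧ c ≤ 3 ∧ c ≠ a₁ := by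
    by_cases ha2 : a₁ = 2
    · exact ⟨3, by omega, by omega, by omega⟩
    · exact ⟨2, by omega, by omega, by omega⟩
  have hdc := h.anti c 3 hc3 (by omega)
  have hch := h.childCount_eq (u := c) (by omega) (by omega) hca (by omega) (by omega) (by omega)
  obtain ⟨z, hz1, hz2, hz3⟩ := h.exists_child (u := c) (by omega)
  have hz4 : d 0 + 2 < z := by
    by_contra! hz
    have := h.p_mono z (d 0 + 2) (by omega) hz (by omega)
    omega
  have hpc : p c = 0 := (h.p_eq_zero_iff (by omega) (by omega)).mpr (by omega)
  have := h.alpha₁ z hz2 (by omega) (by omega) (by omega) (by omega)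
  rw [hz3] at this
  omega

/-- If no extra edge started at `1`, both would lie below the children of the root. The tree grows
fast enough that many vertices with children lie strictly between `p a₁` and `a₁`, and `alpha₁`
allows only very few such children. -/
theorem exists_extra_at_one (h : StableShape N p d a₁ b₁ a₂ b₂) (hd1 : 3 ≤ d 1) (hd3 : 2 ≤ d 3)
    (hle : a₁ ≤ a₂) : a₁ = 1 := by
  have hp1 := h.p_lt₁; have hl1 := h.lt₁; have hN1 := h.lt_N₁
  have hp2 := h.p_lt₂; have hl2 := h.lt₂; have hN2 := h.lt_N₂
  by_contra hne
  have h1 : 2 ≤ a₁ := by omega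
  have h2 : 2 ≤ a₂ := by omega
  have hd0 : 3 ≤ d 0 := hd1.trans (h.anti 0 1 (by omega) (by omega))
  have hc1 := h.childCount_eq (u := 1) (by omega) (by omega) (by omega) (by omega) (by omega)
    (by omega)
  have hC1 := h.childrenBefore_one
  have hC2 := h.childrenBefore_two
  have hC3 := h.childrenBefore_three
  have hCN := Shape.childrenBefore_lt N p 2 h.N_pos
  have hv : p (d 0 + 1) = 1 := h.p_eq_of_le (by omega) (by omega) (by omega)
  have hv' : p (d 0 + 2) = 1 := h.p_eq_of_le (by omega) (by omega) (by omega)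
  have hb1 := h.d_zero_lt_b₁ h1 h2 hv (by omega)
  have hb2 := h.swap.d_zero_lt_b₁ h2 h1 hv (by omega)
  have ha1 := h.d_zero_lt_a₁ hd0 hd3 h1 h2 hv hv' (by omega) hb1 hb2
  have hchild : ∀ q, 2 ≤ q → q < a₁ → 0 < childCount N p q := by
    intro q hq hqa
    have := h.two_le_d (i := q) (by omega)
    have := h.childCount_eq (u := q) (by omega) (by omega) (by omega) (by omega) (by omega)
      (by omega)
    omega
  -- The last two alternatives exclude each other, since together they give `a₂ = b₂`. So at most
  -- two values of `r` are possible, and three consecutive parents already give a contradiction.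
  have hval : ∀ r, 0 < r → r < N → p a₁ < p r → p r < a₁ →
      r = b₁ ∨ (r = a₂ ∧ b₁ = b₂) ∨ (b₁ = a₂ ∧ r = b₂) := by
    intro r hr0 hr hq1 hq2
    by_cases hrb : r = b₁
    · exact Or.inl hrb
    · have hra : a₁ < r := by
        by_contra! hra
        have := h.p_mono r a₁ hr0 hra (by omega)
        omega
      have := h.alpha₁ r hr hra hrb (by omega) (by omega)
      omega
  have hthree : ∀ q, p a₁ < q → 2 ≤ q → q + 2 < a₁ → False := by
    intro q hq hq2 hqa
    obtain ⟨r1, hr1, hr1N, e1⟩ := h.exists_child (hchild q hq2 (by omega))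
    obtain ⟨r2, hr2, hr2N, e2⟩ := h.exists_child (hchild (q + 1) (by omega) (by omega))
    obtain ⟨r3, hr3, hr3N, e3⟩ := h.exists_child (hchild (q + 2) (by omega) (by omega))
    have f1 := hval r1 (by omega) hr1N (by omega) (by omega)
    have f2 := hval r2 (by omega) hr2N (by omega) (by omega)
    have f3 := hval r3 (by omega) hr3N (by omega) (by omega)
    have n1 : r1 ≠ r2 := fun he => by rw [he] at e1; omega
    have n2 : r2 ≠ r3 := fun he => by rw [he] at e2; omega
    have n3 : r1 ≠ r3 := fun he => by rw [he] at e1; omega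
    omega
  have hpa0 : p a₁ ≠ 0 := by
    rw [Ne, h.p_eq_zero_iff (by omega) (by omega)]
    omega
  by_cases hpa : p a₁ = 1
  -- The one configuration too small for three parents. Here both allowed values are used by the
  -- children of `2` and `3`, which forces `d 2 = 2`, while `b₁` also lies on the other extra edge
  -- and has degree at least three.
  · have ha4 : a₁ = 4 ∧ d 0 = 3 := by
      by_contra hcon
      exact hthree 2 (by omega) le_rfl (by omega)
    obtain ⟨r3, hr3, hr3N, e3⟩ := h.exists_child (hchild 3 (by omega) (by omega))
    have f3 := hval r3 (by omega) hr3N (by omega) (by omega)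
    have hc2 := h.childCount_eq (u := 2) (by omega) (by omega) (by omega) (by omega) (by omega)
      (by omega)
    have hch2 := hchild 2 le_rfl (by omega)
    have hCN3 := Shape.childrenBefore_lt N p 3 h.N_pos
    have e2 := h.p_eq_of_le (u := 2) (j := childrenBefore N p 2 + 1) (by omega) (by omega)
      (by omega)
    have f2 := hval (childrenBefore N p 2 + 1) (by omega) (by omega) (by omega) (by omega)
    have hd2 : d 2 = 2 := by
      by_contra hd2
      have e2' := h.p_eq_of_le (u := 2) (j := childrenBefore N p 2 + 2) (by omega) (by omega)
        (by omega)
      have f2' := hval (childrenBefore N p 2 + 2) (by omega) (by omega) (by omega) (by omega)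
      have n1 : childrenBefore N p 2 + 1 ≠ r3 := fun he => by rw [he] at e2; omega
      have n2 : childrenBefore N p 2 + 2 ≠ r3 := fun he => by rw [he] at e2'; omega
      omega
    have n1 : childrenBefore N p 2 + 1 ≠ r3 := fun he => by rw [he] at e2; omega
    have hdb := h.deg b₁ hN1
    have hanti := h.anti 2 b₁ (by omega) hN1
    rw [if_pos (show 0 < b₁ by omega), if_pos (show b₁ = b₁ from rfl)] at hdb
    have : b₁ = a₂ ∨ b₁ = b₂ := by omega
    rcases this with hb | hb
    · rw [if_pos hb] at hdb
      omega
    · rw [if_pos hb] at hdb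
      omega
  -- The offset `3` comes from `childrenBefore N p 2 = d 0 + d 1 - 1 ≥ 5`. It yields `a₁ > p a₁ +
  -- 3`, hence three vertices strictly between.
  · have hgrow := Shape.le_childrenBefore (N := N) (p := p) (s := 2) (u := p a₁) (k := 3) (by omega)
      (by omega) fun i hi1 hi2 => hchild i hi1 (by have := h.p_lt a₁ (by omega) (by omega); omega)
    have := (h.p_lt_iff (u := p a₁) (j := a₁) (by omega) (by omega)).not.mp (lt_irrefl _)
    exact hthree (p a₁ + 1) (by omega) (by omega) (by omega)

end NoExtraAtOne

/-- With degrees as in type 4, both extra edges start at `1`. -/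
theorem extra_at_one_right (h : StableShape N p d a₁ b₁ a₂ b₂) (hd1 : 3 ≤ d 1) (hd3 : 2 ≤ d 3)
    (hd : 4 ≤ d 0 ∨ 3 ≤ d 2) (h1 : a₁ = 1) : a₂ = 1 := by
  have hp1 := h.p_lt₁; have hl1 := h.lt₁; have hN1 := h.lt_N₁
  have hp2 := h.p_lt₂; have hl2 := h.lt₂; have hN2 := h.lt_N₂
  by_contra hne
  have hd0 : 3 ≤ d 0 := hd1.trans (h.anti 0 1 (by omega) (by omega))
  have hd0N := h.d_zero_lt
  have hp02 : p 2 = 0 := (h.p_eq_zero_iff (by omega) (by omega)).mpr (by omega)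
  have hp03 : p 3 = 0 := (h.p_eq_zero_iff (by omega) (by omega)).mpr (by omega)
  have hb1 : b₁ = 2 := by
    have := h.shapeAdj_one_two h1
    unfold ShapeAdj at this
    omega
  have hc1 : childCount N p 1 + 2 = d 1 := by
    rw [h.deg 1 (by omega), if_pos (by omega), if_pos (by omega), if_neg (by omega),
      if_neg (by omega), if_neg (by omega)]
  have hC1 := h.childrenBefore_one
  have hC2 := h.childrenBefore_two
  have hC3 := h.childrenBefore_three
  have hCN := Shape.childrenBefore_lt N p 2 h.N_pos
  have hv : p (d 0 + 1) = 1 := h.p_eq_of_le (by omega) (by omega) (by omega)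
  have halpha : ∀ r, r < N → a₂ < r → r ≠ b₂ → p r ≠ a₂ → p r < b₂ →
      p r = p a₂ ∨ (p r = 1 ∧ a₂ = 2) ∨ (a₂ < p r ∧ a₂ = p (p r)) := by
    intro r e1 e2 e3 e4 e5
    have := h.alpha₂ r e1 e2 e3 e4 e5
    omega
  by_cases ha2 : a₂ = 2
  · by_cases hb3 : b₂ = 3
    · have := h.beta₂ (d 0 + 1) (by omega) (by omega) (by omega)
      rw [hb3] at this
      omega
    · have hc3 := h.childCount_eq (u := 3) (by omega) (by omega) (by omega) (by omega) (by omega)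
        (by omega)
      obtain ⟨z, hz1, hz2, hz3⟩ := h.exists_child (u := 3) (by omega)
      have hzb : z ≠ b₂ := fun he => by rw [he] at hz3; omega
      have := halpha z hz2 (by omega) hzb (by omega) (by omega)
      rw [hz3, hp03, ha2] at this
      omega
  by_cases had : a₂ ≤ d 0
  · have hpa : p a₂ = 0 := (h.p_eq_zero_iff (by omega) (by omega)).mpr (by omega)
    have hvb : b₂ = d 0 + 1 := by
      by_contra hvb
      have := halpha (d 0 + 1) (by omega) (by omega) (by omega) (by omega) (by omega)
      omega
    have hno : ∀ c, 2 ≤ c → c ≤ d 0 → c ≠ a₂ → 0 < childCount N p c → False := by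
      intro c hc hcd hca hch
      obtain ⟨z, hz1, hz2, hz3⟩ := h.exists_child hch
      have hpc : p c = 0 := (h.p_eq_zero_iff (by omega) (by omega)).mpr (by omega)
      have hz4 : d 0 + 1 < z := by
        by_contra! hz
        have := h.p_mono z (d 0 + 1) (by omega) hz (by omega)
        omega
      have := halpha z hz2 (by omega) (by omega) (by omega) (by omega)
      rw [hz3] at this
      omega
    have hch : ∀ c, 3 ≤ c → c ≤ d 0 → c ≠ a₂ → 2 ≤ d c → False := by
      intro c hc hcd hca hdc
      have := h.childCount_eq (u := c) (by omega) (by omega) (by omega) (by omega) (by omega)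
        (by omega)
      exact hno c (by omega) hcd hca (by omega)
    -- When `a₂ = 3`, the vertex `2` has no child, so `d 2 = 2`. Then `hd` gives `4 ≤ d 0`, and the
    -- vertex `4` is a child of the root with a child of its own.
    by_cases ha3 : a₂ = 3
    · have hc2 : childCount N p 2 + 2 = d 2 := by
        rw [h.deg 2 (by omega), if_pos (by omega), if_neg (by omega), if_pos (by omega),
          if_neg (by omega), if_neg (by omega)]
      have h2 : childCount N p 2 = 0 := by
        by_contra hcc
        exact hno 2 le_rfl (by omega) (by omega) (by omega)
      exact hch 4 (by omega) (by omega) (by omega) (h.swap.two_le_d (by omega))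
    · exact hch 3 le_rfl (by omega) (by omega) hd3
  · have hpa0 : p a₂ ≠ 0 := by
      rw [Ne, h.p_eq_zero_iff (by omega) (by omega)]
      omega
    have hval : ∀ r, 0 < r → r < N → p a₂ < p r → p r < a₂ → r = b₂ := by
      intro r hr0 hr hq1 hq2
      by_contra hrb
      have hra : a₂ < r := by
        by_contra! hra
        have := h.p_mono r a₂ hr0 hra (by omega)
        omega
      have := halpha r hr hra hrb (by omega) (by omega)
      omega
    have hchild : ∀ q, 3 ≤ q → q < a₂ → 0 < childCount N p q := by
      intro q hq hqa
      have := h.swap.two_le_d (i := q) (by omega)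
      have := h.childCount_eq (u := q) (by omega) (by omega) (by omega) (by omega) (by omega)
        (by omega)
      omega
    have htwo : ∀ q q', p a₂ < q → p a₂ < q' → q < a₂ → q' < a₂ → q ≠ q' →
        0 < childCount N p q → 0 < childCount N p q' → False := by
      intro q q' e1 e1' e2 e2' hqq hq hq'
      obtain ⟨r1, hr1, hr1N, f1⟩ := h.exists_child hq
      obtain ⟨r2, hr2, hr2N, f2⟩ := h.exists_child hq'
      have g1 := hval r1 (by omega) hr1N (by omega) (by omega)
      have g2 := hval r2 (by omega) hr2N (by omega) (by omega)
      rw [g1] at f1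
      rw [g2] at f2
      omega
    have hd2 := h.anti 2 3 (by omega) (by omega)
    have hc2 : childCount N p 2 + 2 = d 2 := by
      rw [h.deg 2 (by omega), if_pos (by omega), if_neg (by omega), if_pos (by omega),
        if_neg (by omega), if_neg (by omega)]
    rcases Nat.lt_or_ge (p a₂) 3 with hpa | hpa
    · by_cases ha4 : a₂ = 4
      · have hpa' : p a₂ = 1 := by
          rw [ha4, ← hv]
          congr 1
          omega
        exact htwo 2 3 (by omega) (by omega) (by omega) (by omega) (by omega) (by omega)
          (hchild 3 le_rfl (by omega))
      · exact htwo 3 4 (by omega) (by omega) (by omega) (by omega) (by omega)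
          (hchild 3 le_rfl (by omega)) (hchild 4 (by omega) (by omega))
    · have hgrow := Shape.le_childrenBefore (N := N) (p := p) (s := 3) (u := p a₂) (k := 2)
        (by omega) hpa fun i hi1 hi2 => hchild i hi1
          (by have := h.p_lt a₂ (by omega) (by omega); omega)
      have := (h.p_lt_iff (u := p a₂) (j := a₂) (by omega) (by omega)).not.mp (lt_irrefl _)
      exact htwo (p a₂ + 1) (p a₂ + 2) (by omega) (by omega) (by omega) (by omega) (by omega)
        (hchild _ (by omega) (by omega)) (hchild _ (by omega) (by omega))

/-- With degrees as in types 2 and 4, the vertices `1` and `2` are adjacent. -/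
theorem shapeAdj_one_two_of_three_le (h : StableShape N p d a₁ b₁ a₂ b₂) (hd1 : 3 ≤ d 1)
    (hd3 : 2 ≤ d 3) : ShapeAdj N p a₁ b₁ a₂ b₂ 1 2 := by
  rcases le_total a₁ a₂ with hle | hle
  · exact h.shapeAdj_one_two (h.exists_extra_at_one hd1 hd3 hle)
  · rw [shapeAdj_swap]
    exact h.swap.shapeAdj_one_two (h.swap.exists_extra_at_one hd1 hd3 hle)

/-- With degrees as in type 4, the extra edges are `12` and `13`. -/
theorem extra_eq_of_three_le (h : StableShape N p d a₁ b₁ a₂ b₂) (hd1 : 3 ≤ d 1) (hd3 : 2 ≤ d 3)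
    (hd : 4 ≤ d 0 ∨ 3 ≤ d 2) : a₁ = 1 ∧ a₂ = 1 ∧ ((b₁ = 2 ∧ b₂ = 3) ∨ (b₁ = 3 ∧ b₂ = 2)) := by
  have ha : a₁ = 1 ∧ a₂ = 1 := by
    rcases le_total a₁ a₂ with hle | hle
    · have := h.exists_extra_at_one hd1 hd3 hle
      exact ⟨this, h.extra_at_one_right hd1 hd3 hd this⟩
    · have := h.swap.exists_extra_at_one hd1 hd3 hle
      exact ⟨h.swap.extra_at_one_right hd1 hd3 hd this, this⟩
  have hp1 := h.p_lt₁; have hl1 := h.lt₁; have hN1 := h.lt_N₁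
  have hp2 := h.p_lt₂; have hl2 := h.lt₂; have hN2 := h.lt_N₂
  have hne := h.ne
  have hd0 : 3 ≤ d 0 := hd1.trans (h.anti 0 1 (by omega) (by omega))
  have hd0N := h.d_zero_lt
  have hp02 : p 2 = 0 := (h.p_eq_zero_iff (by omega) (by omega)).mpr (by omega)
  have hp03 : p 3 = 0 := (h.p_eq_zero_iff (by omega) (by omega)).mpr (by omega)
  have h12 := h.shapeAdj_one_two ha.1
  -- If `1` were adjacent to a later child `b` of the root but not to `3`, `exists_lt` would yield a
  -- vertex before `1`, that is the root, not adjacent to `b`.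
  have hno : ∀ b, 3 < b → b < N → ShapeAdj N p a₁ b₁ a₂ b₂ 1 b → p b = 0 →
      ShapeAdj N p a₁ b₁ a₂ b₂ 1 3 := by
    intro b hb hbN hadj hpb
    by_contra hcon
    obtain ⟨c, hc, -, hc2⟩ := h.exists_lt 1 b 3 hadj hcon hb (by omega)
    exact hc2 (Or.inl ⟨by omega, hbN, Or.inl (by omega)⟩)
  have g1 := hno b₁
  have g2 := hno b₂
  unfold ShapeAdj at h12 g1 g2
  omega

section Matching

/-- With degrees as in types 1 and 3, the extra edges are disjoint and their ends have no
children. -/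
theorem _root_.ConeGraph.Shape.extra_disjoint (h : Shape N p d a₁ b₁ a₂ b₂) (hd1 : d 1 = 2) :
    (∀ i, (i = a₁ ∨ i = b₁ ∨ i = a₂ ∨ i = b₂) → childCount N p i = 0) ∧
      a₁ ≠ a₂ ∧ b₁ ≠ b₂ ∧ a₁ ≠ b₂ ∧ a₂ ≠ b₁ := by
  have hp1 := h.p_lt₁; have hl1 := h.lt₁; have hN1 := h.lt_N₁
  have hp2 := h.p_lt₂; have hl2 := h.lt₂; have hN2 := h.lt_N₂
  have key : ∀ i, 0 < i → i < N → childCount N p i + (if i = a₁ then 1 else 0) +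
    (if i = b₁ then 1 else 0) + (if i = a₂ then 1 else 0) + (if i = b₂ then 1 else 0) ≤ 1 := by
    intro i hi hiN
    have h1 := h.deg i hiN
    have h2 := h.anti 1 i hi hiN
    rw [if_pos hi] at h1
    omega
  have k1 := key a₁ (by omega) (by omega)
  have k2 := key b₁ (by omega) (by omega)
  have k3 := key a₂ (by omega) (by omega)
  have k4 := key b₂ (by omega) (by omega)
  simp only [if_true] at k1 k2 k3 k4
  refine ⟨?_, ?_, ?_, ?_, ?_⟩
  · rintro i (rfl | rfl | rfl | rfl) <;> omega
  · intro he; rw [if_pos he] at k1; omega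
  · intro he; rw [if_pos he] at k2; omega
  · intro he; rw [if_pos he] at k1; omega
  · intro he; rw [if_pos he] at k3; omega

/-- Every exceptional alternative of `alpha₁` needs either a child of `a₁` or a common vertex of the
extra edges. -/
theorem alpha_of_disjoint (h : StableShape N p d a₁ b₁ a₂ b₂) (hd1 : d 1 = 2) {r : ℕ}
    (hrN : r < N) (har : a₁ < r) (hrb : r ≠ b₁) (hpr : p r < b₁) : p r = p a₁ := by
  obtain ⟨h0, h1, h2, h3, h4⟩ := h.extra_disjoint hd1
  have hno : ∀ j, 0 < j → j < N → p j ≠ a₁ := by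
    intro j hj hjN hpj
    have := h0 a₁ (by tauto)
    unfold childCount at this
    rw [card_eq_zero, filter_eq_empty_iff] at this
    exact this (mem_range.mpr hjN) ⟨hj, hpj⟩
  have e := h.alpha₁ r hrN har hrb (hno r (by omega) hrN) hpr
  have e2 := h.p_lt r (by omega) hrN
  have e3 : a₁ < p r → a₁ ≠ p (p r) := fun hh => (hno (p r) (by omega) (by omega)).symm
  omega

/-- With degrees as in types 1 and 3, one of the extra edges is `12`. -/
theorem extra_eq_one_two (h : StableShape N p d a₁ b₁ a₂ b₂) (hd0 : 4 ≤ d 0) (hd1 : d 1 = 2)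
    (hd4 : d 4 = 2) (hle : a₁ ≤ a₂) : a₁ = 1 ∧ b₁ = 2 := by
  have hp1 := h.p_lt₁; have hl1 := h.lt₁; have hN1 := h.lt_N₁
  have hp2 := h.p_lt₂; have hl2 := h.lt₂; have hN2 := h.lt_N₂
  have hd0N := h.d_zero_lt
  obtain ⟨h0, h1, h2, h3, h4⟩ := h.extra_disjoint hd1
  have hp02 : p 2 = 0 := (h.p_eq_zero_iff (by omega) (by omega)).mpr (by omega)
  suffices ha : a₁ = 1 by
    have := h.shapeAdj_one_two ha
    unfold ShapeAdj at this
    omega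
  by_contra hne
  have hc1 := h.childCount_eq (u := 1) (by omega) (by omega) (by omega) (by omega) (by omega)
    (by omega)
  have hC1 := h.childrenBefore_one
  have hC2 := h.childrenBefore_two
  have hCN := Shape.childrenBefore_lt N p 2 h.N_pos
  have hv : p (d 0 + 1) = 1 := h.p_eq_of_le (by omega) (by omega) (by omega)
  have hlow : ∀ {a₁ b₁ a₂ b₂}, StableShape N p d a₁ b₁ a₂ b₂ → 2 ≤ a₁ → 2 ≤ a₂ → d 0 < b₁ := by
    intro a₁ b₁ a₂ b₂ h e1 e2
    by_contra! hb
    have := h.lt₁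
    have := h.alpha_of_disjoint hd1 (r := d 0 + 1) (by omega) (by omega) (by omega) (by omega)
    have hpa : p a₁ = 0 := (h.p_eq_zero_iff (by omega) (by omega)).mpr (by omega)
    omega
  have hb1 := hlow h (by omega) (by omega)
  have hb2 := hlow h.swap (by omega) (by omega)
  have hchild : ∀ q, 0 < q → (q ≤ b₁ ∨ q ≤ 4) → q ≠ a₁ → q ≠ b₁ → q ≠ a₂ → q ≠ b₂ →
      ∃ r, q < r ∧ r < N ∧ p r = q := by
    intro q hq hqb e1 e2 e3 e4
    have : 2 ≤ d q := by
      rcases hqb with hqb | hqb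
      · exact h.two_le_d hqb
      · exact hd4.symm.le.trans (h.anti q 4 hqb (by omega))
    have := h.childCount_eq (u := q) hq (by omega) e1 e2 e3 e4
    exact h.exists_child (by omega)
  have ha1 : d 0 < a₁ := by
    by_contra! ha
    have hpa : p a₁ = 0 := (h.p_eq_zero_iff (by omega) (by omega)).mpr (by omega)
    have hvb : b₁ = d 0 + 1 := by
      by_contra hvb
      have := h.alpha_of_disjoint hd1 (r := d 0 + 1) (by omega) (by omega) (by omega) (by omega)
      omega
    obtain ⟨c, hc2, hc4, hca, hca'⟩ : ∃ c, 2 ≤ c ∧ c ≤ 4 ∧ c ≠ a₁ ∧ c ≠ a₂ := by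
      by_cases e2 : 2 ≠ a₁ ∧ 2 ≠ a₂
      · exact ⟨2, by omega, by omega, e2.1, e2.2⟩
      · by_cases e3 : 3 ≠ a₁ ∧ 3 ≠ a₂
        · exact ⟨3, by omega, by omega, e3.1, e3.2⟩
        · exact ⟨4, by omega, by omega, by omega, by omega⟩
    obtain ⟨z, hz1, hz2, hz3⟩ := hchild c (by omega) (by omega) hca (by omega) hca' (by omega)
    have hz4 : d 0 + 1 < z := by
      by_contra! hz
      have := h.p_mono z (d 0 + 1) (by omega) hz (by omega)
      omega
    have := h.alpha_of_disjoint hd1 (r := z) hz2 (by omega) (by omega) (by omega)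
    omega
  have hpa0 : p a₁ ≠ 0 := by
    rw [Ne, h.p_eq_zero_iff (by omega) (by omega)]
    omega
  have hpl := h.p_lt a₁ (by omega) (by omega)
  have hval : ∀ r, 0 < r → r < N → p a₁ < p r → p r < a₁ → r = b₁ := by
    intro r hr0 hr hq1 hq2
    by_contra hrb
    have hra : a₁ < r := by
      by_contra! hra
      have := h.p_mono r a₁ hr0 hra (by omega)
      omega
    have := h.alpha_of_disjoint hd1 hr hra hrb (by omega)
    omega
  -- The offset is `d 0 - 1 ≥ 3`. It leaves room for two vertices strictly between `p a₁` and `a₁`,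
  -- and both would have `b₁` as a child.
  have hgrow := Shape.le_childrenBefore (N := N) (p := p) (s := 1) (u := p a₁) (k := 3)
    (by omega) (by omega) fun i hi1 hi2 => by
      have := h.two_le_d (i := i) (by omega)
      have := h.childCount_eq (u := i) (by omega) (by omega) (by omega) (by omega) (by omega)
        (by omega)
      omega
  have := (h.p_lt_iff (u := p a₁) (j := a₁) (by omega) (by omega)).not.mp (lt_irrefl _)
  obtain ⟨r1, hr1, hr1N, f1⟩ := hchild (p a₁ + 1) (by omega) (by omega) (by omega) (by omega)
    (by omega) (by omega)
  obtain ⟨r2, hr2, hr2N, f2⟩ := hchild (p a₁ + 2) (by omega) (by omega) (by omega) (by omega)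
    (by omega) (by omega)
  have g1 := hval r1 (by omega) hr1N (by omega) (by omega)
  have g2 := hval r2 (by omega) hr2N (by omega) (by omega)
  rw [g1] at f1
  rw [g2] at f2
  omega

/-- With degrees as in type 3, if one extra edge is `12` then the other one is `34`. -/
theorem extra_eq_three_four (h : StableShape N p d a₁ b₁ a₂ b₂) (hd0 : 5 ≤ d 0) (hd1 : d 1 = 2)
    (hd4 : d 4 = 2) (ha : a₂ = 1) (hb : b₂ = 2) : a₁ = 3 ∧ b₁ = 4 := by
  have hp1 := h.p_lt₁; have hl1 := h.lt₁; have hN1 := h.lt_N₁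
  have hp2 := h.p_lt₂; have hl2 := h.lt₂; have hN2 := h.lt_N₂
  have hd0N := h.d_zero_lt
  obtain ⟨h0, h1, h2, h3, h4⟩ := h.extra_disjoint hd1
  have hch1 := h0 1 (by omega)
  have hch2 := h0 2 (by omega)
  have hC1 := h.childrenBefore_one
  have hC3 := h.childrenBefore_three
  have hC4 := h.childrenBefore_four
  have hp04 : p 4 = 0 := (h.p_eq_zero_iff (by omega) (by omega)).mpr (by omega)
  have hpos : 0 < b₁ := by omega
  suffices ha3 : a₁ = 3 by
    refine ⟨ha3, ?_⟩
    have hpb : p b₁ = 0 := by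
      have e := (h.p_lt_iff (u := 3) hpos hN1).mp (by omega)
      exact (h.p_eq_zero_iff hpos hN1).mpr (by omega)
    by_contra hb4
    obtain ⟨c, hc, hc1, hc2⟩ := h.exists_lt 3 b₁ 4
      (Or.inl ⟨by omega, hN1, Or.inr (Or.inl ⟨ha3.symm, rfl⟩)⟩)
      (by unfold ShapeAdj; omega) (by omega) (by omega)
    unfold ShapeAdj at hc1 hc2
    omega
  by_contra hne
  have hch : ∀ q, 3 ≤ q → (q ≤ b₁ ∨ q ≤ 4) → q ≠ a₁ → q ≠ b₁ → 0 < childCount N p q := by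
    intro q hq hqb e1 e2
    have : 2 ≤ d q := by
      rcases hqb with hqb | hqb
      · exact h.two_le_d hqb
      · exact hd4.symm.le.trans (h.anti q 4 hqb (by omega))
    have := h.childCount_eq (u := q) (by omega) (by omega) e1 e2 (by omega) (by omega)
    omega
  have hch3 := hch 3 le_rfl (by omega) (by omega) (by omega)
  have hCN := Shape.childrenBefore_lt N p 4 h.N_pos
  have hv : p (d 0 + 1) = 3 := h.p_eq_of_le (by omega) (by omega) (by omega)
  have hb1 : d 0 < b₁ := by
    by_contra! hb
    have := h.alpha_of_disjoint hd1 (r := d 0 + 1) (by omega) (by omega) (by omega) (by omega)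
    have hpa : p a₁ = 0 := (h.p_eq_zero_iff (by omega) (by omega)).mpr (by omega)
    omega
  have ha1 : d 0 < a₁ := by
    by_contra! ha
    have hpa : p a₁ = 0 := (h.p_eq_zero_iff (by omega) (by omega)).mpr (by omega)
    have hvb : b₁ = d 0 + 1 := by
      by_contra hvb
      have := h.alpha_of_disjoint hd1 (r := d 0 + 1) (by omega) (by omega) (by omega) (by omega)
      omega
    obtain ⟨c, hc2, hc4, hca⟩ : ∃ c, 4 ≤ c ∧ c ≤ 5 ∧ c ≠ a₁ := by
      by_cases e2 : a₁ = 4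
      · exact ⟨5, by omega, by omega, by omega⟩
      · exact ⟨4, by omega, by omega, by omega⟩
    obtain ⟨z, hz1, hz2, hz3⟩ := h.exists_child (hch c (by omega) (by omega) hca (by omega))
    have hz4 : d 0 + 1 < z := by
      by_contra! hz
      have := h.p_mono z (d 0 + 1) (by omega) hz (by omega)
      omega
    have := h.alpha_of_disjoint hd1 (r := z) hz2 (by omega) (by omega) (by omega)
    omega
  have hpl := h.p_lt a₁ (by omega) (by omega)
  have hpa3 : 3 ≤ p a₁ := by
    by_contra! hlt
    have := (h.p_lt_iff (u := 3) (j := a₁) (by omega) (by omega)).mp hlt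
    omega
  have hval : ∀ r, 0 < r → r < N → p a₁ < p r → p r < a₁ → r = b₁ := by
    intro r hr0 hr hq1 hq2
    by_contra hrb
    have hra : a₁ < r := by
      by_contra! hra
      have := h.p_mono r a₁ hr0 hra (by omega)
      omega
    have := h.alpha_of_disjoint hd1 hr hra hrb (by omega)
    omega
  -- Since `1` and `2` are childless, `childrenBefore N q 3 = d 0 ≥ 5` for the parent function `q`
  -- in question, which gives the offset `2`.
  have hgrow := Shape.le_childrenBefore (N := N) (p := p) (s := 3) (u := p a₁) (k := 2)
    (by omega) hpa3 fun i hi1 hi2 => hch i hi1 (by omega) (by omega) (by omega)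
  have := (h.p_lt_iff (u := p a₁) (j := a₁) (by omega) (by omega)).not.mp (lt_irrefl _)
  obtain ⟨r1, hr1, hr1N, f1⟩ := h.exists_child
    (hch (p a₁ + 1) (by omega) (by omega) (by omega) (by omega))
  obtain ⟨r2, hr2, hr2N, f2⟩ := h.exists_child
    (hch (p a₁ + 2) (by omega) (by omega) (by omega) (by omega))
  have g1 := hval r1 (by omega) hr1N (by omega) (by omega)
  have g2 := hval r2 (by omega) hr2N (by omega) (by omega)
  rw [g1] at f1
  rw [g2] at f2
  omega

end Matching

end StableShape

end ConeGraph

namespace ConeGraph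

open SimpleGraph Finset

/-! ### From breadth-first and stable graphs to shapes. -/

section ShapeOfGraph

variable {N : ℕ} {K : SimpleGraph (Fin N)} {p d : ℕ → ℕ} {a₁ b₁ a₂ b₂ : ℕ}

theorem card_pairs_lt (K : SimpleGraph (Fin N)) [DecidableRel K.Adj] :
    #{q : Fin N × Fin N | q.1 < q.2 ∧ K.Adj q.1 q.2} = K.edgeSet.ncard := by
  classical
  have h1 := sum_card_nbrs K
  have h2 : ∑ v, #(nbrs K v) = #{q : Fin N × Fin N | K.Adj q.1 q.2} := by
    rw [card_filter, Fintype.sum_prod_type]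
    refine sum_congr rfl fun v _ => ?_
    rw [← card_filter]
    congr 1
    ext w
    simp
  have h3 : #{q : Fin N × Fin N | K.Adj q.1 q.2} =
      #{q : Fin N × Fin N | q.1 < q.2 ∧ K.Adj q.1 q.2} +
      #{q : Fin N × Fin N | q.2 < q.1 ∧ K.Adj q.1 q.2} := by
    rw [← card_union_of_disjoint]
    · congr 1
      ext q
      simp only [mem_filter, mem_univ, true_and, mem_union]
      constructor
      · intro h
        rcases lt_or_gt_of_ne h.ne with h' | h'
        · exact Or.inl ⟨h', h⟩
        · exact Or.inr ⟨h', h⟩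
      · tauto
    · rw [Finset.disjoint_left]
      intro q h h'
      simp only [mem_filter, mem_univ, true_and] at h h'
      exact lt_asymm h.1 h'.1
  have h4 : #{q : Fin N × Fin N | q.2 < q.1 ∧ K.Adj q.1 q.2} =
      #{q : Fin N × Fin N | q.1 < q.2 ∧ K.Adj q.1 q.2} := by
    refine card_equiv (Equiv.prodComm _ _) fun q => ?_
    simp [K.adj_comm]
  omega

open Classical in
theorem ite_eq_add_of_iff_or {P Q R S : Prop} (h : S ↔ P ∨ Q ∨ R) (h1 : P → ¬ Q) (h2 : P → ¬ R)
    (h3 : Q → ¬ R) : (if S then 1 else 0 : ℕ) =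
      (if P then 1 else 0) + (if Q then 1 else 0) + (if R then 1 else 0) := by
  rw [if_congr h rfl rfl]
  by_cases hP : P
  · simp [hP, h1 hP, h2 hP]
  · by_cases hQ : Q
    · simp [hP, hQ, h3 hQ]
    · simp [hP, hQ]

theorem card_shapeAdj (hlt : ∀ j, 0 < j → j < N → p j < j)
    (h1 : p b₁ < a₁ ∧ a₁ < b₁ ∧ b₁ < N) (h2 : p b₂ < a₂ ∧ a₂ < b₂ ∧ b₂ < N)
    (hne : ¬ (a₁ = a₂ ∧ b₁ = b₂)) {i : ℕ} (hi : i < N)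
    [DecidablePred fun j => ShapeAdj N p a₁ b₁ a₂ b₂ i j] :
    #{j ∈ range N | ShapeAdj N p a₁ b₁ a₂ b₂ i j} =
      childCount N p i + (if 0 < i then 1 else 0) + (if i = a₁ then 1 else 0) +
        (if i = b₁ then 1 else 0) + (if i = a₂ then 1 else 0) + (if i = b₂ then 1 else 0) := by
  have key : ∀ j ∈ range N, (if ShapeAdj N p a₁ b₁ a₂ b₂ i j then 1 else 0) =
      (if 0 < j ∧ p j = i then 1 else 0) + (if j = p i ∧ 0 < i then 1 else 0) +
      (if j = b₁ ∧ i = a₁ then 1 else 0) + (if j = a₁ ∧ i = b₁ then 1 else 0) +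
      (if j = b₂ ∧ i = a₂ then 1 else 0) + (if j = a₂ ∧ i = b₂ then 1 else 0) := by
    intro j hj
    have hj := mem_range.mp hj
    have e1 := hlt i
    have e2 := hlt j
    have e3 : j = b₁ → p j < a₁ := by rintro rfl; exact h1.1
    have e4 : j = b₂ → p j < a₂ := by rintro rfl; exact h2.1
    have e5 : i = b₁ → p i < a₁ := by rintro rfl; exact h1.1
    have e6 : i = b₂ → p i < a₂ := by rintro rfl; exact h2.1
    rcases lt_trichotomy i j with hij | hij | hij
    · have g := ite_eq_add_of_iff_or (S := ShapeAdj N p a₁ b₁ a₂ b₂ i j) (P := 0 < j ∧ p j = i)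
        (Q := j = b₁ ∧ i = a₁) (R := j = b₂ ∧ i = a₂) (by unfold ShapeAdj; omega) (by omega)
        (by omega) (by omega)
      rw [if_neg (show ¬ (j = p i ∧ 0 < i) by omega), if_neg (show ¬ (j = a₁ ∧ i = b₁) by omega),
        if_neg (show ¬ (j = a₂ ∧ i = b₂) by omega), add_zero, add_zero, add_zero]
      convert g
    · rw [if_neg (show ¬ ShapeAdj N p a₁ b₁ a₂ b₂ i j by unfold ShapeAdj; omega),
        if_neg (by omega), if_neg (by omega), if_neg (by omega), if_neg (by omega),
        if_neg (by omega), if_neg (by omega)]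
    · have g := ite_eq_add_of_iff_or (S := ShapeAdj N p a₁ b₁ a₂ b₂ i j) (P := j = p i ∧ 0 < i)
        (Q := j = a₁ ∧ i = b₁) (R := j = a₂ ∧ i = b₂) (by unfold ShapeAdj; omega) (by omega)
        (by omega) (by omega)
      rw [if_neg (show ¬ (0 < j ∧ p j = i) by omega), if_neg (show ¬ (j = b₁ ∧ i = a₁) by omega),
        if_neg (show ¬ (j = b₂ ∧ i = a₂) by omega), add_zero, add_zero, zero_add]
      convert g
  rw [card_filter, sum_congr rfl key]
  have hsum : ∀ (a : ℕ) (P : Prop) [Decidable P], (P → a < N) →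
      ∑ j ∈ range N, (if j = a ∧ P then 1 else 0) = if P then 1 else 0 := by
    intro a P _ ha
    by_cases hP : P
    · simp [hP, ha hP]
    · simp [hP]
  simp only [sum_add_distrib]
  rw [hsum _ _ fun h0 => (hlt i h0 hi).trans hi, hsum _ _ fun _ => h1.2.2,
    hsum _ _ fun _ => h1.2.1.trans h1.2.2, hsum _ _ fun _ => h2.2.2,
    hsum _ _ fun _ => h2.2.1.trans h2.2.2, ← card_filter]
  rfl

/-- The graph `K` has the adjacency described by the shape. -/
def HasShape (K : SimpleGraph (Fin N)) (p : ℕ → ℕ) (a₁ b₁ a₂ b₂ : ℕ) : Prop :=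
  ∀ i j : Fin N, K.Adj i j ↔ ShapeAdj N p a₁ b₁ a₂ b₂ i j

theorem HasShape.swap (h : HasShape K p a₁ b₁ a₂ b₂) : HasShape K p a₂ b₂ a₁ b₁ := fun i j => by
  rw [h i j, shapeAdj_swap]

/-- Joining every vertex other than the first to its first neighbor gives a tree with `N - 1` edges.
A bicyclic graph has `N + 1` edges, so exactly two remain. -/
theorem BFSOrdered.exists_shape (hK : BFSOrdered K) (hN : 0 < N)
    (he : K.edgeSet.ncard + 1 = N + 2) (hd : ∀ i : Fin N, d i = #(nbrs K i))
    (hanti : Antitone fun i => #(nbrs K i)) :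
    ∃ p a₁ b₁ a₂ b₂, Shape N p d a₁ b₁ a₂ b₂ ∧ HasShape K p a₁ b₁ a₂ b₂ := by
  classical
  let p : ℕ → ℕ := fun j => if h : j < N then firstNbr K ⟨j, h⟩ else 0
  have hp : ∀ j : Fin N, p j = firstNbr K j := fun j => by simp [p]
  have hple : ∀ i j : Fin N, i < j → K.Adj i j → p j ≤ i := fun i j hij hadj => by
    rw [hp]
    exact firstNbr_le hadj (by omega)
  have hpadj : ∀ j : Fin N, 0 < j.val → ∃ c : Fin N, c.val = p j ∧ K.Adj c j ∧ c < j := by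
    intro j hj
    obtain ⟨a, ha, haj⟩ := hK.1 j hj
    obtain ⟨c, hc1, hc2⟩ := exists_firstNbr haj hj
    refine ⟨c, by rw [hc1, hp], hc2, ?_⟩
    have := firstNbr_le haj hj
    rw [Fin.lt_def] at ha ⊢
    omega
  have hplt : ∀ j, 0 < j → j < N → p j < j := by
    intro j hj hjN
    obtain ⟨c, hc1, -, hc3⟩ := hpadj ⟨j, hjN⟩ hj
    rw [← hc1]
    exact hc3
  set E : Finset (Fin N × Fin N) := {q | q.1 < q.2 ∧ K.Adj q.1 q.2} with hE
  have hEc : #E = K.edgeSet.ncard := card_pairs_lt K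
  set T : Finset (Fin N × Fin N) := {q ∈ E | q.1.val = p q.2} with hT
  set F : Finset (Fin N × Fin N) := {q ∈ E | ¬ q.1.val = p q.2} with hF
  have hTF : #T + #F = #E := card_filter_add_card_filter_not _
  have hTc : #T = N - 1 := by
    have h1 : #T = #({j : Fin N | 0 < j.val} : Finset (Fin N)) := by
      refine card_bij (fun q _ => q.2) ?_ ?_ ?_
      · intro q hq
        simp only [hT, hE, mem_filter, mem_univ, true_and] at hq ⊢
        have := hq.1.1
        omega
      · intro q hq q' hq' heq
        simp only [hT, hE, mem_filter, mem_univ, true_and] at hq hq'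
        refine Prod.ext (Fin.ext ?_) heq
        rw [hq.2, hq'.2, heq]
      · intro j hj
        simp only [mem_filter, mem_univ, true_and] at hj
        obtain ⟨c, hc1, hc2, hc3⟩ := hpadj j hj
        refine ⟨(c, j), ?_, rfl⟩
        simp only [hT, hE, mem_filter, mem_univ, true_and]
        exact ⟨⟨hc3, hc2⟩, hc1⟩
    rw [h1, show ({j : Fin N | 0 < j.val} : Finset (Fin N)) = univ.erase ⟨0, hN⟩ by
      ext j
      simp only [mem_filter, mem_univ, true_and, mem_erase, and_true, Ne, Fin.ext_iff]
      omega, card_erase_of_mem (mem_univ _), card_univ, Fintype.card_fin]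
  obtain ⟨q₁, q₂, hne, hF2⟩ := card_eq_two.mp (show #F = 2 by omega)
  have hadj : HasShape K p q₁.1 q₁.2 q₂.1 q₂.2 := by
    have key : ∀ i j : Fin N, i < j → (K.Adj i j ↔ i.val = p j ∨ (i.val = q₁.1 ∧ j.val = q₁.2) ∨
        (i.val = q₂.1 ∧ j.val = q₂.2)) := by
      intro i j hij
      have hFm : (i, j) ∈ F ↔ (i, j) = q₁ ∨ (i, j) = q₂ := by rw [hF2]; simp
      simp only [hF, hE, mem_filter, mem_univ, true_and, hij] at hFm
      simp only [Prod.ext_iff, Fin.ext_iff] at hFm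
      by_cases hpj : i.val = p j
      · refine iff_of_true ?_ (Or.inl hpj)
        obtain ⟨c, hc1, hc2, -⟩ := hpadj j (by omega)
        rwa [Fin.ext (hpj.trans hc1.symm)]
      · tauto
    intro i j
    unfold ShapeAdj
    rcases lt_trichotomy i j with hij | hij | hij
    · rw [key i j hij]
      have : ¬ j.val < i.val := by omega
      have : i.val < j.val := hij
      have := j.isLt
      tauto
    · subst hij
      simp
    · rw [K.adj_comm, key j i hij]
      have : ¬ i.val < j.val := by omega
      have : j.val < i.val := hij
      have := i.isLt
      tauto
  have hext : ∀ q ∈ F, p q.2 < q.1.val ∧ q.1.val < q.2.val ∧ q.2.val < N := by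
    intro q hq
    simp only [hF, hE, mem_filter, mem_univ, true_and] at hq
    have := hple q.1 q.2 hq.1.1 hq.1.2
    exact ⟨lt_of_le_of_ne this fun h => hq.2 h.symm, hq.1.1, q.2.isLt⟩
  have h1 := hext q₁ (by rw [hF2]; simp)
  have h2 := hext q₂ (by rw [hF2]; simp)
  have hne' : ¬ (q₁.1.val = q₂.1.val ∧ q₁.2.val = q₂.2.val) := fun h =>
    hne (Prod.ext (Fin.ext h.1) (Fin.ext h.2))
  refine ⟨p, q₁.1, q₁.2, q₂.1, q₂.2, ⟨hplt, ?_, h1.1, h1.2.1, h1.2.2, h2.1, h2.2.1, h2.2.2, hne',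
    ?_, ?_⟩, hadj⟩
  · intro i j hi hij hjN
    rcases hij.eq_or_lt with rfl | hij
    · exact le_rfl
    obtain ⟨a, ha1, ha2, -⟩ := hpadj ⟨j, hjN⟩ (by simp; omega)
    obtain ⟨c, hc1, hc2⟩ := hK.2 ⟨i, by omega⟩ ⟨j, hjN⟩ a hi hij ha2
    change a.val = p j at ha1
    rw [← ha1]
    refine le_trans ?_ hc1
    have := firstNbr_le hc2 hi
    rwa [← hp] at this
  · intro i j hij hjN
    have h3 := hd ⟨i, by omega⟩
    have h4 := hd ⟨j, hjN⟩
    have h5 := hanti (show (⟨i, by omega⟩ : Fin N) ≤ ⟨j, hjN⟩ from hij)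
    simp only at h3 h4 h5
    omega
  · intro i hi
    rw [← card_shapeAdj hplt h1 h2 hne' hi]
    have h3 := hd ⟨i, hi⟩
    simp only at h3
    rw [h3, ← card_map Fin.valEmbedding]
    congr 1
    ext j
    simp only [mem_map, mem_nbrs, mem_filter, mem_range, Fin.valEmbedding_apply]
    constructor
    · rintro ⟨j, hj, rfl⟩
      exact ⟨j.isLt, (hadj _ _).mp hj⟩
    · rintro ⟨hj, hadj'⟩
      exact ⟨⟨j, hj⟩, (hadj _ _).mpr hadj', rfl⟩

/-- Parents decrease, so the tree path from a vertex before `r` never meets `r` and survives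
deletion of the tree edge at `r`. -/
theorem Shape.reachable_zero (h : Shape N p d a₁ b₁ a₂ b₂) {K₀ : SimpleGraph (Fin N)} {r : ℕ}
    (hK : ∀ i j : Fin N, i.val = p j → 0 < j.val → j.val ≠ r → K₀.Adj i j) (j : Fin N)
    (hj : j.val < r) : K₀.Reachable ⟨0, h.N_pos⟩ j := by
  induction j using WellFoundedLT.induction with
  | _ j ih =>
    rcases Nat.eq_zero_or_pos j.val with h0 | h0
    · rw [show j = ⟨0, h.N_pos⟩ from Fin.ext h0]
    · have h1 := h.p_lt j h0 j.isLt
      have h2 := ih ⟨p j, by omega⟩ h1 (by simp; omega)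
      exact h2.trans (hK _ _ rfl h0 hj.ne).reachable

/-- The switch replaces the tree edge from `p r` to `r` and the extra edge `a₁b₁` by an edge from `p
r` to `a₁` and the edge `b₁r`. It keeps `p r` and `b₁` joined through the tree, so stability forbids
it. The alternatives list the ways in which a new edge may already be present. -/
theorem Shape.alpha_of_stable (h : Shape N p d a₁ b₁ a₂ b₂) (hK : HasShape K p a₁ b₁ a₂ b₂)
    (hst : Stable K) : ∀ r, r < N → a₁ < r → r ≠ b₁ → p r ≠ a₁ → p r < b₁ →
    p r = p a₁ ∨ (p r = a₂ ∧ a₁ = b₂) ∨ (a₁ < p r ∧ a₁ = p (p r)) ∨ (a₁ = a₂ ∧ p r = b₂) ∨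
      (r = a₂ ∧ b₁ = b₂) ∨ (b₁ = a₂ ∧ r = b₂) := by
  intro r hrN har hrb hpa hpb
  by_contra hcon
  have h1 := h.p_lt₁; have h2 := h.lt₁; have h3 := h.lt_N₁
  have h4 := h.p_lt r (by omega) hrN
  have h5 := h.p_lt a₁ (by omega) (by omega)
  have hpne : r ≠ p b₁ := by omega
  let q : Fin N := ⟨p r, by omega⟩
  let r' : Fin N := ⟨r, hrN⟩
  let a' : Fin N := ⟨a₁, by omega⟩
  let b' : Fin N := ⟨b₁, h3⟩
  have hs : Switchable K q r' b' a' := by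
    refine ⟨(hK _ _).mpr ?_, (hK _ _).mpr ?_, fun hh => ?_, fun hh => ?_, ?_, ?_, ?_, ?_⟩
    · exact Or.inl ⟨h4, hrN, Or.inl rfl⟩
    · exact Or.inr ⟨h2, h3, Or.inr (Or.inl ⟨rfl, rfl⟩)⟩
    · have := (hK _ _).mp hh
      unfold ShapeAdj at this
      simp only [q, a'] at this
      omega
    · have := (hK _ _).mp hh
      unfold ShapeAdj at this
      simp only [r', b'] at this
      omega
    all_goals
      simp only [q, r', a', b', Ne, Fin.ext_iff]
      omega
  refine hst q r' b' a' hs hpb har (Or.inl ?_)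
  have hK₀ : ∀ i j : Fin N, i.val = p j → 0 < j.val → j.val ≠ r →
      (K \ twoEdges q r' b' a').Adj i j := by
    intro i j hi hj hjr
    have e1 := h.p_lt j hj j.isLt
    refine (sdiff_adj _ _ _ _).mpr ⟨(hK _ _).mpr (Or.inl ⟨by omega, j.isLt, Or.inl hi⟩), ?_⟩
    rw [twoEdges_adj hs.uv.ne hs.ab.ne]
    simp only [q, r', a', b', Fin.ext_iff]
    have e2 : j.val = b₁ → p j = p b₁ := fun hh => by rw [hh]
    have e3 : j.val = p r → r ≠ p j := by omega
    omega
  have hq := h.reachable_zero hK₀ q h4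
  have hb := h.reachable_zero hK₀ ⟨p b₁, by omega⟩ (by simp; omega)
  exact hq.symm.trans (hb.trans (hK₀ _ _ rfl (by simp [b']; omega) (by simp [b']; omega)).reachable)

/-- The other pairing of the same two edges: the new edges join `p r` to `b₁` and `a₁` to `r`. Both
`p r` and `a₁` precede `r`, so they stay joined. -/
theorem Shape.beta_of_stable (h : Shape N p d a₁ b₁ a₂ b₂) (hK : HasShape K p a₁ b₁ a₂ b₂)
    (hst : Stable K) : ∀ r, r < N → b₁ < r → p r < a₁ →
    p r = p b₁ ∨ (p r = a₂ ∧ b₁ = b₂) ∨ (a₁ = a₂ ∧ r = b₂) := by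
  intro r hrN hbr hpa
  by_contra hcon
  have h1 := h.p_lt₁; have h2 := h.lt₁; have h3 := h.lt_N₁
  have h4 := h.p_lt r (by omega) hrN
  let q : Fin N := ⟨p r, by omega⟩
  let r' : Fin N := ⟨r, hrN⟩
  let a' : Fin N := ⟨a₁, by omega⟩
  let b' : Fin N := ⟨b₁, h3⟩
  have hs : Switchable K q r' a' b' := by
    refine ⟨(hK _ _).mpr ?_, (hK _ _).mpr ?_, fun hh => ?_, fun hh => ?_, ?_, ?_, ?_, ?_⟩
    · exact Or.inl ⟨h4, hrN, Or.inl rfl⟩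
    · exact Or.inl ⟨h2, h3, Or.inr (Or.inl ⟨rfl, rfl⟩)⟩
    · have := (hK _ _).mp hh
      unfold ShapeAdj at this
      simp only [q, b'] at this
      omega
    · have := (hK _ _).mp hh
      unfold ShapeAdj at this
      simp only [r', a'] at this
      omega
    all_goals
      simp only [q, r', a', b', Ne, Fin.ext_iff]
      omega
  refine hst q r' a' b' hs hpa hbr (Or.inl ?_)
  have hK₀ : ∀ i j : Fin N, i.val = p j → 0 < j.val → j.val ≠ r →
      (K \ twoEdges q r' a' b').Adj i j := by
    intro i j hi hj hjr
    have e1 := h.p_lt j hj j.isLt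
    refine (sdiff_adj _ _ _ _).mpr ⟨(hK _ _).mpr (Or.inl ⟨by omega, j.isLt, Or.inl hi⟩), ?_⟩
    rw [twoEdges_adj hs.uv.ne hs.ab.ne]
    simp only [q, r', a', b', Fin.ext_iff]
    have e2 : j.val = b₁ → p j = p b₁ := fun hh => by rw [hh]
    omega
  exact (h.reachable_zero hK₀ q h4).symm.trans (h.reachable_zero hK₀ a' (by simp [a']; omega))

theorem Shape.stableShape (h : Shape N p d a₁ b₁ a₂ b₂) (hK : HasShape K p a₁ b₁ a₂ b₂)
    (hst : Stable K) (hc : K.Connected) (hanti : Antitone fun i => #(nbrs K i)) :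
    StableShape N p d a₁ b₁ a₂ b₂ where
  toShape := h
  alpha₁ := h.alpha_of_stable hK hst
  beta₁ := h.beta_of_stable hK hst
  alpha₂ := h.swap.alpha_of_stable hK.swap hst
  beta₂ := h.swap.beta_of_stable hK.swap hst
  exists_lt := by
    intro u v y huv huy hyv hyu
    have hlt : ∀ i j, ShapeAdj N p a₁ b₁ a₂ b₂ i j → i < N ∧ j < N := by
      intro i j hij
      unfold ShapeAdj at hij
      omega
    obtain ⟨hu, hv⟩ := hlt u v huv
    obtain ⟨c, hc1, hc2, hc3⟩ := hst.exists_adj_lt hc hanti (u := ⟨u, hu⟩) (v := ⟨v, hv⟩)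
      (y := ⟨y, by omega⟩) ((hK _ _).mpr huv) (fun hh => huy ((hK _ _).mp hh))
      (by simpa using hyu) hyv
    exact ⟨c, hc1, (hK _ _).mp hc2.symm, fun hh => hc3 ((hK _ _).mpr (shapeAdj_comm.mp hh))⟩

end ShapeOfGraph

end ConeGraph

/-! ### Reduced degrees, maximal pairs and the four types. -/

namespace ConeGraph

open SimpleGraph Finset

/-- Two antitone rearrangements of the same tuple coincide. -/
theorem eq_of_antitone_of_comp_equiv {n : ℕ} {f g : Fin n → ℕ} (hf : Antitone f) (hg : Antitone g)
    (e : Equiv.Perm (Fin n)) (h : f = g ∘ e) : f = g := by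
  have hf' : Monotone ((OrderDual.toDual ∘ g) ∘ e) := by
    intro i j hij
    have := hf hij
    rw [h] at this
    exact this
  have hg' : Monotone ((OrderDual.toDual ∘ g) ∘ (Equiv.refl (Fin n))) := fun i j hij => hg hij
  have := Tuple.unique_monotone hf' hg'
  ext i
  have h1 := congrFun this i
  rw [h]
  exact h1

/-- The apices have the largest possible degree, so listing them first and then the base in its
order gives an antitone degree list, which must be `π`. -/
theorem reducedSeq_eq {n t : ℕ} (ht : t ≤ n) {π : Fin n → ℕ} (hπ : Antitone π)
    {G : SimpleGraph (Fin n)} (hG : HasDegreeSequence G π) {H : SimpleGraph (Fin (n - t))}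
    (φ : G ≃g cone t H) (hH : Antitone fun i => #(nbrs H i)) (i : Fin (n - t)) :
    reducedSeq n t π i = #(nbrs H i) := by
  classical
  obtain ⟨σ, hσ⟩ := hG
  let e : Fin t ⊕ Fin (n - t) ≃ Fin n := finSumFinEquiv.trans (finCongr (by omega))
  have el : ∀ a : Fin t, (e (Sum.inl a)).val = a := fun a => by simp [e]
  have er : ∀ b : Fin (n - t), (e (Sum.inr b)).val = t + b := fun b => by simp [e]
  let g : Fin t ⊕ Fin (n - t) → ℕ := fun s => #(nbrs (cone t H) s)
  have hGco : G = (cone t H).comap φ.toEquiv := by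
    ext a b
    exact φ.map_adj_iff.symm
  have hdegG : ∀ v, #(nbrs G v) = #(nbrs (cone t H) (φ v)) := fun v => by
    conv_lhs => rw [hGco]
    exact card_nbrs_comap φ.toEquiv _ v
  have hcard : ∀ b, #(nbrs H b) < n - t := by
    intro b
    have : nbrs H b ⊂ univ := by
      rw [ssubset_univ_iff]
      intro hu
      have := mem_univ b
      rw [← hu, mem_nbrs] at this
      exact this.ne rfl
    simpa using card_lt_card this
  have hanti : Antitone (g ∘ e.symm) := by
    have key : ∀ s s', e s ≤ e s' → g s' ≤ g s := by
      intro s s' hle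
      rw [Fin.le_def] at hle
      rcases s with a | b <;> rcases s' with a' | b'
      · simp only [g, card_nbrs_cone_inl, le_refl]
      · simp only [g, card_nbrs_cone_inl, card_nbrs_cone_inr, Fintype.card_fin]
        have := hcard b'
        have := a.isLt
        omega
      · rw [er, el] at hle
        have := a'.isLt
        omega
      · rw [er, er] at hle
        simp only [g, card_nbrs_cone_inr]
        have := hH (show b ≤ b' from by rw [Fin.le_def]; omega)
        simp only at this
        omega
    intro i j hij
    exact key _ _ (by simpa using hij)
  have heq : π = g ∘ e.symm := by
    refine eq_of_antitone_of_comp_equiv hπ hanti (σ.trans (φ.toEquiv.trans e)) ?_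
    ext v
    rw [← hσ v, ← card_nbrs, hdegG]
    simp [g]
  have hi := i.isLt
  unfold reducedSeq
  rw [dif_pos (show t + i.val < n by omega), heq]
  have : (⟨t + i.val, by omega⟩ : Fin n) = e (Sum.inr i) := Fin.ext (er i).symm
  simp only [Function.comp, this, Equiv.symm_apply_apply, g, card_nbrs_cone_inr]
  omega

/-- A maximal graph `H` in breadth-first form, and a stable graph `K` with the same degrees,
eigenvector and neighbor sums. -/
structure MaximalPair {N : ℕ} (α : ℝ) (d : ℕ → ℕ) (H K : SimpleGraph (Fin N)) (x : Fin N → ℝ)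
    (p : ℕ → ℕ) (a₁ b₁ a₂ b₂ : ℕ) (q : ℕ → ℕ) (a₃ b₃ a₄ b₄ : ℕ) : Prop where
  anti : Antitone x
  cyclic : IsCyclic 2 H
  ext : Extremal α H x
  deg : ∀ i : Fin N, d i = #(nbrs H i)
  shape : Shape N p d a₁ b₁ a₂ b₂
  hasShape : HasShape H p a₁ b₁ a₂ b₂
  shapeK : StableShape N q d a₃ b₃ a₄ b₄
  hasShapeK : HasShape K q a₃ b₃ a₄ b₄
  nbrSum_eq : ∀ v, nbrSum K x v = nbrSum H x v
  lt_of_lt : ∀ i j : Fin N, d j < d i → x j < x i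

theorem IsCyclic.of_iso {V W : Type*} [Fintype V] [Fintype W] {c : ℕ} {H : SimpleGraph V}
    {K : SimpleGraph W} (e : H ≃g K) (h : IsCyclic c H) : IsCyclic c K := by
  refine ⟨e.connected_iff.mp h.1, ?_⟩
  have h1 : K.edgeSet.ncard = H.edgeSet.ncard := by
    have h2 := sum_card_nbrs H
    have h3 := sum_card_nbrs K
    have hco : H = K.comap e.toEquiv := by
      ext a b
      exact e.map_adj_iff.symm
    have h4 : ∑ v, #(nbrs H v) = ∑ w, #(nbrs K w) := by
      rw [← Equiv.sum_comp e.toEquiv]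
      refine sum_congr rfl fun v _ => ?_
      conv_lhs => rw [hco]
      exact card_nbrs_comap e.toEquiv K v
    omega
  rw [h1, h.2, Nat.card_congr e.toEquiv]

/-- The base is sorted by decreasing entries, then renumbered within ties to become breadth-first.
Both steps are isomorphisms, so `H` still carries `G`. Passing to `K` is not known to be one, so
only degrees and neighbor sums are retained. -/
theorem exists_maximalPair {α : ℝ} (hα : 0 ≤ α) {n t : ℕ} (ht : t + 4 ≤ n) {π : Fin n → ℕ}
    (hπ : Antitone π) {G : SimpleGraph (Fin n)}
    (hG : IsThetaMaximal α (coneClass n t 2 π) G) :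
    ∃ (H K : SimpleGraph (Fin (n - t))) (x : Fin (n - t) → ℝ) (p : ℕ → ℕ) (a₁ b₁ a₂ b₂ : ℕ)
      (q : ℕ → ℕ) (a₃ b₃ a₄ b₄ : ℕ), Nonempty (G ≃g cone t H) ∧
      MaximalPair α (reducedSeq n t π) H K x p a₁ b₁ a₂ b₂ q a₃ b₃ a₄ b₄ := by
  obtain ⟨⟨H₀, hH₀, ⟨φ⟩⟩, hdeg⟩ := hG.1
  obtain ⟨x₀, hx₀⟩ := Extremal.of_isThetaMaximal hG hH₀ φ
  let e := Tuple.sort fun i => -x₀ i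
  have he : Antitone (x₀ ∘ e) := by
    intro i j hij
    have := Tuple.monotone_sort (fun i => -x₀ i) hij
    simp only [Function.comp] at this ⊢
    exact neg_le_neg_iff.mp this
  have hx₁ := hx₀.comap e
  obtain ⟨e', he', hbfs⟩ := hx₁.exists_bfsOrdered hα he
  have hx := hx₁.comap e'
  rw [he'] at hx
  set x := x₀ ∘ e
  set H := (H₀.comap e).comap e' with hHdef
  have ψ : H ≃g H₀ := (SimpleGraph.Iso.comap e' _).trans (SimpleGraph.Iso.comap e _)
  have hcyc : IsCyclic 2 H := hH₀.of_iso ψ.symm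
  have hanti := hx.antitone_card hα he
  have φ' : G ≃g cone t H := φ.trans (coneIso ψ.symm)
  have hd : ∀ i : Fin (n - t), reducedSeq n t π i = #(nbrs H i) :=
    reducedSeq_eq (by omega) hπ hdeg φ' hanti
  have hedge : H.edgeSet.ncard + 1 = (n - t) + 2 := by
    have := hcyc.2
    rwa [Nat.card_eq_fintype_card, Fintype.card_fin] at this
  obtain ⟨p, a₁, b₁, a₂, b₂, hs, hs'⟩ := hbfs.exists_shape (by omega) hedge hd hanti
  obtain ⟨K, hK1, hK2, hK3, hK4⟩ := hx.exists_stable he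
  have hKanti : Antitone fun i => #(nbrs K i) := by simpa only [hK3] using hanti
  have hKedge : K.edgeSet.ncard + 1 = (n - t) + 2 := by
    have h1 := sum_card_nbrs H
    have h2 := sum_card_nbrs K
    simp only [hK3] at h2
    omega
  obtain ⟨q, a₃, b₃, a₄, b₄, ht1, ht2⟩ := (hK2.bfsOrdered hK1.conn hKanti).exists_shape (by omega)
    hKedge (fun i => (hd i).trans (hK3 i).symm) hKanti
  refine ⟨H, K, x, p, a₁, b₁, a₂, b₂, q, a₃, b₃, a₄, b₄, ⟨φ'⟩, he, hcyc, hx, hd, hs, hs',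
    ht1.stableShape ht2 hK2 hK1.conn hKanti, ht2, hK4, fun i j hij => ?_⟩
  rw [hd, hd] at hij
  exact hx.lt_of_card_nbrs_lt hα hij

namespace MaximalPair

variable {N : ℕ} {α : ℝ} {d : ℕ → ℕ} {H K : SimpleGraph (Fin N)} {x : Fin N → ℝ} {p : ℕ → ℕ}
  {a₁ b₁ a₂ b₂ : ℕ} {q : ℕ → ℕ} {a₃ b₃ a₄ b₄ : ℕ}

theorem sum_d (h : MaximalPair α d H K x p a₁ b₁ a₂ b₂ q a₃ b₃ a₄ b₄) :
    ∑ i ∈ range N, d i = 2 * N + 2 := by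
  rw [← Fin.sum_univ_eq_sum_range]
  simp only [h.deg]
  rw [sum_card_nbrs]
  have := h.cyclic.2
  rw [Nat.card_eq_fintype_card, Fintype.card_fin] at this
  omega

theorem eq_of_eq (h : MaximalPair α d H K x p a₁ b₁ a₂ b₂ q a₃ b₃ a₄ b₄) {i j : Fin N}
    (hij : x i = x j) : d i = d j := by
  by_contra hne
  rcases lt_or_gt_of_ne hne with hlt | hlt
  · exact (h.lt_of_lt _ _ hlt).ne hij
  · exact (h.lt_of_lt _ _ hlt).ne hij.symm

/-- Equal entries have equal degrees, so the eigenvalue equations leave equal neighbor sums. -/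
theorem nbrSum_eq_of_eq (h : MaximalPair α d H K x p a₁ b₁ a₂ b₂ q a₃ b₃ a₄ b₄) {i j : Fin N}
    (hij : x i = x j) : nbrSum H x i = nbrSum H x j := by
  obtain ⟨μ, s, -, h1⟩ := h.ext.eig
  have hi := h1 i
  have hj := h1 j
  unfold localSum at hi hj
  rw [← h.deg, hij, h.eq_of_eq hij] at hi
  rw [← h.deg] at hj
  linarith

theorem card_nbrsK (h : MaximalPair α d H K x p a₁ b₁ a₂ b₂ q a₃ b₃ a₄ b₄) (i : Fin N) :
    #(nbrs K i) = d i := by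
  classical
  rw [h.shapeK.deg i i.isLt, ← card_shapeAdj h.shapeK.p_lt ⟨h.shapeK.p_lt₁, h.shapeK.lt₁,
    h.shapeK.lt_N₁⟩ ⟨h.shapeK.p_lt₂, h.shapeK.lt₂, h.shapeK.lt_N₂⟩ h.shapeK.ne i.isLt,
    ← card_map Fin.valEmbedding]
  congr 1
  ext j
  simp only [mem_map, mem_nbrs, mem_filter, mem_range, Fin.valEmbedding_apply]
  constructor
  · rintro ⟨j, hj, rfl⟩
    exact ⟨j.isLt, (h.hasShapeK _ _).mp hj⟩
  · rintro ⟨hj, hadj⟩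
    exact ⟨⟨j, hj⟩, (h.hasShapeK _ _).mpr hadj, rfl⟩

end MaximalPair

/-- In an antitone sequence of numbers at least `2` with sum `2 N + 2`, the excess over `2` is
distributed in one of two ways. -/
theorem eq_two_of_sum {N : ℕ} {d : ℕ → ℕ} (hN : 2 ≤ N) (hanti : ∀ i j, i ≤ j → j < N → d j ≤ d i)
    (h2 : ∀ i < N, 2 ≤ d i) (hs : ∑ i ∈ range N, d i = 2 * N + 2) :
    (d 0 = 4 ∧ ∀ i, 1 ≤ i → i < N → d i = 2) ∨
      (d 0 = 3 ∧ d 1 = 3 ∧ ∀ i, 2 ≤ i → i < N → d i = 2) := by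
  obtain ⟨M, rfl⟩ : ∃ M, N = M + 2 := ⟨N - 2, by omega⟩
  rw [sum_range_succ', sum_range_succ'] at hs
  have h3 : ∑ i ∈ range M, d (i + 1 + 1) = ∑ i ∈ range M, (d (i + 1 + 1) - 2) + 2 * M := by
    have : ∀ i ∈ range M, d (i + 1 + 1) = (d (i + 1 + 1) - 2) + 2 := fun i hi => by
      have := h2 (i + 1 + 1) (by simp at hi; omega)
      omega
    conv_lhs => rw [sum_congr rfl this]
    rw [sum_add_distrib]
    simp [mul_comm]
  have h0 := h2 0 (by omega)
  have h1 := h2 1 (by omega)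
  have h01 := hanti 0 1 (by omega) (by omega)
  simp only [zero_add] at hs
  have hle : ∀ i < M, d (i + 1 + 1) - 2 ≤ ∑ i ∈ range M, (d (i + 1 + 1) - 2) := fun i hi =>
    single_le_sum (f := fun i => d (i + 1 + 1) - 2) (fun _ _ => Nat.zero_le _) (mem_range.mpr hi)
  by_cases h1' : d 1 = 2
  · have hall : ∀ i, 1 ≤ i → i < M + 2 → d i = 2 := fun i hi hiN => by
      have := hanti 1 i hi hiN
      have := h2 i hiN
      omega
    have hz : ∑ i ∈ range M, (d (i + 1 + 1) - 2) = 0 := sum_eq_zero fun i hi => by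
      rw [hall (i + 1 + 1) (by omega) (by simp at hi; omega), Nat.sub_self]
    left
    exact ⟨by omega, hall⟩
  · right
    refine ⟨by omega, by omega, fun i hi hiN => ?_⟩
    have := hle (i - 2) (by omega)
    rw [show i - 2 + 1 + 1 = i by omega] at this
    have := h2 i hiN
    omega

theorem sum_le_of_le_two {N k : ℕ} {d : ℕ → ℕ} (hk : k < N)
    (hle : ∀ i, k ≤ i → i < N → d i ≤ 2) (hlast : d (N - 1) = 1) :
    ∑ i ∈ range N, d i + 1 ≤ ∑ i ∈ range k, d i + 2 * (N - k) := by
  obtain ⟨M, rfl⟩ : ∃ M, N = M + 1 := ⟨N - 1, by omega⟩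
  rw [sum_range_succ, ← sum_range_add_sum_Ico d (show k ≤ M by omega)]
  have : ∑ i ∈ Ico k M, d i ≤ ∑ i ∈ Ico k M, 2 := sum_le_sum fun i hi => by
    rw [mem_Ico] at hi
    exact hle i hi.1 (by omega)
  simp only [sum_const, Nat.card_Ico, smul_eq_mul] at this
  rw [Nat.add_sub_cancel] at hlast
  omega

namespace MaximalPair

variable {N : ℕ} {α : ℝ} {d : ℕ → ℕ} {H K : SimpleGraph (Fin N)} {x : Fin N → ℝ} {p : ℕ → ℕ}
  {a₁ b₁ a₂ b₂ : ℕ} {q : ℕ → ℕ} {a₃ b₃ a₄ b₄ : ℕ}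

/-- Otherwise the degree sum is at most `3 + 3 + 2 (N - 2) - 1`, one less than `2 N + 2`. -/
theorem four_le_or (h : MaximalPair α d H K x p a₁ b₁ a₂ b₂ q a₃ b₃ a₄ b₄) (hN : 4 ≤ N)
    (hd1 : 3 ≤ d 1) (hlast : d (N - 1) = 1) : 4 ≤ d 0 ∨ 3 ≤ d 2 := by
  by_contra hcon
  have h1 := h.shape.anti 0 1 (by omega) (by omega)
  have h2 := sum_le_of_le_two (k := 2) (show 2 < N by omega)
    (fun i hi hiN => by have := h.shape.anti 2 i hi hiN; omega) hlast
  rw [h.sum_d, sum_range_succ, sum_range_one] at h2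
  omega

theorem types (h : MaximalPair α d H K x p a₁ b₁ a₂ b₂ q a₃ b₃ a₄ b₄) {n t : ℕ} (hN : N = n - t)
    (ht : t + 4 ≤ n) :
    IsType1 n t d ∨ IsType2 n t d ∨ IsType3 n t d ∨ IsType4 n t d := by
  have hN4 : 4 ≤ N := by omega
  have hs := h.sum_d
  have hanti := h.shape.anti
  by_cases hlast : 2 ≤ d (N - 1)
  · rcases eq_two_of_sum (by omega) hanti
      (fun i hi => hlast.trans (hanti i (N - 1) (by omega) (by omega))) hs with h1 | h1
    · have := h.shape.d_zero_lt
      exact Or.inl ⟨by omega, h1.1, by rw [← hN]; exact h1.2⟩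
    · exact Or.inr (Or.inl ⟨ht, h1.1, h1.2.1, by rw [← hN]; exact h1.2.2⟩)
  have hl : d (N - 1) = 1 := by
    have := h.shape.deg (N - 1) (by omega)
    rw [if_pos (show 0 < N - 1 by omega)] at this
    omega
  have hp1 := h.shapeK.p_lt₁; have hl1 := h.shapeK.lt₁; have hN1 := h.shapeK.lt_N₁
  have hp2 := h.shapeK.p_lt₂; have hl2 := h.shapeK.lt₂; have hN2 := h.shapeK.lt_N₂
  have hne := h.shapeK.ne
  -- The larger end of an extra edge has degree at least two. If `d 3 < 2`, both extra edges would
  -- be `12`.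
  have hd3 : 2 ≤ d 3 := by
    by_contra hd3
    have e1 : b₃ < 3 := by
      by_contra hb
      exact hd3 (h.shapeK.two_le_d (by omega))
    have e2 : b₄ < 3 := by
      by_contra hb
      exact hd3 (h.shapeK.swap.two_le_d (by omega))
    omega
  have hN5 : 5 ≤ N := by
    by_contra hN5
    rw [show N - 1 = 3 by omega] at hl
    omega
  have hd13 := hanti 1 3 (by omega) (by omega)
  by_cases hd1 : 3 ≤ d 1
  · right; right; right
    exact ⟨by omega, hanti 0 1 (by omega) (by omega), hd1, hanti 2 3 (by omega) (by omega), hd3,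
      fun i j _ hij hj => hanti i j hij (by omega), by rw [← hN]; exact hl⟩
  · right; right; left
    have hd1' : d 1 = 2 := by omega
    -- Since `d 1 = 2`, the extra edges are disjoint, and two disjoint edges do not fit into `1, 2,
    -- 3`.
    have hd4 : 2 ≤ d 4 := by
      by_contra hd4
      have e1 : b₃ < 4 := by
        by_contra hb
        exact hd4 (h.shapeK.two_le_d (by omega))
      have e2 : b₄ < 4 := by
        by_contra hb
        exact hd4 (h.shapeK.swap.two_le_d (by omega))
      have := h.shapeK.extra_disjoint hd1'
      omega
    have hN6 : 6 ≤ N := by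
      by_contra hN6
      rw [show N - 1 = 4 by omega] at hl
      omega
    have h2 := sum_le_of_le_two (k := 1) (show 1 < N by omega)
      (fun i hi hiN => by have := hanti 1 i hi hiN; omega) hl
    rw [h.sum_d, sum_range_one] at h2
    refine ⟨by omega, by omega, fun i hi hi4 => ?_, ?_, fun i j _ hij hj =>
      hanti i j hij (by omega), by rw [← hN]; exact hl⟩
    · have := hanti 1 i hi (by omega)
      have := hanti i 4 hi4 (by omega)
      omega
    · have := hanti 1 5 (by omega) (by omega)
      omega

end MaximalPair

end ConeGraph

/-! ### Carrying the extra edges of `K` over to `H` through the eigenvector. -/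

namespace ConeGraph

open SimpleGraph Finset

theorem exists_nbrs_eq_pair {V : Type*} [Fintype V] [DecidableEq V] {H : SimpleGraph V} {v u : V}
    (hc : #(nbrs H v) = 2) (h : H.Adj v u) : ∃ w, w ≠ u ∧ nbrs H v = {u, w} := by
  have h1 : #((nbrs H v).erase u) = 1 := by
    rw [card_erase_of_mem (by simpa using h), hc]
  obtain ⟨w, hw⟩ := card_eq_one.mp h1
  refine ⟨w, ?_, ?_⟩
  · have : w ∈ (nbrs H v).erase u := by rw [hw]; exact mem_singleton_self w
    exact (mem_erase.mp this).1
  · rw [← insert_erase (show u ∈ nbrs H v by simpa using h), hw]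

theorem nbrs_eq_pair {V : Type*} [Fintype V] [DecidableEq V] {H : SimpleGraph V} {v u w : V}
    (hc : #(nbrs H v) = 2) (h : H.Adj v u) (h' : H.Adj v w) (hne : w ≠ u) :
    nbrs H v = {u, w} := by
  obtain ⟨w', -, h2⟩ := exists_nbrs_eq_pair hc h
  have : w ∈ nbrs H v := by simpa using h'
  rw [h2, mem_insert, mem_singleton] at this
  rw [h2, this.resolve_left hne]

theorem nbrSum_of_pair {V : Type*} [Fintype V] [DecidableEq V] {H : SimpleGraph V} {v u w : V}
    (h : nbrs H v = {u, w}) (hne : w ≠ u) (x : V → ℝ) : nbrSum H x v = x u + x w := by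
  rw [nbrSum, h, sum_pair hne.symm]

namespace MaximalPair

variable {N : ℕ} {α : ℝ} {d : ℕ → ℕ} {H K : SimpleGraph (Fin N)} {x : Fin N → ℝ} {p : ℕ → ℕ}
  {a₁ b₁ a₂ b₂ : ℕ} {q : ℕ → ℕ} {a₃ b₃ a₄ b₄ : ℕ}

theorem swap (h : MaximalPair α d H K x p a₁ b₁ a₂ b₂ q a₃ b₃ a₄ b₄) :
    MaximalPair α d H K x p a₁ b₁ a₂ b₂ q a₄ b₄ a₃ b₃ :=
  { h with shapeK := h.shapeK.swap, hasShapeK := h.hasShapeK.swap }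

theorem swapH (h : MaximalPair α d H K x p a₁ b₁ a₂ b₂ q a₃ b₃ a₄ b₄) :
    MaximalPair α d H K x p a₂ b₂ a₁ b₁ q a₃ b₃ a₄ b₄ :=
  { h with shape := h.shape.swap, hasShape := h.hasShape.swap }

theorem localSum_eq (h : MaximalPair α d H K x p a₁ b₁ a₂ b₂ q a₃ b₃ a₄ b₄) :
    ∃ μ s : ℝ, 0 ≤ s ∧ ∀ v, nbrSum H x v + α * d v * x v + s = μ * x v := by
  obtain ⟨μ, s, hs, h1⟩ := h.ext.eig
  refine ⟨μ, s, hs, fun v => ?_⟩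
  rw [h.deg]
  exact h1 v

/-- A triangle of `K` with two vertices of degree two gives one of `H`. -/
theorem exists_triangle (h : MaximalPair α d H K x p a₁ b₁ a₂ b₂ q a₃ b₃ a₄ b₄) {o i i' : Fin N}
    (ho : ∀ w : Fin N, d w = d o → w = o) (hio : i ≠ o) (hi'o : i' ≠ o)
    (hK : K.Adj i o) (hK' : K.Adj i' o) (hii' : K.Adj i i') (hd : d i = 2) (hd' : d i' = 2)
    (hH : H.Adj i o) : ∃ j, H.Adj i j ∧ H.Adj j o := by
  have e1 := nbrSum_of_pair (nbrs_eq_pair ((h.card_nbrsK i).trans hd) hK hii' hi'o) hi'o x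
  have e2 := nbrSum_of_pair (nbrs_eq_pair ((h.card_nbrsK i').trans hd') hK' hii'.symm hio) hio x
  rw [h.nbrSum_eq] at e1 e2
  -- In `K` the neighbors of `i` are `o` and `i'`, those of `i'` are `o` and `i`. Subtracting the
  -- two equations gives `(μ - 2 α + 1) (x i - x i') = 0`, and positivity of the entries makes the
  -- first factor positive.
  have hxi : x i = x i' := by
    obtain ⟨μ, s, hs, heig⟩ := h.localSum_eq
    have f1 := heig i
    have f2 := heig i'
    rw [e1, hd] at f1
    rw [e2, hd'] at f2
    have p1 := h.ext.pos i
    have p2 := h.ext.pos i'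
    have p3 := h.ext.pos o
    push_cast at f1 f2
    have hμ : 0 < μ - α * 2 := by
      by_contra! hcon
      nlinarith
    have : (μ - α * 2 + 1) * (x i - x i') = 0 := by linarith
    rcases mul_eq_zero.mp this with h0 | h0 <;> linarith
  obtain ⟨j, hjo, hj⟩ := exists_nbrs_eq_pair ((h.deg i).symm.trans hd) hH
  have hij : H.Adj i j := by
    rw [← mem_nbrs, hj]
    simp
  refine ⟨j, hij, ?_⟩
  have e3 := nbrSum_of_pair hj hjo x
  -- The second neighbor `j` of `i` in `H` repeats the entry of `i`. Hence `j` has degree two, and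
  -- comparing its neighbor sum with that of `i` gives its other neighbor the entry of `o`. The
  -- degree of `o` is unique, so that neighbor is `o`.
  have hxj : x i = x j := by linarith
  have hdj : d j = 2 := (h.eq_of_eq hxj).symm.trans hd
  obtain ⟨w, hwi, hw⟩ := exists_nbrs_eq_pair ((h.deg j).symm.trans hdj) hij.symm
  have e4 := nbrSum_of_pair hw hwi x
  have e5 := h.nbrSum_eq_of_eq hxj
  have hxw : x w = x o := by linarith
  have := ho w (h.eq_of_eq hxw)
  rw [← this, ← mem_nbrs, hw]
  simp

theorem exists_triangle_one (h : MaximalPair α d H K x p a₁ b₁ a₂ b₂ q a₃ b₃ a₄ b₄)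
    (hd0 : 4 ≤ d 0) (hd1 : d 1 = 2) (hd4 : d 4 = 2) (hN : 5 ≤ N) :
    ∃ j, H.Adj ⟨1, by omega⟩ j ∧ H.Adj j ⟨0, by omega⟩ := by
  wlog hle : a₃ ≤ a₄ generalizing a₃ b₃ a₄ b₄
  · exact this h.swap (by omega)
  obtain ⟨rfl, rfl⟩ := h.shapeK.extra_eq_one_two hd0 hd1 hd4 hle
  have hanti := h.shape.anti
  have q1 := (h.shapeK.p_eq_zero_iff (j := 1) (by omega) (by omega)).mpr (by omega)
  have q2 := (h.shapeK.p_eq_zero_iff (j := 2) (by omega) (by omega)).mpr (by omega)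
  have p1 := (h.shape.p_eq_zero_iff (j := 1) (by omega) (by omega)).mpr (by omega)
  refine h.exists_triangle (o := ⟨0, by omega⟩) (i := ⟨1, by omega⟩) (i' := ⟨2, by omega⟩) ?_
    (by simp) (by simp) ((h.hasShapeK _ _).mpr ?_) ((h.hasShapeK _ _).mpr ?_)
    ((h.hasShapeK _ _).mpr ?_) hd1 ?_ ((h.hasShape _ _).mpr ?_)
  · intro w hw
    by_contra hne
    have hne' : w.val ≠ 0 := fun hw0 => hne (Fin.ext hw0)
    have := hanti 1 w (by omega) w.isLt
    simp only at hw
    omega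
  · dsimp only [ShapeAdj]; omega
  · dsimp only [ShapeAdj]; omega
  · dsimp only [ShapeAdj]; omega
  · have := hanti 2 4 (by omega) (by omega)
    have := hanti 1 2 (by omega) (by omega)
    simp only
    omega
  · dsimp only [ShapeAdj]; omega

/-- In type 3 the extra edges of `H` form a perfect matching of `{1, 2, 3, 4}`. -/
theorem extra_mem (h : MaximalPair α d H K x p a₁ b₁ a₂ b₂ q a₃ b₃ a₄ b₄)
    (hd0 : 5 ≤ d 0) (hd1 : d 1 = 2) (hd4 : d 4 = 2) (i : ℕ) (hi : 0 < i) (hi4 : i ≤ 4) :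
    i = a₁ ∨ i = b₁ ∨ i = a₂ ∨ i = b₂ := by
  wlog hle : a₃ ≤ a₄ generalizing a₃ b₃ a₄ b₄
  · exact this h.swap (by omega)
  obtain ⟨rfl, rfl⟩ := h.shapeK.extra_eq_one_two (by omega) hd1 hd4 hle
  obtain ⟨rfl, rfl⟩ := h.shapeK.swap.extra_eq_three_four hd0 hd1 hd4 rfl rfl
  have hanti := h.shape.anti
  have hN := h.shape.d_zero_lt
  have qz : ∀ j, 0 < j → j ≤ 4 → q j = 0 := fun j hj hj4 =>
    (h.shapeK.p_eq_zero_iff hj (by omega)).mpr (by omega)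
  have pz := (h.shape.p_eq_zero_iff (j := i) (by omega) (by omega)).mpr (by omega)
  have hd2 : ∀ j, 0 < j → j ≤ 4 → d j = 2 := fun j hj hj4 => by
    have := hanti 1 j hj (by omega)
    have := hanti j 4 hj4 (by omega)
    omega
  have hw : ∀ w : Fin N, d w = d (⟨0, by omega⟩ : Fin N) → w = ⟨0, by omega⟩ := by
    intro w hw
    by_contra hne
    have hne' : w.val ≠ 0 := fun hw0 => hne (Fin.ext hw0)
    have := hanti 1 w (by omega) w.isLt
    simp only at hw
    omega
  obtain ⟨i', hi', hi'4, hadj⟩ : ∃ i', 0 < i' ∧ i' ≤ 4 ∧ ShapeAdj N q 1 2 3 4 i i' := by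
    have := qz 1 (by omega) (by omega); have := qz 2 (by omega) (by omega)
    have := qz 3 (by omega) (by omega); have := qz 4 (by omega) (by omega)
    interval_cases i
    · exact ⟨2, by omega, by omega, by unfold ShapeAdj; omega⟩
    · exact ⟨1, by omega, by omega, by unfold ShapeAdj; omega⟩
    · exact ⟨4, by omega, by omega, by unfold ShapeAdj; omega⟩
    · exact ⟨3, by omega, by omega, by unfold ShapeAdj; omega⟩
  have qi := qz i hi hi4
  have qi' := qz i' hi' hi'4
  obtain ⟨j, hj1, hj2⟩ := h.exists_triangle (o := ⟨0, by omega⟩) (i := ⟨i, by omega⟩)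
    (i' := ⟨i', by omega⟩) hw (by simp; omega) (by simp; omega)
    ((h.hasShapeK _ _).mpr (by dsimp only [ShapeAdj]; omega))
    ((h.hasShapeK _ _).mpr (by dsimp only [ShapeAdj]; omega))
    ((h.hasShapeK _ _).mpr hadj) (hd2 i hi hi4) (hd2 i' hi' hi'4)
    ((h.hasShape _ _).mpr (by dsimp only [ShapeAdj]; omega))
  have hj0 : 0 < j.val := by
    by_contra hj0
    exact hj2.ne (Fin.ext (by simp only; omega))
  have hp1 := h.shape.p_lt₁; have hp2 := h.shape.p_lt₂
  rw [h.hasShape] at hj1 hj2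
  dsimp only [ShapeAdj] at hj1 hj2
  omega

theorem adj_of_three_three (h : MaximalPair α d H K x p a₁ b₁ a₂ b₂ q a₃ b₃ a₄ b₄)
    (hd0 : d 0 = 3) (hd1 : d 1 = 3) (hd2 : ∀ i, 2 ≤ i → i < N → d i = 2) (hN : 4 ≤ N) :
    H.Adj ⟨0, by omega⟩ ⟨1, by omega⟩ ∧ H.Adj ⟨0, by omega⟩ ⟨2, by omega⟩ ∧
      H.Adj ⟨1, by omega⟩ ⟨2, by omega⟩ := by
  have p1 := (h.shape.p_eq_zero_iff (j := 1) (by omega) (by omega)).mpr (by omega)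
  have p2 := (h.shape.p_eq_zero_iff (j := 2) (by omega) (by omega)).mpr (by omega)
  have q2 := (h.shapeK.p_eq_zero_iff (j := 2) (by omega) (by omega)).mpr (by omega)
  have hH02 : H.Adj ⟨0, by omega⟩ ⟨2, by omega⟩ := (h.hasShape _ _).mpr
    (by dsimp only [ShapeAdj]; omega)
  refine ⟨(h.hasShape _ _).mpr (by dsimp only [ShapeAdj]; omega), hH02, ?_⟩
  have hK12 := h.shapeK.shapeAdj_one_two_of_three_le (by omega)
    (by rw [hd2 3 (by omega) (by omega)])
  have hK12' : K.Adj ⟨2, by omega⟩ ⟨1, by omega⟩ := (h.hasShapeK _ _).mpr (shapeAdj_comm.mp hK12)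
  have hK02 : K.Adj ⟨2, by omega⟩ ⟨0, by omega⟩ := (h.hasShapeK _ _).mpr
    (by dsimp only [ShapeAdj]; omega)
  have hne : (⟨1, by omega⟩ : Fin N) ≠ ⟨0, by omega⟩ := by simp
  have e1 := nbrSum_of_pair (nbrs_eq_pair ((h.card_nbrsK _).trans (hd2 2 le_rfl (by omega)))
    hK02 hK12' hne) hne x
  rw [h.nbrSum_eq] at e1
  obtain ⟨w, hw, hw'⟩ := exists_nbrs_eq_pair ((h.deg _).symm.trans (hd2 2 le_rfl (by omega)))
    hH02.symm
  have e2 := nbrSum_of_pair hw' hw x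
  have hxw : x w = x ⟨1, by omega⟩ := by linarith
  have hdw := h.eq_of_eq hxw
  have hw1 : w = ⟨1, by omega⟩ := by
    have hw0 : w.val ≠ 0 := fun hh => hw (Fin.ext hh)
    by_contra hne'
    have hw1 : w.val ≠ 1 := fun hh => hne' (Fin.ext hh)
    have := hd2 w (by omega) w.isLt
    simp only at hdw
    omega
  have : w ∈ nbrs H ⟨2, by omega⟩ := by
    rw [hw']
    simp
  rw [mem_nbrs, hw1] at this
  exact this.symm

/-- In type 4, the entry of the vertex `3` exceeds all later ones. -/
theorem lt_three (h : MaximalPair α d H K x p a₁ b₁ a₂ b₂ q 1 2 1 3) (hd0 : 3 ≤ d 0)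
    (hd3 : 2 ≤ d 3) (i : Fin N) (hi : 4 ≤ i.val) : x i < x ⟨3, by omega⟩ := by
  classical
  have hN := i.isLt
  set v3 : Fin N := ⟨3, by omega⟩ with hv3
  by_contra hcon
  have hi3 : x i = x v3 := le_antisymm (h.anti (show v3 ≤ i by rw [Fin.le_def]; simp [v3]; omega))
    (not_lt.mp hcon)
  -- Taking the last vertex `m` tied with `3` makes the entry of its first child `c` strictly
  -- smaller than that of `3`.
  obtain ⟨m, hm, hmax⟩ := exists_max_image ({m : Fin N | x m = x v3} : Finset (Fin N)) id
    ⟨v3, by simp⟩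
  rw [mem_filter] at hm
  have hxm := hm.2
  have him : i.val ≤ m.val := by
    have := hmax i (by simp [hi3])
    exact Fin.le_def.mp this
  have hlt : ∀ w : Fin N, m < w → x w < x v3 := by
    intro w hw
    refine lt_of_le_of_ne ((h.anti hw.le).trans hxm.le) fun hne => ?_
    have := hmax w (by simp [hne])
    exact absurd hw (not_lt.mpr this)
  have hdm : d m = d 3 := h.eq_of_eq hxm
  have hsum : nbrSum K x m = nbrSum K x v3 := by
    rw [h.nbrSum_eq, h.nbrSum_eq, h.nbrSum_eq_of_eq hxm]
  have hc := h.shapeK.childCount_eq (u := m) (by omega) m.isLt (by omega) (by omega) (by omega)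
    (by omega)
  have hcB := Shape.childrenBefore_succ N q m
  have hcB' := Shape.childrenBefore_lt N q (m + 1) h.shape.N_pos
  have hqc : q (childrenBefore N q m + 1) = m := h.shapeK.p_eq_of_le (by omega) (by omega)
    (by omega)
  set c : Fin N := ⟨childrenBefore N q m + 1, by omega⟩ with hcdef
  have hmc : m < c := by
    have := h.shapeK.p_lt (childrenBefore N q m + 1) (by omega) (by omega)
    rw [Fin.lt_def]
    simp only [hcdef]
    omega
  have hxc := hlt c hmc
  have hq1 : ∀ j, 0 < j → j ≤ 3 → q j = 0 := fun j hj hj3 =>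
    (h.shapeK.p_eq_zero_iff hj (by omega)).mpr (by omega)
  have hqm := h.shapeK.p_lt m (by omega) m.isLt
  let v0 : Fin N := ⟨0, by omega⟩
  let v1 : Fin N := ⟨1, by omega⟩
  -- Neighbor sums are compared relative to `x c`. Only the parent of `m` can contribute positively
  -- at `m`, while `3` has the neighbors `0` and `1` and no neighbor after `c`. The degrees and the
  -- sums at `m` and `3` agree, which forces `x 1 ≤ x c`, a contradiction.
  have ub : ∑ w ∈ nbrs K m, (x w - x c) ≤ x v0 - x c := by
    have hmem : (⟨q m, by omega⟩ : Fin N) ∈ nbrs K m := by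
      rw [mem_nbrs, h.hasShapeK]
      dsimp only [ShapeAdj]
      omega
    rw [← add_sum_erase _ _ hmem]
    have h1 : ∑ w ∈ (nbrs K m).erase ⟨q m, by omega⟩, (x w - x c) ≤ 0 := by
      refine sum_nonpos fun w hw => ?_
      rw [mem_erase, mem_nbrs, h.hasShapeK] at hw
      have hwne : w.val ≠ q m := fun hh => hw.1 (Fin.ext hh)
      have hadj := hw.2
      dsimp only [ShapeAdj] at hadj
      have hqw : q w = m := by omega
      have := (h.shapeK.p_eq_iff (u := m) (by omega) w.isLt).mp hqw
      have hcw : c ≤ w := by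
        rw [Fin.le_def]
        simp only [hcdef]
        omega
      have := h.anti hcw
      linarith
    have h2 : x ⟨q m, by omega⟩ ≤ x v0 := h.anti (Fin.le_def.mpr (Nat.zero_le _))
    linarith
  have lb : (x v0 - x c) + (x v1 - x c) ≤ ∑ w ∈ nbrs K v3, (x w - x c) := by
    have hne : v0 ≠ v1 := by simp [v0, v1]
    have hsub : ({v0, v1} : Finset (Fin N)) ⊆ nbrs K v3 := by
      have := hq1 3 (by omega) (by omega)
      intro w hw
      rw [mem_insert, mem_singleton] at hw
      rw [mem_nbrs, h.hasShapeK]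
      rcases hw with rfl | rfl
      · dsimp only [ShapeAdj, v0, v3]
        omega
      · dsimp only [ShapeAdj, v1, v3]
        omega
    rw [← sum_pair hne (f := fun w => x w - x c)]
    refine sum_le_sum_of_subset_of_nonneg hsub fun w hw _ => ?_
    rw [mem_nbrs, h.hasShapeK] at hw
    have := hq1 3 (by omega) (by omega)
    dsimp only [ShapeAdj, v3] at hw
    have hwc : w ≤ c := by
      rw [Fin.le_def]
      by_contra hcw
      have := h.shapeK.p_mono c w (by simp [hcdef]) (by omega) w.isLt
      simp only [hcdef] at this hcw
      omega
    have := h.anti hwc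
    linarith
  have hx1 : x v3 ≤ x v1 := h.anti (by rw [Fin.le_def]; simp [v1, hv3])
  simp only [sum_sub_distrib, sum_const, h.card_nbrsK, hdm] at ub lb
  unfold nbrSum at hsum
  have : d v3 = d 3 := rfl
  rw [this] at lb
  linarith

/-- In type 4, `H` has the same extra edges as `K`. -/
theorem adj_one (h : MaximalPair α d H K x p a₁ b₁ a₂ b₂ q 1 2 1 3) (hd0 : 3 ≤ d 0)
    (hd3 : 2 ≤ d 3) (hN : 4 ≤ N) :
    H.Adj ⟨1, by omega⟩ ⟨2, by omega⟩ ∧ H.Adj ⟨1, by omega⟩ ⟨3, by omega⟩ := by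
  classical
  set v1 : Fin N := ⟨1, by omega⟩ with hv1
  set v3 : Fin N := ⟨3, by omega⟩ with hv3
  have hp1 : ∀ j, 0 < j → j ≤ 3 → p j = 0 := fun j hj hj3 =>
    (h.shape.p_eq_zero_iff hj (by omega)).mpr (by omega)
  have hq1 : ∀ j, 0 < j → j ≤ 3 → q j = 0 := fun j hj hj3 =>
    (h.shapeK.p_eq_zero_iff hj (by omega)).mpr (by omega)
  have p1 := hp1 1 (by omega) (by omega)
  have q1 := hq1 1 (by omega) (by omega)
  -- In both graphs the children of `1` start at `d 0 + 1`. In `K` the vertex `1` lies on both extra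
  -- edges, so it has no more children there than in `H`.
  have hKc : ∀ w : Fin N, K.Adj v1 w → ¬ H.Adj v1 w → w.val = 2 ∨ w.val = 3 := by
    intro w hw hw'
    rw [h.hasShapeK] at hw
    rw [h.hasShape] at hw'
    dsimp only [ShapeAdj, v1] at hw hw'
    by_contra hne
    have hw0 : w.val ≠ 0 := by
      intro hw0
      rw [hw0, p1] at hw'
      omega
    have hqw : 1 < w.val ∧ q w = 1 := by omega
    have hpw : p w = 1 := by
      have d1 := h.shape.deg 1 (by omega)
      have d1' := h.shapeK.deg 1 (by omega)
      have e1 := (h.shapeK.p_eq_iff (u := 1) (by omega) w.isLt).mp hqw.2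
      refine h.shape.p_eq_of_le w.isLt ?_ ?_
      · rw [h.shape.childrenBefore_one, ← h.shapeK.childrenBefore_one]
        exact e1.1
      · rw [h.shape.childrenBefore_one]
        rw [h.shapeK.childrenBefore_one, h.shapeK.childrenBefore_two] at e1
        have := h.shape.ne
        have := h.shape.lt₁
        have := h.shape.lt₂
        norm_num at d1'
        split_ifs at d1 <;> omega
    omega
  have hHc : ∀ w : Fin N, H.Adj v1 w → ¬ K.Adj v1 w → 4 ≤ w.val := by
    intro w hw hw'
    by_contra hlt
    apply hw'
    rw [h.hasShapeK]
    have hne : w.val ≠ 1 := fun hh => hw.ne (Fin.ext hh.symm)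
    dsimp only [ShapeAdj, v1]
    omega
  have hcard : #(nbrs K v1 \ nbrs H v1) = #(nbrs H v1 \ nbrs K v1) := by
    have e1 := card_sdiff_add_card_inter (nbrs K v1) (nbrs H v1)
    have e2 := card_sdiff_add_card_inter (nbrs H v1) (nbrs K v1)
    rw [inter_comm] at e2
    rw [h.card_nbrsK] at e1
    rw [← h.deg] at e2
    omega
  have hsum : ∑ w ∈ nbrs K v1 \ nbrs H v1, x w = ∑ w ∈ nbrs H v1 \ nbrs K v1, x w := by
    have e := h.nbrSum_eq v1
    unfold nbrSum at e
    have e1 := sum_inter_add_sum_sdiff (nbrs K v1) (nbrs H v1) x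
    have e2 := sum_inter_add_sum_sdiff (nbrs H v1) (nbrs K v1) x
    rw [inter_comm] at e2
    linarith
  -- The two differences have equal size and equal sum of entries. One consists of vertices among
  -- `2`, `3`, the other of vertices from `4` on, whose entries are strictly below that of `3`, so
  -- both are empty.
  have hB : nbrs H v1 \ nbrs K v1 = ∅ := by
    by_contra hne
    have h1 : ∑ w ∈ nbrs H v1 \ nbrs K v1, x w < ∑ w ∈ nbrs H v1 \ nbrs K v1, x v3 := by
      refine sum_lt_sum_of_nonempty (nonempty_iff_ne_empty.mpr hne) fun w hw => ?_
      rw [mem_sdiff, mem_nbrs, mem_nbrs] at hw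
      exact h.lt_three hd0 hd3 w (hHc w hw.1 hw.2)
    have h2 : ∑ w ∈ nbrs K v1 \ nbrs H v1, x v3 ≤ ∑ w ∈ nbrs K v1 \ nbrs H v1, x w := by
      refine sum_le_sum fun w hw => ?_
      rw [mem_sdiff, mem_nbrs, mem_nbrs] at hw
      have := hKc w hw.1 hw.2
      exact h.anti (by rw [Fin.le_def, hv3]; simp only; omega)
    simp only [sum_const, hcard] at h1 h2
    linarith
  have hA : nbrs K v1 \ nbrs H v1 = ∅ := by
    rw [← card_eq_zero, hcard, hB, card_empty]
  have hsub : ∀ w : Fin N, K.Adj v1 w → H.Adj v1 w := by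
    intro w hw
    have := sdiff_eq_empty_iff_subset.mp hA (mem_nbrs.mpr hw)
    exact mem_nbrs.mp this
  constructor
  · apply hsub
    rw [h.hasShapeK]
    dsimp only [ShapeAdj, v1]
    omega
  · apply hsub
    rw [h.hasShapeK]
    change ShapeAdj N q 1 2 1 3 1 3
    unfold ShapeAdj
    omega

theorem extra_eq (h : MaximalPair α d H K x p a₁ b₁ a₂ b₂ q a₃ b₃ a₄ b₄) (hN : 5 ≤ N)
    (hd1 : 3 ≤ d 1) (hd3 : 2 ≤ d 3) (hlast : d (N - 1) = 1) :
    Shape N p d 1 2 1 3 ∧ HasShape H p 1 2 1 3 := by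
  wlog hb : b₃ = 2 ∧ b₄ = 3 generalizing a₃ b₃ a₄ b₄
  · have hcases := h.shapeK.extra_eq_of_three_le hd1 hd3 (h.four_le_or (by omega) hd1 hlast)
    exact this h.swap (by omega)
  obtain ⟨rfl, rfl, -⟩ := h.shapeK.extra_eq_of_three_le hd1 hd3 (h.four_le_or (by omega) hd1 hlast)
  obtain ⟨rfl, rfl⟩ := hb
  have hd0 : 3 ≤ d 0 := hd1.trans (h.shape.anti 0 1 (by omega) (by omega))
  obtain ⟨h1, h2⟩ := h.adj_one hd0 hd3 (by omega)
  rw [h.hasShape] at h1 h2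
  dsimp only [ShapeAdj] at h1 h2
  have p2 := (h.shape.p_eq_zero_iff (j := 2) (by omega) (by omega)).mpr (by omega)
  have p3 := (h.shape.p_eq_zero_iff (j := 3) (by omega) (by omega)).mpr (by omega)
  rw [p2] at h1
  rw [p3] at h2
  have : (a₁ = 1 ∧ b₁ = 2 ∧ a₂ = 1 ∧ b₂ = 3) ∨ (a₂ = 1 ∧ b₂ = 2 ∧ a₁ = 1 ∧ b₁ = 3) := by omega
  rcases this with ⟨rfl, rfl, rfl, rfl⟩ | ⟨rfl, rfl, rfl, rfl⟩
  · exact ⟨h.shape, h.hasShape⟩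
  · exact ⟨h.swapH.shape, h.swapH.hasShape⟩

end MaximalPair

end ConeGraph

namespace ConeGraph

open SimpleGraph Finset

/-! ### Isomorphisms with the extremal graphs -/

/-- A bijective homomorphism to a graph with at most as many edges is an isomorphism. -/
theorem nonempty_iso_of_injective {V W : Type*} [Fintype V] [Fintype W] {H : SimpleGraph V}
    {T : SimpleGraph W} (f : V → W) (hf : Function.Injective f)
    (hcard : Fintype.card V = Fintype.card W) (hadj : ∀ u v, H.Adj u v → T.Adj (f u) (f v))
    (hle : T.edgeSet.ncard ≤ H.edgeSet.ncard) : Nonempty (H ≃g T) := by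
  have hbij : Function.Bijective f := (Fintype.bijective_iff_injective_and_card f).mpr ⟨hf, hcard⟩
  have hsub : Sym2.map f '' H.edgeSet ⊆ T.edgeSet := by
    rintro _ ⟨e, he, rfl⟩
    induction e using Sym2.ind with
    | _ u v => exact hadj u v he
  have heq : Sym2.map f '' H.edgeSet = T.edgeSet := by
    refine Set.eq_of_subset_of_ncard_le hsub ?_ (Set.toFinite _)
    rwa [Set.ncard_image_of_injective _ (Sym2.map.injective hf)]
  refine ⟨⟨Equiv.ofBijective f hbij, ?_⟩⟩
  intro u v
  refine ⟨fun h => ?_, hadj u v⟩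
  have h1 : s(f u, f v) ∈ T.edgeSet := h
  rw [← heq] at h1
  obtain ⟨e, he, he'⟩ := h1
  have h2 : e = s(u, v) := Sym2.map.injective hf (by rw [he', Sym2.map_mk])
  rwa [h2] at he

/-- Since `H` has `N + 1` edges, an upper bound on the edges of the model replaces any check of
non-adjacency. -/
theorem HasShape.nonempty_iso {N : ℕ} {p : ℕ → ℕ} {a₁ b₁ a₂ b₂ : ℕ} {H : SimpleGraph (Fin N)}
    (h : HasShape H p a₁ b₁ a₂ b₂) (hH : IsCyclic 2 H) {W : Type*} [Fintype W]
    {T : SimpleGraph W} (f : Fin N → W) (hf : Function.Injective f)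
    (hcard : N = Fintype.card W)
    (htree : ∀ i j : Fin N, i < j → i.val = p j → T.Adj (f i) (f j))
    (h1 : ∀ i j : Fin N, i.val = a₁ → j.val = b₁ → T.Adj (f i) (f j))
    (h2 : ∀ i j : Fin N, i.val = a₂ → j.val = b₂ → T.Adj (f i) (f j))
    (hT : T.edgeSet.ncard ≤ N + 1) : Nonempty (H ≃g T) := by
  refine nonempty_iso_of_injective f hf (by simpa using hcard) ?_ ?_
  · have key : ∀ u v : Fin N, u < v → H.Adj u v → T.Adj (f u) (f v) := by
      intro u v huv huv'
      rw [h] at huv'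
      rcases huv' with ⟨-, -, h' | h' | h'⟩ | ⟨h', -⟩
      · exact htree u v huv h'
      · exact h1 u v h'.1 h'.2
      · exact h2 u v h'.1 h'.2
      · exact absurd huv (not_lt.mpr (Fin.le_def.mpr h'.le))
    intro u v huv
    rcases lt_trichotomy u v with hlt | rfl | hlt
    · exact key u v hlt huv
    · exact absurd rfl huv.ne
    · exact (key v u hlt huv.symm).symm
  · have := hH.2
    rw [Nat.card_eq_fintype_card, Fintype.card_fin] at this
    omega

/-- The edges of a path. -/
def pathEdges (a b o ℓ : ℕ) : Finset (Sym2 ℕ) :=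
  (range ℓ).image fun k => s(pathVertex a b o ℓ k, pathVertex a b o ℓ (k + 1))

theorem card_pathEdges_le (a b o ℓ : ℕ) : #(pathEdges a b o ℓ) ≤ ℓ :=
  card_image_le.trans (card_range ℓ).le

theorem mem_pathEdges {a b o ℓ u v : ℕ} (h : pathRel a b o ℓ u v) : s(u, v) ∈ pathEdges a b o ℓ := by
  obtain ⟨k, hk, rfl, rfl⟩ := h
  exact mem_image_of_mem _ (mem_range.mpr hk)

theorem ncard_edgeSet_fromRel_le {N : ℕ} {R : Fin N → Fin N → Prop} (S : Finset (Sym2 ℕ))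
    (h : ∀ u v, R u v → s(u.val, v.val) ∈ S) : (SimpleGraph.fromRel R).edgeSet.ncard ≤ #S := by
  rw [← Set.ncard_image_of_injective _ (Sym2.map.injective Fin.val_injective),
    ← Set.ncard_coe_finset]
  refine Set.ncard_le_ncard ?_ S.finite_toSet
  rintro _ ⟨e, he, rfl⟩
  induction e using Sym2.ind with
  | _ u v =>
    rw [mem_edgeSet, SimpleGraph.fromRel_adj] at he
    rw [Sym2.map_mk]
    rcases he.2 with h' | h'
    · exact h u v h'
    · rw [Sym2.eq_swap]
      exact h v u h'

theorem ncard_edgeSet_twoCycles_le (p q : ℕ) : (twoCycles p q).edgeSet.ncard ≤ p + q := by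
  refine (ncard_edgeSet_fromRel_le (pathEdges 0 0 1 p ∪ pathEdges 0 0 p q) ?_).trans
    ((card_union_le _ _).trans (add_le_add (card_pathEdges_le ..) (card_pathEdges_le ..)))
  rintro u v (h | h)
  · exact mem_union_left _ (mem_pathEdges h)
  · exact mem_union_right _ (mem_pathEdges h)

theorem ncard_edgeSet_thetaGraph_le (p r q : ℕ) :
    (thetaGraph p r q).edgeSet.ncard ≤ p + r + q := by
  refine (ncard_edgeSet_fromRel_le
    (pathEdges 0 1 2 p ∪ pathEdges 0 1 (p + 1) r ∪ pathEdges 0 1 (p + r) q) ?_).trans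
    ((card_union_le _ _).trans (add_le_add ((card_union_le _ _).trans
      (add_le_add (card_pathEdges_le ..) (card_pathEdges_le ..))) (card_pathEdges_le ..)))
  rintro u v (h | h | h)
  · exact mem_union_left _ (mem_union_left _ (mem_pathEdges h))
  · exact mem_union_left _ (mem_union_right _ (mem_pathEdges h))
  · exact mem_union_right _ (mem_pathEdges h)

/-- The pairs `u < v` of adjacent vertices of `C(3, q)`. -/
theorem twoCycles_adj_of {q : ℕ} {u v : Fin (3 + q - 1)} (hq : 3 ≤ q) (huv : u.val < v.val)
    (h : (u.val = 0 ∧ (v.val ≤ 3 ∨ v.val = q + 1)) ∨ (u.val = 1 ∧ v.val = 2) ∨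
      (3 ≤ u.val ∧ v.val = u.val + 1)) : (twoCycles 3 q).Adj u v := by
  have hu := u.isLt
  have hv := v.isLt
  rw [twoCycles, SimpleGraph.fromRel_adj]
  refine ⟨fun hh => huv.ne (congrArg Fin.val hh), ?_⟩
  have key : ∀ a b o ℓ k u' v', k < ℓ → u' = pathVertex a b o ℓ k →
    v' = pathVertex a b o ℓ (k + 1) → pathRel a b o ℓ u' v' :=
    fun a b o ℓ k u' v' h1 h2 h3 => ⟨k, h1, h2, h3⟩
  rcases h with ⟨h0, h1 | h1⟩ | ⟨h0, h1⟩ | ⟨h0, h1⟩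
  · obtain h2 | h2 | h2 : v.val = 1 ∨ v.val = 2 ∨ v.val = 3 := by omega
    · exact Or.inl (Or.inl (key 0 0 1 3 0 _ _ (by omega) (by simp [pathVertex, h0])
        (by simp [pathVertex, h2])))
    · exact Or.inr (Or.inl (key 0 0 1 3 2 _ _ (by omega) (by simp [pathVertex, h2])
        (by simp [pathVertex, h0])))
    · refine Or.inl (Or.inr (key 0 0 3 q 0 _ _ (by omega) (by simp [pathVertex, h0]) ?_))
      unfold pathVertex
      split_ifs <;> first | omega | contradiction
  · refine Or.inr (Or.inr (key 0 0 3 q (q - 1) _ _ (by omega) ?_ ?_))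
    · unfold pathVertex
      split_ifs <;> omega
    · unfold pathVertex
      split_ifs <;> omega
  · exact Or.inl (Or.inl (key 0 0 1 3 1 _ _ (by omega) (by simp [pathVertex, h0])
      (by simp [pathVertex, h1])))
  · refine Or.inl (Or.inr (key 0 0 3 q (u.val - 2) _ _ (by omega) ?_ ?_))
    · unfold pathVertex
      split_ifs <;> omega
    · unfold pathVertex
      split_ifs <;> first | omega | contradiction

/-- The pairs `u < v` of adjacent vertices of `θ(p, 1, 2)`. -/
theorem thetaGraph_adj_of {p : ℕ} {u v : Fin (p + 1 + 2 - 1)} (hp : 2 ≤ p) (huv : u.val < v.val)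
    (h : (u.val = 0 ∧ (v.val = 1 ∨ v.val = 2 ∨ v.val = p + 1)) ∨
      (u.val = 1 ∧ (v.val = p ∨ v.val = p + 1)) ∨
      (2 ≤ u.val ∧ v.val = u.val + 1 ∧ v.val ≤ p)) : (thetaGraph p 1 2).Adj u v := by
  have hu := u.isLt
  have hv := v.isLt
  rw [thetaGraph, SimpleGraph.fromRel_adj]
  refine ⟨fun hh => huv.ne (congrArg Fin.val hh), ?_⟩
  have key : ∀ a b o ℓ k u' v', k < ℓ → u' = pathVertex a b o ℓ k →
    v' = pathVertex a b o ℓ (k + 1) → pathRel a b o ℓ u' v' :=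
    fun a b o ℓ k u' v' h1 h2 h3 => ⟨k, h1, h2, h3⟩
  rcases h with ⟨h0, h1 | h1 | h1⟩ | ⟨h0, h1 | h1⟩ | ⟨h0, h1, h2⟩
  · exact Or.inl (Or.inr (Or.inl (key 0 1 (p + 1) 1 0 _ _ (by omega) (by simp [pathVertex, h0])
      (by simp [pathVertex, h1]))))
  · refine Or.inl (Or.inl (key 0 1 2 p 0 _ _ (by omega) (by simp [pathVertex, h0]) ?_))
    unfold pathVertex
    split_ifs <;> first | omega | contradiction
  · refine Or.inl (Or.inr (Or.inr (key 0 1 (p + 1) 2 0 _ _ (by omega) (by simp [pathVertex, h0])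
      ?_)))
    unfold pathVertex
    split_ifs <;> first | omega | contradiction
  · refine Or.inr (Or.inl (key 0 1 2 p (p - 1) _ _ (by omega) ?_ ?_))
    · unfold pathVertex
      split_ifs <;> omega
    · unfold pathVertex
      split_ifs <;> first | omega | contradiction
  · refine Or.inr (Or.inr (Or.inr (key 0 1 (p + 1) 2 1 _ _ (by omega) ?_ ?_)))
    · unfold pathVertex
      split_ifs <;> first | omega | contradiction
    · unfold pathVertex
      split_ifs <;> first | omega | contradiction
  · refine Or.inl (Or.inl (key 0 1 2 p (u.val - 1) _ _ (by omega) ?_ ?_))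
    · unfold pathVertex
      split_ifs <;> omega
    · unfold pathVertex
      split_ifs <;> first | omega | contradiction

namespace Shape

variable {N : ℕ} {p d : ℕ → ℕ} {a₁ b₁ a₂ b₂ : ℕ}

/-- From `u₀` on, each vertex has one child, less one for each extra edge ending there. The degree
formula telescopes. -/
theorem childrenBefore_add (h : Shape N p d a₁ b₁ a₂ b₂) {u₀ : ℕ} (hu₀ : 0 < u₀)
    (hd : ∀ i, u₀ ≤ i → i < N → d i = 2) {u : ℕ} (hu : u₀ ≤ u) (huN : u ≤ N) :
    childrenBefore N p u + (if a₁ < u then 1 else 0) + (if b₁ < u then 1 else 0) +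
      (if a₂ < u then 1 else 0) + (if b₂ < u then 1 else 0) + u₀ =
    childrenBefore N p u₀ + (if a₁ < u₀ then 1 else 0) + (if b₁ < u₀ then 1 else 0) +
      (if a₂ < u₀ then 1 else 0) + (if b₂ < u₀ then 1 else 0) + u := by
  induction u, hu using Nat.le_induction with
  | base => rfl
  | succ u hu ih =>
    have h1 := ih (by omega)
    have h2 := h.deg u (by omega)
    rw [hd u hu (by omega), if_pos (show 0 < u by omega)] at h2
    rw [childrenBefore_succ]
    have e : ∀ a, (if a < u + 1 then 1 else 0) = (if a < u then 1 else 0) + (if u = a then 1 else 0) := by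
      intro a
      split_ifs <;> omega
    rw [e, e, e, e]
    omega

end Shape

end ConeGraph

/-! ### Types 1 and 2: unrolling the long cycle by a zigzag numbering. -/

namespace ConeGraph

open SimpleGraph Finset

/-- The position of the vertex `z` on the path with `M` vertices `0, 2, 4, …, 5, 3, 1`. -/
def zigzag (M z : ℕ) : ℕ := if z % 2 = 0 then z / 2 else M - 1 - z / 2

theorem zigzag_zero (M : ℕ) : zigzag M 0 = 0 := rfl

theorem zigzag_one (M : ℕ) : zigzag M 1 = M - 1 := rfl

theorem zigzag_lt {M z : ℕ} (h : z < M) : zigzag M z < M := by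
  unfold zigzag
  split_ifs <;> omega

theorem zigzag_inj {M z z' : ℕ} (h : z < M) (h' : z' < M) (he : zigzag M z = zigzag M z') :
    z = z' := by
  unfold zigzag at he
  split_ifs at he <;> omega

/-- Breadth-first search feeds two branches alternately, so each vertex on them has its parent two
numbers earlier. The branches meet at the last two numbers. -/
theorem zigzag_add_two {M z : ℕ} (h : z + 2 < M) :
    zigzag M (z + 2) = zigzag M z + 1 ∨ zigzag M z = zigzag M (z + 2) + 1 := by
  unfold zigzag
  split_ifs <;> omega

theorem zigzag_last {M : ℕ} (h : 2 ≤ M) :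
    zigzag M (M - 1) = zigzag M (M - 2) + 1 ∨ zigzag M (M - 2) = zigzag M (M - 1) + 1 := by
  unfold zigzag
  split_ifs <;> omega

/-- Numbers of the vertices of `θ(N - 2, 1, 2)` for the vertices of a breadth-first graph. -/
def thetaLabel (N v : ℕ) : ℕ :=
  if v < 2 then v else if v = 2 then N - 1 else zigzag (N - 3) (v - 3) + 2

/-- Numbers of the vertices of `C(3, N - 2)` for the vertices of a breadth-first graph in which
`0, 1, j` is a triangle and `u < w` are the other neighbors of `0`. -/
def twoCyclesLabel (N j u w v : ℕ) : ℕ :=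
  if v < 2 then v else if v = j then 2 else
    zigzag (N - 3) (if v = u then 0 else if v = w then 1 else v - 3) + 3

namespace Shape

variable {N : ℕ} {p d : ℕ → ℕ} {a b : ℕ} {H : SimpleGraph (Fin N)}

/-- With the triangle `0, 1, 2` fixed, all other degrees are two, so the rest is one path from `0`
to `1`. The child counts force `b = N - 1`, then `a = N - 2` (or `a = 1` when `N = 4`), and `p v = v
- 2` from `v = 5` on. -/
theorem iso_thetaGraph (h : Shape N p d 1 2 a b) (hs : HasShape H p 1 2 a b) (hH : IsCyclic 2 H)
    (hd0 : d 0 = 3) (hd1 : d 1 = 3) (hd : ∀ i, 2 ≤ i → i < N → d i = 2) (hN : 4 ≤ N) :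
    Nonempty (H ≃g thetaGraph (N - 2) 1 2) := by
  have hp := h.p_lt₂; have hab := h.lt₂; have hbN := h.lt_N₂
  have hC1 := h.childrenBefore_one
  have hC2 := h.childrenBefore_two
  have hcc1 : childCount N p 1 + (if a = 1 then 1 else 0) = 1 := by
    have := h.deg 1 (by omega)
    rw [hd1] at this
    simp only [zero_lt_one, if_true, OfNat.one_ne_ofNat, if_false] at this
    split_ifs at this ⊢ <;> omega
  have h2 : a ≠ 2 ∧ b ≠ 2 := by
    have := h.deg 2 (by omega)
    rw [hd 2 le_rfl (by omega)] at this
    simp only [Nat.ofNat_pos, if_true, OfNat.ofNat_ne_one, if_false] at this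
    split_ifs at this <;> omega
  have hC : ∀ u, 3 ≤ u → u ≤ N → childrenBefore N p u + (if a < u then 1 else 0) +
      (if b < u then 1 else 0) = u + 1 := by
    intro u hu huN
    have := h.childrenBefore_add (by omega) hd (u := u) (by omega) huN
    simp only [if_pos (show 1 < u by omega), if_pos (show 2 < u by omega)] at this
    simp only [Nat.one_lt_ofNat, if_true, lt_irrefl, if_false, if_neg (show ¬ b < 2 by omega)]
      at this
    have e : (if a < 2 then 1 else 0) = (if a = 1 then 1 else 0) := by
      split_ifs <;> omega
    omega
  -- Once both ends of the extra edge are passed, `childrenBefore` at `b + 1` is only `b`, so no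
  -- vertex `b + 1` can have an earlier parent.
  have hb : b = N - 1 := by
    by_contra hne
    have e1 := hC (b + 1) (by omega) (by omega)
    have e2 := (h.p_lt_iff (u := b + 1) (j := b + 1) (by omega) (by omega)).mp
      (h.p_lt _ (by omega) (by omega))
    rw [if_pos (by omega), if_pos (by omega)] at e1
    omega
  have ha : (a = 1 ∧ N = 4) ∨ (3 ≤ a ∧ a = N - 2) := by
    have e2 := (h.p_lt_iff (u := a) (j := b) (by omega) (by omega)).mp hp
    by_cases ha1 : a = 1
    · rw [ha1, hC1] at e2
      omega
    · have e1 := hC a (by omega) (by omega)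
      simp only [lt_irrefl, if_false, if_neg (show ¬ b < a by omega)] at e1
      omega
  have hpz : ∀ v, 0 < v → v < N → (p v = 0 ↔ v ≤ 3) := fun v hv hvN => by
    rw [h.p_eq_zero_iff hv hvN, hd0]
  have hp4 : ∀ v, 4 ≤ v → v < N → (v = 4 ∧ p v = 1) ∨ (5 ≤ v ∧ p v + 2 = v) := by
    intro v hv hvN
    have hlt := h.p_lt v (by omega) hvN
    have hpos := hpz v (by omega) hvN
    have e := (h.p_eq_iff (u := p v) (j := v) (by omega) hvN).mp rfl
    rw [if_neg (show a ≠ 1 by omega)] at hcc1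
    obtain h1 | h1 | h1 : p v = 1 ∨ p v = 2 ∨ 3 ≤ p v := by omega
    · rw [h1, one_add_one_eq_two] at e
      omega
    · rw [h1, show 2 + 1 = 3 from rfl] at e
      have e3 := hC 3 le_rfl (by omega)
      rw [if_neg (by omega), if_neg (by omega)] at e3
      omega
    · have e3 := hC _ h1 (by omega)
      have e4 := hC (p v + 1) (by omega) (by omega)
      rw [if_neg (show ¬ b < p v by omega)] at e3
      rw [if_neg (show ¬ b < p v + 1 by omega)] at e4
      split_ifs at e3 e4 <;> omega
  have hlt : ∀ v, v < N → thetaLabel N v < N - 2 + 1 + 2 - 1 := by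
    intro v hv
    unfold thetaLabel
    split_ifs
    · omega
    · omega
    · have := zigzag_lt (M := N - 3) (z := v - 3) (by omega)
      omega
  have hstep : ∀ i j : Fin (N - 2 + 1 + 2 - 1), 2 ≤ i.val → 2 ≤ j.val → i.val ≤ N - 2 →
      j.val ≤ N - 2 → (j.val = i.val + 1 ∨ i.val = j.val + 1) →
      (thetaGraph (N - 2) 1 2).Adj i j := by
    rintro i j hi hj hi' hj' (e | e)
    · exact thetaGraph_adj_of (by omega) (by omega) (by omega)
    · exact (thetaGraph_adj_of (by omega) (by omega) (by omega)).symm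
  refine hs.nonempty_iso hH (fun v => ⟨thetaLabel N v, hlt v v.isLt⟩) ?_ ?_ ?_ ?_ ?_ ?_
  · intro v v' hvv
    have e : thetaLabel N v = thetaLabel N v' := congrArg Fin.val hvv
    have hv := v.isLt
    have hv' := v'.isLt
    have z1 := fun hh : 3 ≤ v.val => zigzag_lt (M := N - 3) (z := v - 3) (by omega)
    have z2 := fun hh : 3 ≤ v'.val => zigzag_lt (M := N - 3) (z := v' - 3) (by omega)
    apply Fin.ext
    unfold thetaLabel at e
    split_ifs at e with c1 c2 c3 c4 c5 c6 c7 c8 <;> try omega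
    have := zigzag_inj (M := N - 3) (z := v - 3) (z' := v' - 3) (by omega) (by omega) (by omega)
    omega
  · rw [Fintype.card_fin]
    omega
  · intro i j hij hpj
    have hjN := j.isLt
    have hij' : i.val < j.val := hij
    by_cases hj : j.val ≤ 3
    · have hi0 := hpj.trans ((hpz j (by omega) hjN).mpr hj)
      obtain e | e | e : j.val = 1 ∨ j.val = 2 ∨ j.val = 3 := by omega
      all_goals
        refine thetaGraph_adj_of (by omega) ?_ (Or.inl ⟨?_, ?_⟩) <;>
        simp [thetaLabel, hi0, e, zigzag_zero] <;> omega
    · rcases hp4 j (by omega) hjN with ⟨e, e'⟩ | ⟨e, e'⟩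
      · have hi1 := hpj.trans e'
        refine thetaGraph_adj_of (by omega) ?_ (Or.inr (Or.inl ⟨?_, ?_⟩)) <;>
        simp [thetaLabel, hi1, e, zigzag_one] <;> omega
      · have z0 := zigzag_lt (M := N - 3) (z := j - 3) (by omega)
        have z1 := zigzag_lt (M := N - 3) (z := i - 3) (by omega)
        have z2 := zigzag_add_two (M := N - 3) (z := i - 3) (by omega)
        rw [show i.val - 3 + 2 = j - 3 by omega] at z2
        have l1 : thetaLabel N i = zigzag (N - 3) (i - 3) + 2 := by
          rw [thetaLabel, if_neg (by omega), if_neg (by omega)]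
        have l2 : thetaLabel N j = zigzag (N - 3) (j - 3) + 2 := by
          rw [thetaLabel, if_neg (by omega), if_neg (by omega)]
        refine hstep _ _ ?_ ?_ ?_ ?_ ?_ <;> simp only [l1, l2] <;> omega
  · intro i j hi hj
    refine thetaGraph_adj_of (by omega) ?_ (Or.inr (Or.inl ⟨?_, ?_⟩)) <;>
      simp [thetaLabel, hi, hj] <;> omega
  · intro i j hi hj
    rcases ha with ⟨ha, hN4⟩ | ⟨ha, hN4⟩
    · have hb3 : b = 3 := by omega
      refine thetaGraph_adj_of (by omega) ?_ (Or.inr (Or.inl ⟨?_, ?_⟩)) <;>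
        simp [thetaLabel, hi, hj, ha, hb3, zigzag_zero] <;> omega
    · have z0 := zigzag_lt (M := N - 3) (z := j - 3) (by omega)
      have z1 := zigzag_lt (M := N - 3) (z := i - 3) (by omega)
      have z2 := zigzag_last (M := N - 3) (by omega)
      rw [show N - 3 - 1 = j.val - 3 by omega, show N - 3 - 2 = i.val - 3 by omega] at z2
      have l1 : thetaLabel N i = zigzag (N - 3) (i - 3) + 2 := by
        rw [thetaLabel, if_neg (by omega), if_neg (by omega)]
      have l2 : thetaLabel N j = zigzag (N - 3) (j - 3) + 2 := by
        rw [thetaLabel, if_neg (by omega), if_neg (by omega)]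
      refine hstep _ _ ?_ ?_ ?_ ?_ ?_ <;> simp only [l1, l2] <;> omega
  · exact (ncard_edgeSet_thetaGraph_le _ _ _).trans (by omega)

/-- The two children `u < w` of the root outside the triangle start two branches that close up at
`a` and `b`. The position of `j` among `2, 3, 4` is left open, since only a triangle through `0` and
`1` is known. -/
theorem iso_twoCycles {j : ℕ} (h : Shape N p d 1 j a b) (hs : HasShape H p 1 j a b)
    (hH : IsCyclic 2 H) (hpj : p j = 0) (hd0 : d 0 = 4) (hd : ∀ i, 1 ≤ i → i < N → d i = 2)
    (hN : 5 ≤ N) : Nonempty (H ≃g twoCycles 3 (N - 2)) := by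
  have hp := h.p_lt₂; have hab := h.lt₂; have hbN := h.lt_N₂
  have hj1 := h.lt₁; have hjN := h.lt_N₁
  have hC1 := h.childrenBefore_one
  obtain ⟨-, ha1, hbj, hb1, haj⟩ := h.extra_disjoint (hd 1 le_rfl (by omega))
  have hpz : ∀ v, 0 < v → v < N → (p v = 0 ↔ v ≤ 4) := fun v hv hvN => by
    rw [h.p_eq_zero_iff hv hvN, hd0]
  have hj4 : j ≤ 4 := (hpz j (by omega) hjN).mp hpj
  obtain ⟨u, w, hu, huw, hw, hju, hjw⟩ : ∃ u w, 2 ≤ u ∧ u < w ∧ w ≤ 4 ∧ u ≠ j ∧ w ≠ j := by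
    obtain rfl | rfl | rfl : j = 2 ∨ j = 3 ∨ j = 4 := by omega
    · exact ⟨3, 4, by omega⟩
    · exact ⟨2, 4, by omega⟩
    · exact ⟨2, 3, by omega⟩
  have hC : ∀ v, 2 ≤ v → v ≤ N → childrenBefore N p v + (if j < v then 1 else 0) +
      (if a < v then 1 else 0) + (if b < v then 1 else 0) = v + 2 := by
    intro v hv hvN
    have := h.childrenBefore_add (by omega) hd (u := v) (by omega) hvN
    rw [if_pos (show 1 < v by omega)] at this
    simp only [lt_irrefl, if_false, if_neg (show ¬ j < 1 by omega),
      if_neg (show ¬ a < 1 by omega), if_neg (show ¬ b < 1 by omega)] at this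
    omega
  have e5 := hC 5 (by omega) hN
  have e5' : 6 ≤ N → 5 ≤ childrenBefore N p 5 := fun hN6 =>
    (h.p_lt_iff (by omega) (by omega)).mp (h.p_lt 5 (by omega) (by omega))
  have hb : b = N - 1 ∨ (N = 5 ∧ b = 3 ∧ j = 4) := by
    by_contra hne
    have e1 := hC (b + 1) (by omega) (by omega)
    have e2 := (h.p_lt_iff (u := b + 1) (j := b + 1) (by omega) (by omega)).mp
      (h.p_lt _ (by omega) (by omega))
    rw [if_pos (show a < b + 1 by omega), if_pos (show b < b + 1 by omega)] at e1
    split_ifs at e1 e5 <;> omega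
  have hcase : (N = 5 ∧ a = u ∧ b = w) ∨ (N = 6 ∧ a = w ∧ b = 5) ∨
      (7 ≤ N ∧ a = N - 2 ∧ b = N - 1) := by
    have e2 := (h.p_lt_iff (u := a) (j := b) (by omega) (by omega)).mp hp
    have e1 := hC a (by omega) (by omega)
    simp only [lt_irrefl, if_false, if_neg (show ¬ b < a by omega)] at e1
    split_ifs at e1 <;> omega
  have hp5 : ∀ v, 5 ≤ v → v < N → (v = 5 ∧ p v = u) ∨ (v = 6 ∧ p v = w) ∨
      (7 ≤ v ∧ p v + 2 = v) := by
    intro v hv hvN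
    have hlt := h.p_lt v (by omega) hvN
    have hpos := hpz v (by omega) hvN
    have e := (h.p_eq_iff (u := p v) (j := v) (by omega) hvN).mp rfl
    obtain h1 | h1 : p v = 1 ∨ 2 ≤ p v := by omega
    · rw [h1, hC1, one_add_one_eq_two] at e
      have e3 := hC 2 le_rfl (by omega)
      split_ifs at e3 <;> omega
    · have e3 := hC _ h1 (by omega)
      have e4 := hC (p v + 1) (by omega) (by omega)
      rw [if_neg (show ¬ b < p v by omega)] at e3
      rw [if_neg (show ¬ b < p v + 1 by omega)] at e4
      split_ifs at e3 e4 <;> omega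
  have hind : ∀ v, 2 ≤ v → v < N → v ≠ j → ∃ z, z < N - 3 ∧ ((v = u ∧ z = 0) ∨ (v = w ∧ z = 1) ∨
      (5 ≤ v ∧ z = v - 3)) ∧ twoCyclesLabel N j u w v = zigzag (N - 3) z + 3 := by
    intro v hv hvN hvj
    refine ⟨if v = u then 0 else if v = w then 1 else v - 3, ?_, ?_, ?_⟩
    · split_ifs <;> omega
    · split_ifs <;> omega
    · rw [twoCyclesLabel, if_neg (by omega), if_neg hvj]
  have hlab : ∀ v, v < 2 → twoCyclesLabel N j u w v = v := fun v hv => by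
    rw [twoCyclesLabel, if_pos hv]
  have hlabj : twoCyclesLabel N j u w j = 2 := by
    rw [twoCyclesLabel, if_neg (by omega), if_pos rfl]
  have hlt : ∀ v, v < N → twoCyclesLabel N j u w v < 3 + (N - 2) - 1 := by
    intro v hv
    by_cases hv2 : v < 2
    · rw [hlab v hv2]
      omega
    by_cases hvj : v = j
    · rw [hvj, hlabj]
      omega
    obtain ⟨z, hz, -, e⟩ := hind v (by omega) hv hvj
    have := zigzag_lt hz
    omega
  have hstep : ∀ i k : Fin (3 + (N - 2) - 1), 3 ≤ i.val → 3 ≤ k.val →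
      (k.val = i.val + 1 ∨ i.val = k.val + 1) → (twoCycles 3 (N - 2)).Adj i k := by
    rintro i k hi hk (e | e)
    · exact twoCycles_adj_of (by omega) (by omega) (by omega)
    · exact (twoCycles_adj_of (by omega) (by omega) (by omega)).symm
  refine hs.nonempty_iso hH (fun v => ⟨twoCyclesLabel N j u w v, hlt v v.isLt⟩) ?_ ?_ ?_ ?_ ?_ ?_
  · intro v v' hvv
    have e : twoCyclesLabel N j u w v = twoCyclesLabel N j u w v' := congrArg Fin.val hvv
    apply Fin.ext
    have key : ∀ v : Fin N, (v.val < 2 ∧ twoCyclesLabel N j u w v = v) ∨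
        (v.val = j ∧ twoCyclesLabel N j u w v = 2) ∨ ∃ z, z < N - 3 ∧
          ((v.val = u ∧ z = 0) ∨ (v.val = w ∧ z = 1) ∨ (5 ≤ v.val ∧ z = v - 3)) ∧
            twoCyclesLabel N j u w v = zigzag (N - 3) z + 3 := by
      intro v
      by_cases hv2 : v.val < 2
      · exact Or.inl ⟨hv2, hlab v hv2⟩
      by_cases hvj : v.val = j
      · exact Or.inr (Or.inl ⟨hvj, by rw [hvj, hlabj]⟩)
      exact Or.inr (Or.inr (hind v (by omega) v.isLt hvj))
    rcases key v with c | c | ⟨z, hz, c, c'⟩ <;> rcases key v' with k | k | ⟨z', hz', k, k'⟩ <;>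
      try omega
    have := zigzag_inj hz hz' (by omega)
    omega
  · rw [Fintype.card_fin]
    omega
  · intro i k hik hpk
    have hkN := k.isLt
    have hik' : i.val < k.val := hik
    by_cases hk : k.val ≤ 4
    · have hi0 := (hpz k (by omega) hkN).mpr hk
      have li := hlab i (by omega)
      by_cases hk1 : k.val = 1
      · have lk := hlab k (by omega)
        refine twoCycles_adj_of (by omega) ?_ (Or.inl ⟨?_, ?_⟩) <;> simp only [li, lk] <;> omega
      by_cases hkj : k.val = j
      · have lk : twoCyclesLabel N j u w k = 2 := by rw [hkj, hlabj]
        refine twoCycles_adj_of (by omega) ?_ (Or.inl ⟨?_, ?_⟩) <;> simp only [li, lk] <;> omega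
      obtain ⟨z, hz, hz', lk⟩ := hind k (by omega) hkN hkj
      have z0 := zigzag_zero (N - 3)
      have z1 := zigzag_one (N - 3)
      obtain rfl | rfl : z = 0 ∨ z = 1 := by omega
      all_goals
        refine twoCycles_adj_of (by omega) ?_ (Or.inl ⟨?_, ?_⟩) <;> simp only [li, lk] <;> omega
    · have hp5k := hp5 k (by omega) hkN
      obtain ⟨z, hz, hzk, lk⟩ := hind k (by omega) hkN (by omega)
      obtain ⟨z', hz', hzi, li⟩ := hind i (by omega) i.isLt (by omega)
      obtain rfl : z = z' + 2 := by omega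
      have := zigzag_add_two hz
      refine hstep _ _ ?_ ?_ ?_ <;> simp only [li, lk] <;> omega
  · intro i k hi hk
    have li := hlab i (by omega)
    have lk : twoCyclesLabel N j u w k = 2 := by rw [hk, hlabj]
    refine twoCycles_adj_of (by omega) ?_ (Or.inr (Or.inl ⟨?_, ?_⟩)) <;> simp only [li, lk] <;>
      omega
  · intro i k hi hk
    obtain ⟨z, hz, hzk, lk⟩ := hind k (by omega) k.isLt (by omega)
    obtain ⟨z', hz', hzi, li⟩ := hind i (by omega) i.isLt (by omega)
    obtain rfl : z = N - 3 - 1 := by omega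
    obtain rfl : z' = N - 3 - 2 := by omega
    have := zigzag_last (M := N - 3) (by omega)
    refine hstep _ _ ?_ ?_ ?_ <;> simp only [li, lk] <;> omega
  · exact (ncard_edgeSet_twoCycles_le _ _).trans (by omega)

end Shape

end ConeGraph

/-! ### Type 3: balanced pendant paths. -/

namespace ConeGraph

open SimpleGraph Finset

/-- The parent of a vertex of a pendant path. -/
def pathParent {V : Type*} (v : V) {s : ℕ} {ℓ : Fin s → ℕ} (y : Σ j : Fin s, Fin (ℓ j)) :
    V ⊕ (Σ j : Fin s, Fin (ℓ j)) :=
  if y.2.val = 0 then Sum.inl v else Sum.inr ⟨y.1, ⟨y.2.val - 1, by omega⟩⟩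

theorem ncard_edgeSet_attachPaths_le {V : Type*} [Fintype V] (G : SimpleGraph V) (v : V) {s : ℕ}
    (ℓ : Fin s → ℕ) : (attachPaths G v ℓ).edgeSet.ncard ≤ G.edgeSet.ncard + ∑ j, ℓ j := by
  have hsub : (attachPaths G v ℓ).edgeSet ⊆ Sym2.map Sum.inl '' G.edgeSet ∪
      Set.range fun y : Σ j : Fin s, Fin (ℓ j) => s(pathParent v y, Sum.inr y) := by
    have key : ∀ a b, attachRel G v ℓ a b → s(a, b) ∈ Sym2.map Sum.inl '' G.edgeSet ∪
        Set.range fun y : Σ j : Fin s, Fin (ℓ j) => s(pathParent v y, Sum.inr y) := by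
      rintro (a | ⟨j, k⟩) (b | ⟨j', k'⟩) h
      · exact Or.inl ⟨s(a, b), h, rfl⟩
      · obtain ⟨rfl, h⟩ := h
        exact Or.inr ⟨⟨j', k'⟩, by simp only [pathParent, if_pos h]⟩
      · exact h.elim
      · obtain ⟨h, h'⟩ := h
        simp only at h h'
        subst h
        refine Or.inr ⟨⟨j, k'⟩, ?_⟩
        simp only [pathParent, h', Nat.add_eq_zero_iff, one_ne_zero, and_false, if_false,
          Nat.add_sub_cancel]
    intro e he
    induction e using Sym2.ind with
    | _ a b =>
      rw [mem_edgeSet, attachPaths, SimpleGraph.fromRel_adj] at he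
      rcases he.2 with h | h
      · exact key a b h
      · rw [Sym2.eq_swap]
        exact key b a h
  refine (Set.ncard_le_ncard hsub (Set.toFinite _)).trans ((Set.ncard_union_le _ _).trans ?_)
  refine add_le_add (Set.ncard_image_le (Set.toFinite _)) ?_
  rw [← Set.image_univ]
  refine (Set.ncard_image_le (Set.toFinite _)).trans ?_
  rw [Set.ncard_univ, Nat.card_eq_fintype_card, Fintype.card_sigma]
  simp

/-- Breadth-first order fills the paths in rotation: the vertex with number `x` goes to path `x % s`
at height `x / s`. -/
theorem lt_balancedLength {s M x : ℕ} (hx : x < M) (j : Fin s) (hj : j.val = x % s) :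
    x / s < balancedLength s M j := by
  have hs : 0 < s := j.pos
  unfold balancedLength
  have h1 := Nat.div_add_mod x s
  have h2 := Nat.div_add_mod M s
  have h3 := Nat.mod_lt x hs
  have h4 := Nat.mod_lt M hs
  rcases Nat.lt_trichotomy (x / s) (M / s) with h | h | h
  · omega
  · rw [h] at h1
    rw [if_pos (by omega)]
    omega
  · have := Nat.mul_le_mul_left s h
    rw [Nat.mul_succ] at this
    omega

/-- The vertex of `C(3, 3)` with `s` balanced pendant paths that corresponds to the vertex `v` of a
breadth-first graph with triangles `0, a₁, b₁` and `0, a₂, b₂`. -/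
def bouquetVertex (N s a₁ b₁ a₂ : ℕ) (hs : 0 < s) (v : Fin N) :
    Fin (3 + 3 - 1) ⊕ (Σ j : Fin s, Fin (balancedLength s (N - 5) j)) :=
  if h : v.val < 5 then Sum.inl (if v.val = 0 then 0 else if v.val = a₁ then 1 else
    if v.val = b₁ then 2 else if v.val = a₂ then 3 else 4)
  else Sum.inr ⟨⟨(v.val - 5) % s, Nat.mod_lt _ hs⟩,
    ⟨(v.val - 5) / s, lt_balancedLength (by omega) _ rfl⟩⟩

namespace Shape

variable {N : ℕ} {p d : ℕ → ℕ} {a₁ b₁ a₂ b₂ : ℕ} {H : SimpleGraph (Fin N)}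

/-- The vertices `1, …, 4` have no children. From `5` on the degrees are at most two and
non-increasing, so every vertex up to `p v` has exactly one child, and parents lag by the number `d
0 - 4` of paths. -/
theorem p_add_eq (h : Shape N p d a₁ b₁ a₂ b₂) (hd0 : 5 ≤ d 0) (hd1 : d 1 = 2)
    (he : ∀ i, 0 < i → i ≤ 4 → i = a₁ ∨ i = b₁ ∨ i = a₂ ∨ i = b₂) {v : ℕ} (hv : d 0 < v)
    (hvN : v < N) : p v + (d 0 - 4) = v := by
  have h1 := he 1 (by omega) (by omega)
  have h2 := he 2 (by omega) (by omega)
  have h3 := he 3 (by omega) (by omega)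
  have h4 := he 4 (by omega) (by omega)
  obtain ⟨hc, -⟩ := h.extra_disjoint hd1
  have c1 := hc 1 h1
  have c2 := hc 2 h2
  have c3 := hc 3 h3
  have c4 := hc 4 h4
  have hC5 : childrenBefore N p 5 = d 0 := by
    rw [childrenBefore_succ N p 4, h.childrenBefore_four]
    omega
  have hlt := h.p_lt v (by omega) hvN
  have e := (h.p_eq_iff (u := p v) (j := v) (by omega) hvN).mp rfl
  have h5 : 5 ≤ p v := by
    by_contra hcon
    have := childrenBefore_mono N p (show p v + 1 ≤ 5 by omega)
    omega
  have hcc : ∀ i, 5 ≤ i → i ≤ p v → childCount N p i = 1 := by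
    have hle : ∀ i, 5 ≤ i → i < N → childCount N p i + 1 = d i := fun i hi hiN =>
      h.childCount_eq (by omega) hiN (by omega) (by omega) (by omega) (by omega)
    intro i hi hip
    have := hle i hi (by omega)
    have := hle (p v) h5 (by omega)
    have := h.anti i (p v) hip (by omega)
    have := h.anti 1 i (by omega) (by omega)
    have := childrenBefore_succ N p (p v)
    omega
  have hC : ∀ i, 5 ≤ i → i ≤ p v + 1 → childrenBefore N p i + 5 = d 0 + i := by
    intro i hi
    induction i, hi using Nat.le_induction with
    | base => intro _; omega
    | succ i hi ih =>
      intro hip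
      have := ih (by omega)
      have := hcc i hi (by omega)
      rw [childrenBefore_succ]
      omega
  have := hC _ h5 (by omega)
  have := hC (p v + 1) (by omega) le_rfl
  omega

theorem iso_bouquetWithPaths (h : Shape N p d a₁ b₁ a₂ b₂) (hs : HasShape H p a₁ b₁ a₂ b₂)
    (hH : IsCyclic 2 H) (hd0 : 5 ≤ d 0) (hd1 : d 1 = 2)
    (he : ∀ i, 0 < i → i ≤ 4 → i = a₁ ∨ i = b₁ ∨ i = a₂ ∨ i = b₂) :
    Nonempty (H ≃g bouquetWithPaths (d 0 - 4) (N - 5)) := by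
  have h1 := he 1 (by omega) (by omega)
  have h2 := he 2 (by omega) (by omega)
  have h3 := he 3 (by omega) (by omega)
  have h4 := he 4 (by omega) (by omega)
  have hp := fun v => h.p_add_eq hd0 hd1 he (v := v)
  have hpz := fun v => h.p_eq_zero_iff (j := v)
  have hN := h.d_zero_lt
  set s := d 0 - 4 with hsdef
  have hs0 : 0 < s := by omega
  have hlow : ∀ v : Fin N, v.val < 5 → ∃ k : Fin (3 + 3 - 1),
      bouquetVertex N s a₁ b₁ a₂ hs0 v = Sum.inl k ∧ ((v.val = 0 ∧ k.val = 0) ∨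
        (v.val = a₁ ∧ k.val = 1) ∨ (v.val = b₁ ∧ k.val = 2) ∨ (v.val = a₂ ∧ k.val = 3) ∨
        (v.val = b₂ ∧ k.val = 4)) := by
    intro v hv
    refine ⟨_, dif_pos hv, ?_⟩
    have hv' := he v
    split_ifs with c1 c2 c3 c4
    · exact Or.inl ⟨c1, rfl⟩
    · exact Or.inr (Or.inl ⟨c2, rfl⟩)
    · exact Or.inr (Or.inr (Or.inl ⟨c3, rfl⟩))
    · exact Or.inr (Or.inr (Or.inr (Or.inl ⟨c4, rfl⟩)))
    · exact Or.inr (Or.inr (Or.inr (Or.inr ⟨by omega, rfl⟩)))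
  have hhigh : ∀ v : Fin N, ∀ hv : ¬ v.val < 5, bouquetVertex N s a₁ b₁ a₂ hs0 v =
      Sum.inr ⟨⟨(v.val - 5) % s, Nat.mod_lt _ hs0⟩,
        ⟨(v.val - 5) / s, lt_balancedLength (by omega) _ rfl⟩⟩ := fun v hv => dif_neg hv
  have hinl : ∀ k k' : Fin (3 + 3 - 1), k.val < k'.val →
      (k.val = 0 ∨ (k.val = 1 ∧ k'.val = 2) ∨ (k.val = 3 ∧ k'.val = 4)) →
      (bouquetWithPaths s (N - 5)).Adj (Sum.inl k) (Sum.inl k') := by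
    intro k k' hk hkk
    rw [bouquetWithPaths, attachPaths, SimpleGraph.fromRel_adj]
    refine ⟨fun hh => ?_, Or.inl ?_⟩
    · rw [Sum.inl.inj hh] at hk
      exact lt_irrefl _ hk
    · have := k'.isLt
      exact twoCycles_adj_of le_rfl hk (by omega)
  refine hs.nonempty_iso hH (bouquetVertex N s a₁ b₁ a₂ hs0) ?_ ?_ ?_ ?_ ?_ ?_
  · intro v v' hvv
    apply Fin.ext
    by_cases hv : v.val < 5 <;> by_cases hv' : v'.val < 5
    · obtain ⟨k, e, hk⟩ := hlow v hv
      obtain ⟨k', e', hk'⟩ := hlow v' hv'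
      rw [e, e'] at hvv
      rw [Sum.inl.inj hvv] at hk
      omega
    · obtain ⟨k, e, hk⟩ := hlow v hv
      rw [e, hhigh v' hv'] at hvv
      cases hvv
    · obtain ⟨k, e, hk⟩ := hlow v' hv'
      rw [e, hhigh v hv] at hvv
      cases hvv
    · rw [hhigh v hv, hhigh v' hv', Sum.inr.injEq, Sigma.mk.injEq] at hvv
      obtain ⟨e1, e2⟩ := hvv
      have e1' : (v.val - 5) % s = (v'.val - 5) % s := congrArg Fin.val e1
      have e2' : (v.val - 5) / s = (v'.val - 5) / s :=
        (Fin.heq_ext_iff (by rw [e1])).mp e2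
      have f1 := Nat.div_add_mod (v.val - 5) s
      have f2 := Nat.div_add_mod (v'.val - 5) s
      rw [e1', e2', f2] at f1
      omega
  · rw [Fintype.card_sum, Fintype.card_sigma, Fintype.card_fin]
    simp only [Fintype.card_fin]
    rw [sum_balancedLength hs0]
    omega
  · intro i j hij hpj
    have hij' : i.val < j.val := hij
    have hjN := j.isLt
    by_cases hj : j.val < 5
    · have hi0 := hpj.trans ((hpz j (by omega) hjN).mpr (by omega))
      obtain ⟨k, e, hk⟩ := hlow i (by omega)
      obtain ⟨k', e', hk'⟩ := hlow j hj
      rw [e, e']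
      have := h.p_lt₁; have := h.p_lt₂; have := h.lt₁; have := h.lt₂
      exact hinl k k' (by omega) (by omega)
    rw [hhigh j hj]
    by_cases hjd : j.val ≤ d 0
    · have hi0 := hpj.trans ((hpz j (by omega) hjN).mpr hjd)
      obtain ⟨k, e, hk⟩ := hlow i (by omega)
      rw [e, bouquetWithPaths, attachPaths, SimpleGraph.fromRel_adj]
      have := h.p_lt₁; have := h.p_lt₂; have := h.lt₁; have := h.lt₂
      refine ⟨Sum.inl_ne_inr, Or.inl ⟨Fin.ext ?_, ?_⟩⟩
      · simp only [Fin.val_zero]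
        omega
      · exact Nat.div_eq_of_lt (by omega)
    · have e1 := hp j (by omega) hjN
      rw [← hpj] at e1
      have e2 : j.val - 5 = i.val - 5 + s := by omega
      rw [hhigh i (by omega), bouquetWithPaths, attachPaths, SimpleGraph.fromRel_adj]
      have e3 : (j.val - 5) / s = (i.val - 5) / s + 1 := by rw [e2, Nat.add_div_right _ hs0]
      have e4 : (j.val - 5) % s = (i.val - 5) % s := by rw [e2, Nat.add_mod_right]
      refine ⟨fun hh => ?_, Or.inl ⟨Fin.ext e4.symm, e3⟩⟩
      rw [Sum.inr.injEq, Sigma.mk.injEq] at hh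
      have := (Fin.heq_ext_iff (by rw [hh.1])).mp hh.2
      simp only at this
      omega
  · intro i j hi hj
    have := h.p_lt₁; have := h.p_lt₂; have := h.lt₁; have := h.lt₂
    obtain ⟨k, e, hk⟩ := hlow i (by omega)
    obtain ⟨k', e', hk'⟩ := hlow j (by omega)
    rw [e, e']
    exact hinl k k' (by omega) (by omega)
  · intro i j hi hj
    have := h.p_lt₁; have := h.p_lt₂; have := h.lt₁; have := h.lt₂
    obtain ⟨k, e, hk⟩ := hlow i (by omega)
    obtain ⟨k', e', hk'⟩ := hlow j (by omega)
    rw [e, e']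
    exact hinl k k' (by omega) (by omega)
  · refine (ncard_edgeSet_attachPaths_le _ _ _).trans ?_
    rw [sum_balancedLength hs0]
    have := ncard_edgeSet_twoCycles_le 3 3
    omega

end Shape

end ConeGraph

/-! ### Type 4: distances, the explicit construction and the basic graph. -/

namespace ConeGraph

open SimpleGraph Finset

/-- A function that changes by at most one along edges is bounded by the distance. -/
theorem le_add_dist {V : Type*} {H : SimpleGraph V} (hH : H.Connected) {f : V → ℕ}
    (hf : ∀ u v, H.Adj u v → f u ≤ f v + 1) (u v : V) : f u ≤ f v + H.dist u v := by
  obtain ⟨w, hw⟩ := hH.exists_walk_length_eq_dist u v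
  rw [← hw]
  clear hw
  induction w with
  | nil => simp
  | cons h w ih =>
    rw [Walk.length_cons]
    have := hf _ _ h
    omega

/-- The depth of a vertex in the tree with parent function `p`. -/
def treeDepth (p : ℕ → ℕ) (v : ℕ) : ℕ := if h : p v < v then treeDepth p (p v) + 1 else 0
termination_by v

namespace Shape

variable {N : ℕ} {p d : ℕ → ℕ} {a₁ b₁ a₂ b₂ : ℕ} {H : SimpleGraph (Fin N)}

theorem treeDepth_zero (p : ℕ → ℕ) : treeDepth p 0 = 0 := by
  rw [treeDepth, dif_neg (Nat.not_lt_zero _)]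

theorem treeDepth_eq (h : Shape N p d a₁ b₁ a₂ b₂) {v : ℕ} (hv : 0 < v) (hvN : v < N) :
    treeDepth p v = treeDepth p (p v) + 1 := by
  rw [treeDepth, dif_pos (h.p_lt v hv hvN)]

theorem treeDepth_mono (h : Shape N p d a₁ b₁ a₂ b₂) {u v : ℕ} (huv : u ≤ v) (hvN : v < N) :
    treeDepth p u ≤ treeDepth p v := by
  induction v using Nat.strong_induction_on generalizing u with
  | _ v ih =>
    rcases Nat.eq_zero_or_pos u with rfl | hu
    · rw [treeDepth_zero]
      exact Nat.zero_le _
    · rw [h.treeDepth_eq hu (by omega), h.treeDepth_eq (by omega) hvN]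
      have h1 := h.p_lt v (by omega) hvN
      exact Nat.succ_le_succ (ih (p v) h1 (h.p_mono u v hu huv hvN) (by omega))

/-- If `1, 2, 3` are children of the root, then the distance from the root is the depth. -/
theorem dist_eq_treeDepth (h : Shape N p d 1 2 1 3) (hs : HasShape H p 1 2 1 3)
    (hH : H.Connected) (hd0 : 3 ≤ d 0) (r : Fin N) (hr : r.val = 0) (v : Fin N) :
    H.dist v r = treeDepth p v := by
  apply le_antisymm
  · obtain ⟨v, hv⟩ := v
    induction v using Nat.strong_induction_on with
    | _ v ih =>
      rcases Nat.eq_zero_or_pos v with rfl | hv0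
      · rw [show (⟨0, hv⟩ : Fin N) = r from Fin.ext hr.symm, SimpleGraph.dist_self]
        exact Nat.zero_le _
      · have h1 := h.p_lt v hv0 hv
        have h2 := ih (p v) h1 (by omega)
        have h3 : H.Adj ⟨v, hv⟩ ⟨p v, by omega⟩ :=
          (hs _ _).mpr (Or.inr ⟨h1, hv, Or.inl rfl⟩)
        have h4 := hH.dist_triangle (u := ⟨v, hv⟩) (v := ⟨p v, by omega⟩) (w := r)
        rw [SimpleGraph.dist_eq_one_iff_adj.mpr h3] at h4
        simp only at h2 ⊢
        rw [h.treeDepth_eq hv0 hv]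
        omega
  · have h1 := le_add_dist hH (f := fun v : Fin N => treeDepth p v) ?_ v r
    · simp only [hr, treeDepth_zero, zero_add] at h1
      exact h1
    · have hone : ∀ v, 0 < v → v ≤ 3 → treeDepth p v = 1 := fun v hv hv3 => by
        have := h.lt_N₂
        rw [h.treeDepth_eq hv (by omega),
          (h.p_eq_zero_iff hv (by omega)).mpr (by omega), treeDepth_zero]
      have key : ∀ u v : Fin N, u.val < v.val → H.Adj u v → treeDepth p v ≤ treeDepth p u + 1 := by
        intro u v huv hadj
        rw [hs] at hadj
        rcases hadj with ⟨-, -, e | e | e⟩ | ⟨e, -⟩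
        · rw [h.treeDepth_eq (by omega) v.isLt, e]
        · rw [hone v (by omega) (by omega)]
          omega
        · rw [hone v (by omega) (by omega)]
          omega
        · omega
      intro u v huv
      rcases Nat.lt_trichotomy u.val v.val with e | e | e
      · exact (h.treeDepth_mono e.le v.isLt).trans (Nat.le_succ _)
      · exact absurd (Fin.ext e) huv.ne
      · exact key v u e huv.symm

/-- The given numbering is the breadth-first order. The extra edges join vertices of equal depth, so
a neighbor one level deeper is a child, and monotonicity of `p` orders the children. -/
theorem isBFSGraph (h : Shape N p d 1 2 1 3) (hs : HasShape H p 1 2 1 3) (hH : H.Connected)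
    (hd : ∀ i : Fin N, d i = #(nbrs H i)) (hd0 : 3 ≤ d 0) : IsBFSGraph H := by
  classical
  have hN := h.N_pos
  have hdist := h.dist_eq_treeDepth hs hH hd0 ⟨0, hN⟩ rfl
  refine ⟨hH, Equiv.refl _, ⟨0, hN⟩, fun v => Fin.le_def.mpr (Nat.zero_le _), ?_, ?_⟩
  · intro u v huv
    have huv' : u ≤ v := huv
    rw [hdist, hdist]
    refine ⟨?_, h.treeDepth_mono huv' v.isLt⟩
    have h1 := h.anti u v huv' v.isLt
    rw [hd, hd, card_nbrs, card_nbrs] at h1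
    convert h1
  · intro u x v y huv _ hxy _ hux hv hy hlt
    have hlt' : u < x := hlt
    change v < y
    simp only [hdist] at hux hv hy
    have hpar : ∀ u v : Fin N, H.Adj u v → treeDepth p v = treeDepth p u + 1 →
        0 < v.val ∧ p v = u := by
      intro u v huv hv
      have hlt : u.val < v.val := by
        by_contra hcon
        have := h.treeDepth_mono (not_lt.mp hcon) u.isLt
        omega
      refine ⟨by omega, ?_⟩
      have hone : ∀ v, 0 < v → v ≤ 3 → treeDepth p v = 1 := fun v hv hv3 => by
        have := h.lt_N₂
        rw [h.treeDepth_eq hv (by omega),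
          (h.p_eq_zero_iff hv (by omega)).mpr (by omega), treeDepth_zero]
      rw [hs] at huv
      rcases huv with ⟨-, -, e | e | e⟩ | ⟨e, -⟩
      · exact e.symm
      · rw [hone v (by omega) (by omega), hone u (by omega) (by omega)] at hv
        omega
      · rw [hone v (by omega) (by omega), hone u (by omega) (by omega)] at hv
        omega
      · omega
    have h1 := hpar u v huv hv
    have h2 := hpar x y hxy (by omega)
    rw [Fin.lt_def] at hlt' ⊢
    by_contra hcon
    have := h.p_mono y v h2.1 (by omega) v.isLt
    omega

theorem childrenBefore_eq_sum (h : Shape N p d 1 2 1 3) (u : ℕ) (hu : u ≤ N) :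
    childrenBefore N p u = ∑ i ∈ range u, newNeighbors d i := by
  induction u with
  | zero => simp [childrenBefore_zero]
  | succ u ih =>
    rw [childrenBefore_succ, sum_range_succ, ih (by omega)]
    congr 1
    have h1 := h.deg u (by omega)
    match u, h1 with
    | 0, _ => exact h.childCount_zero
    | 1, h1 => simp at h1; simp only [newNeighbors]; omega
    | 2, h1 => simp at h1; simp only [newNeighbors]; omega
    | 3, h1 => simp at h1; simp only [newNeighbors]; omega
    | u + 4, h1 => simp at h1; simp only [newNeighbors]; omega

theorem eq_bfsBicyclic (h : Shape N p d 1 2 1 3) (hs : HasShape H p 1 2 1 3) :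
    H = bfsBicyclic N d := by
  have key : ∀ u v : Fin N, (∑ i ∈ range u.val, newNeighbors d i < v.val ∧
      v.val ≤ ∑ i ∈ range (u.val + 1), newNeighbors d i) ↔ 0 < v.val ∧ p v = u := by
    intro u v
    rw [← h.childrenBefore_eq_sum u (by omega), ← h.childrenBefore_eq_sum (u + 1) (by omega)]
    constructor
    · intro hh
      exact ⟨by omega, (h.p_eq_iff (by omega) v.isLt).mpr hh⟩
    · rintro ⟨h1, h2⟩
      exact (h.p_eq_iff h1 v.isLt).mp h2
  ext u v
  rw [hs, bfsBicyclic, SimpleGraph.fromRel_adj, key, key, ShapeAdj]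
  have h1 := h.p_lt u
  have h2 := h.p_lt v
  have hu := u.isLt
  have hv := v.isLt
  rw [Ne, Fin.ext_iff]
  omega

theorem mem_pruneStep_of_le_three (hs : HasShape H p 1 2 1 3) (h : Shape N p d 1 2 1 3)
    (hd0 : 3 ≤ d 0) {S : Set (Fin N)} (hS : ∀ v : Fin N, v.val ≤ 3 → v ∈ S) (v : Fin N)
    (hv : v.val ≤ 3) : v ∈ pruneStep H S := by
  refine ⟨hS v hv, fun hone => ?_⟩
  have hN := h.lt_N₂
  have hp : ∀ j, 0 < j → j ≤ 3 → p j = 0 := fun j hj hj3 =>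
    (h.p_eq_zero_iff hj (by omega)).mpr (by omega)
  have p1 := hp 1 (by omega) (by omega)
  have p2 := hp 2 (by omega) (by omega)
  have p3 := hp 3 (by omega) (by omega)
  obtain ⟨a, b, hab, ha3, hb3, ha, hb⟩ : ∃ a b : ℕ, a < b ∧ a ≤ 3 ∧ b ≤ 3 ∧
      ShapeAdj N p 1 2 1 3 v a ∧ ShapeAdj N p 1 2 1 3 v b := by
    unfold ShapeAdj
    obtain e | e | e | e : v.val = 0 ∨ v.val = 1 ∨ v.val = 2 ∨ v.val = 3 := by omega
    · exact ⟨1, 2, by omega, by omega, by omega, by omega, by omega⟩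
    · rw [e]
      exact ⟨0, 2, by omega, by omega, by omega, by omega, by omega⟩
    · rw [e]
      exact ⟨0, 1, by omega, by omega, by omega, by omega, by omega⟩
    · rw [e]
      exact ⟨0, 1, by omega, by omega, by omega, by omega, by omega⟩
  obtain ⟨c, hc⟩ := Set.ncard_eq_one.mp hone
  have ha' : (⟨a, by omega⟩ : Fin N) ∈ H.neighborSet v ∩ S := ⟨(hs _ _).mpr ha, hS _ ha3⟩
  have hb' : (⟨b, by omega⟩ : Fin N) ∈ H.neighborSet v ∩ S := ⟨(hs _ _).mpr hb, hS _ hb3⟩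
  rw [hc, Set.mem_singleton_iff] at ha' hb'
  have := congrArg Fin.val (ha'.trans hb'.symm)
  simp only at this
  omega

/-- Closure under parents is carried along to show that a surviving vertex beyond `3` with a
surviving child has two surviving neighbors. Each round removes at least the largest remaining
number above `3`. -/
theorem iterate_pruneStep (hs : HasShape H p 1 2 1 3) (h : Shape N p d 1 2 1 3) (hd0 : 3 ≤ d 0)
    (k : ℕ) : (∀ v : Fin N, v.val ≤ 3 → v ∈ (pruneStep H)^[k] Set.univ) ∧
      (∀ v w : Fin N, v ∈ (pruneStep H)^[k] Set.univ → 4 ≤ v.val → w.val = p v →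
        w ∈ (pruneStep H)^[k] Set.univ) ∧
      ∀ v ∈ (pruneStep H)^[k] Set.univ, v.val ≤ 3 ∨ v.val + k < N := by
  induction k with
  | zero => exact ⟨fun _ _ => Set.mem_univ _, fun _ _ _ _ _ => Set.mem_univ _,
      fun v _ => Or.inr v.isLt⟩
  | succ k ih =>
    obtain ⟨ih1, ih2, ih3⟩ := ih
    simp only [Function.iterate_succ_apply']
    set S := (pruneStep H)^[k] Set.univ
    have hadj : ∀ v w : Fin N, 4 ≤ v.val → w.val = p v → H.Adj v w := fun v w hv hw => by
      have := h.p_lt v (by omega) v.isLt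
      exact (hs _ _).mpr (Or.inr ⟨by omega, v.isLt, Or.inl hw⟩)
    refine ⟨mem_pruneStep_of_le_three hs h hd0 ih1, ?_, ?_⟩
    · intro v w hv hv4 hw
      have hwS := ih2 v w hv.1 hv4 hw
      by_cases hw3 : w.val ≤ 3
      · exact mem_pruneStep_of_le_three hs h hd0 ih1 w hw3
      refine ⟨hwS, fun hone => ?_⟩
      obtain ⟨c, hc⟩ := Set.ncard_eq_one.mp hone
      have hpw := h.p_lt w (by omega) w.isLt
      have hpv := h.p_lt v (by omega) v.isLt
      have h1 : v ∈ H.neighborSet w ∩ S := ⟨(hadj v w hv4 hw).symm, hv.1⟩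
      have h2 : (⟨p w, by omega⟩ : Fin N) ∈ H.neighborSet w ∩ S :=
        ⟨hadj w _ (by omega) rfl, ih2 w _ hwS (by omega) rfl⟩
      rw [hc, Set.mem_singleton_iff] at h1 h2
      have := congrArg Fin.val (h1.trans h2.symm)
      simp only at this
      omega
    · intro v hv
      by_contra hcon
      push Not at hcon
      -- Now `v` is `N - 1 - k`, the largest number that can still be present, so all its children
      -- are gone and its parent is its only remaining neighbor.
      have hvN := (ih3 v hv.1).resolve_left (by omega)
      apply hv.2
      have hpv := h.p_lt v (by omega) v.isLt
      rw [Set.ncard_eq_one]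
      refine ⟨⟨p v, by omega⟩, ?_⟩
      ext w
      rw [Set.mem_singleton_iff]
      constructor
      · rintro ⟨hw, hwS⟩
        have hw' : ShapeAdj N p 1 2 1 3 v w := (hs _ _).mp hw
        have hwN := ih3 w hwS
        unfold ShapeAdj at hw'
        apply Fin.ext
        simp only
        omega
      · rintro rfl
        exact ⟨hadj v _ (by omega) rfl, ih2 v _ hv.1 (by omega) rfl⟩

theorem basicVertices_eq (hs : HasShape H p 1 2 1 3) (h : Shape N p d 1 2 1 3) (hd0 : 3 ≤ d 0) :
    basicVertices H = {v | v.val ≤ 3} := by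
  obtain ⟨h1, -, h3⟩ := iterate_pruneStep hs h hd0 (Nat.card (Fin N))
  ext v
  refine ⟨fun hv => ?_, h1 v⟩
  have := h3 v hv
  rw [Nat.card_eq_fintype_card, Fintype.card_fin] at this
  exact this.resolve_right (by omega)

theorem thetaGraph_two_one_two_adj {u v : Fin (2 + 1 + 2 - 1)} (huv : u.val < v.val) :
    (thetaGraph 2 1 2).Adj u v ↔ u.val ≤ 1 := by
  constructor
  · intro hadj
    rw [thetaGraph, SimpleGraph.fromRel_adj] at hadj
    have key : ∀ u v : ℕ, pathRel 0 1 2 2 u v ∨ pathRel 0 1 (2 + 1) 1 u v ∨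
        pathRel 0 1 (2 + 1) 2 u v → u ≤ 1 ∨ v ≤ 1 := by
      rintro u v (⟨k, hk, rfl, rfl⟩ | ⟨k, hk, rfl, rfl⟩ | ⟨k, hk, rfl, rfl⟩) <;>
        interval_cases k <;> simp [pathVertex]
    rcases hadj.2 with e | e
    · have := key _ _ e
      omega
    · have := key _ _ e
      omega
  · intro hu
    have := v.isLt
    exact thetaGraph_adj_of le_rfl huv (by omega)

theorem basicGraph_iso (hs : HasShape H p 1 2 1 3) (h : Shape N p d 1 2 1 3) (hd0 : 3 ≤ d 0) :
    Nonempty (basicGraph H ≃g thetaGraph 2 1 2) := by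
  have hB := basicVertices_eq hs h hd0
  have hN := h.lt_N₂
  have hmem : ∀ v : basicVertices H, v.1.val ≤ 3 := fun v => hB.subset v.2
  let e : basicVertices H ≃ Fin (2 + 1 + 2 - 1) :=
    { toFun := fun v => ⟨v.1.val, by have := hmem v; omega⟩
      invFun := fun k => ⟨⟨k.val, by omega⟩, by
        rw [hB]
        exact Nat.le_of_lt_succ k.isLt⟩
      left_inv := fun v => rfl
      right_inv := fun k => rfl }
  have hadj : ∀ u v : basicVertices H, u.1.val < v.1.val → (H.Adj u.1 v.1 ↔ u.1.val ≤ 1) := by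
    intro u v huv
    have hv := hmem v
    have hp := (h.p_eq_zero_iff (j := v.1.val) (by omega) v.1.isLt).mpr (by omega)
    have hvN := v.1.isLt
    rw [hs, ShapeAdj, hp]
    omega
  refine ⟨⟨e, ?_⟩⟩
  intro u v
  change (thetaGraph 2 1 2).Adj (e u) (e v) ↔ H.Adj u.1 v.1
  rcases Nat.lt_trichotomy u.1.val v.1.val with hlt | heq | hlt
  · rw [hadj u v hlt]
    exact thetaGraph_two_one_two_adj hlt
  · obtain rfl : u = v := Subtype.ext (Fin.ext heq)
    exact ⟨fun hh => absurd rfl hh.ne, fun hh => absurd rfl hh.ne⟩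
  · rw [SimpleGraph.adj_comm, SimpleGraph.adj_comm (G := H), hadj v u hlt]
    exact thetaGraph_two_one_two_adj hlt

end Shape

end ConeGraph

/-! ### Isomorphism invariance and the conclusion for each type. -/

namespace ConeGraph

open SimpleGraph Finset

theorem card_nbrs_of_iso {V W : Type*} [Fintype V] [Fintype W] {G : SimpleGraph V}
    {G' : SimpleGraph W} (φ : G ≃g G') (v : V) : #(nbrs G' (φ v)) = #(nbrs G v) := by
  have hG : G = G'.comap φ.toEquiv := by
    ext a b
    exact φ.map_adj_iff.symm
  conv_rhs => rw [hG]
  exact (card_nbrs_comap φ.toEquiv G' v).symm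

theorem hasEigenvalue_of_iso {n : ℕ} (α : ℝ) {G G' : SimpleGraph (Fin n)} (φ : G ≃g G') {μ : ℝ}
    (h : Module.End.HasEigenvalue (Matrix.toLin' (generalMatrix α G)) μ) :
    Module.End.HasEigenvalue (Matrix.toLin' (generalMatrix α G')) μ := by
  rw [hasEigenvalue_toLin'_iff] at h ⊢
  obtain ⟨z, hz, h⟩ := h
  obtain ⟨e, rfl⟩ : ∃ e : Equiv.Perm (Fin n), G' = G.comap e := ⟨φ.symm.toEquiv, by
    ext a b
    exact φ.symm.map_adj_iff.symm⟩
  refine ⟨z ∘ e, fun h0 => hz ?_, ?_⟩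
  · ext v
    have := congrFun h0 (e.symm v)
    simpa using this
  · ext v
    rw [generalMatrix_mulVec, localSum_comap, ← generalMatrix_mulVec, h]
    rfl

theorem generalSpectralRadius_eq_of_iso {n : ℕ} (α : ℝ) {G G' : SimpleGraph (Fin n)}
    (φ : G ≃g G') : generalSpectralRadius α G = generalSpectralRadius α G' := by
  unfold generalSpectralRadius
  congr 1
  ext μ
  exact ⟨hasEigenvalue_of_iso α φ, hasEigenvalue_of_iso α φ.symm⟩

theorem IsThetaMaximal.of_iso {n t : ℕ} {α : ℝ} {π : Fin n → ℕ} {G G' : SimpleGraph (Fin n)}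
    (h : IsThetaMaximal α (coneClass n t 2 π) G) (φ : G ≃g G') :
    IsThetaMaximal α (coneClass n t 2 π) G' := by
  obtain ⟨⟨⟨H, hH, ⟨ψ⟩⟩, σ, hσ⟩, hmax⟩ := h
  refine ⟨⟨⟨H, hH, ⟨φ.symm.trans ψ⟩⟩, σ.trans φ.toEquiv, fun i => ?_⟩, fun K hK => ?_⟩
  · rw [← hσ i, ← card_nbrs, ← card_nbrs]
    exact card_nbrs_of_iso φ (σ i)
  · rw [← generalSpectralRadius_eq_of_iso α φ]
    exact hmax K hK

theorem exists_isThetaMaximal {n : ℕ} (α : ℝ) {𝒢 : Set (SimpleGraph (Fin n))} (h : 𝒢.Nonempty) :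
    ∃ G, IsThetaMaximal α 𝒢 G := by
  obtain ⟨G, hG, hmax⟩ := Set.exists_max_image 𝒢 (generalSpectralRadius α) (Set.toFinite 𝒢) h
  exact ⟨G, hG, hmax⟩

section Types

variable {α : ℝ} {n t : ℕ} {π : Fin n → ℕ} {G : SimpleGraph (Fin n)}

theorem IsThetaMaximal.iso_of_isType1 (hα : 0 ≤ α) (ht : t + 4 ≤ n) (hπ : Antitone π)
    (hG : IsThetaMaximal α (coneClass n t 2 π) G) (hT : IsType1 n t (reducedSeq n t π)) :
    Nonempty (G ≃g cone t (twoCycles 3 (n - t - 2))) := by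
  obtain ⟨H, K, x, p, a₁, b₁, a₂, b₂, q, a₃, b₃, a₄, b₄, ⟨φ⟩, h⟩ := exists_maximalPair hα ht hπ hG
  obtain ⟨hn, hd0, hd⟩ := hT
  obtain ⟨j, hj1, hj2⟩ := h.exists_triangle_one (by omega) (hd 1 le_rfl (by omega))
    (hd 4 (by omega) (by omega)) (by omega)
  have hj0 : 0 < j.val := by
    by_contra hj0
    exact hj2.ne (Fin.ext (by simp only; omega))
  rw [h.hasShape] at hj1 hj2
  have hp1 := h.shape.p_lt₁
  have hp2 := h.shape.p_lt₂
  have p1 := (h.shape.p_eq_zero_iff (j := 1) (by omega) (by omega)).mpr (by omega)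
  simp only [ShapeAdj] at hj1 hj2
  have hpj : p j = 0 := by omega
  have hcase : (a₁ = 1 ∧ b₁ = j) ∨ (a₂ = 1 ∧ b₂ = j) := by omega
  rcases hcase with ⟨rfl, rfl⟩ | ⟨rfl, rfl⟩
  · obtain ⟨ψ⟩ := h.shape.iso_twoCycles h.hasShape h.cyclic hpj hd0 hd (by omega)
    exact ⟨φ.trans (coneIso ψ)⟩
  · obtain ⟨ψ⟩ := h.shape.swap.iso_twoCycles h.hasShape.swap h.cyclic hpj hd0 hd (by omega)
    exact ⟨φ.trans (coneIso ψ)⟩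

theorem IsThetaMaximal.iso_of_isType2 (hα : 0 ≤ α) (ht : t + 4 ≤ n) (hπ : Antitone π)
    (hG : IsThetaMaximal α (coneClass n t 2 π) G) (hT : IsType2 n t (reducedSeq n t π)) :
    Nonempty (G ≃g cone t (thetaGraph (n - t - 2) 1 2)) := by
  obtain ⟨H, K, x, p, a₁, b₁, a₂, b₂, q, a₃, b₃, a₄, b₄, ⟨φ⟩, h⟩ := exists_maximalPair hα ht hπ hG
  obtain ⟨hn, hd0, hd1, hd⟩ := hT
  have h12 := (h.adj_of_three_three hd0 hd1 hd (by omega)).2.2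
  rw [h.hasShape] at h12
  have p2 := (h.shape.p_eq_zero_iff (j := 2) (by omega) (by omega)).mpr (by omega)
  simp only [ShapeAdj] at h12
  have hcase : (a₁ = 1 ∧ b₁ = 2) ∨ (a₂ = 1 ∧ b₂ = 2) := by omega
  rcases hcase with ⟨rfl, rfl⟩ | ⟨rfl, rfl⟩
  · obtain ⟨ψ⟩ := h.shape.iso_thetaGraph h.hasShape h.cyclic hd0 hd1 hd (by omega)
    exact ⟨φ.trans (coneIso ψ)⟩
  · obtain ⟨ψ⟩ := h.shape.swap.iso_thetaGraph h.hasShape.swap h.cyclic hd0 hd1 hd (by omega)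
    exact ⟨φ.trans (coneIso ψ)⟩

theorem IsThetaMaximal.iso_of_isType3 (hα : 0 ≤ α) (ht : t + 4 ≤ n) (hπ : Antitone π)
    (hG : IsThetaMaximal α (coneClass n t 2 π) G) (hT : IsType3 n t (reducedSeq n t π)) :
    Nonempty (G ≃g cone t (bouquetWithPaths (reducedSeq n t π 0 - 4) (n - t - 5))) := by
  obtain ⟨H, K, x, p, a₁, b₁, a₂, b₂, q, a₃, b₃, a₄, b₄, ⟨φ⟩, h⟩ := exists_maximalPair hα ht hπ hG
  obtain ⟨hn, hd0, hd, -⟩ := hT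
  have hd1 := hd 1 le_rfl (by omega)
  obtain ⟨ψ⟩ := h.shape.iso_bouquetWithPaths h.hasShape h.cyclic hd0 hd1
    (h.extra_mem hd0 hd1 (hd 4 (by omega) le_rfl))
  exact ⟨φ.trans (coneIso ψ)⟩

theorem IsThetaMaximal.of_isType4 (hα : 0 ≤ α) (ht : t + 4 ≤ n) (hπ : Antitone π)
    (hG : IsThetaMaximal α (coneClass n t 2 π) G) (hT : IsType4 n t (reducedSeq n t π)) :
    (IsBFSGraph (bfsBicyclic (n - t) (reducedSeq n t π)) ∧
      IsCyclic 2 (bfsBicyclic (n - t) (reducedSeq n t π)) ∧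
      Nonempty (basicGraph (bfsBicyclic (n - t) (reducedSeq n t π)) ≃g thetaGraph 2 1 2)) ∧
    Nonempty (G ≃g cone t (bfsBicyclic (n - t) (reducedSeq n t π))) := by
  obtain ⟨H, K, x, p, a₁, b₁, a₂, b₂, q, a₃, b₃, a₄, b₄, ⟨φ⟩, h⟩ := exists_maximalPair hα ht hπ hG
  obtain ⟨hn, hd01, hd1, hd23, hd3, -, hlast⟩ := hT
  obtain ⟨hs, hs'⟩ := h.extra_eq (by omega) hd1 hd3 hlast
  rw [← hs.eq_bfsBicyclic hs']
  exact ⟨⟨hs.isBFSGraph hs' h.cyclic.1 h.deg (hd1.trans hd01), h.cyclic,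
    Shape.basicGraph_iso hs' hs (hd1.trans hd01)⟩, ⟨φ⟩⟩

theorem IsThetaMaximal.types (hα : 0 ≤ α) (ht : t + 4 ≤ n) (hπ : Antitone π)
    (hG : IsThetaMaximal α (coneClass n t 2 π) G) :
    IsType1 n t (reducedSeq n t π) ∨ IsType2 n t (reducedSeq n t π) ∨
      IsType3 n t (reducedSeq n t π) ∨ IsType4 n t (reducedSeq n t π) := by
  obtain ⟨H, K, x, p, a₁, b₁, a₂, b₂, q, a₃, b₃, a₄, b₄, -, h⟩ := exists_maximalPair hα ht hπ hG
  exact h.types rfl ht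

end Types

end ConeGraph

theorem theorem4p6 (α : ℝ) (hα : 0 ≤ α) (n t : ℕ) (ht : t + 4 ≤ n) (π : Fin n → ℕ)
    (hπ : Antitone π) (hne : (ConeGraph.coneClass n t 2 π).Nonempty) :
    (∃ G, ConeGraph.IsThetaMaximal α (ConeGraph.coneClass n t 2 π) G) ∧
    (∀ G G', ConeGraph.IsThetaMaximal α (ConeGraph.coneClass n t 2 π) G →
      ConeGraph.IsThetaMaximal α (ConeGraph.coneClass n t 2 π) G' → Nonempty (G ≃g G')) ∧
    (ConeGraph.IsType1 n t (ConeGraph.reducedSeq n t π) ∨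
      ConeGraph.IsType2 n t (ConeGraph.reducedSeq n t π) ∨
      ConeGraph.IsType3 n t (ConeGraph.reducedSeq n t π) ∨
      ConeGraph.IsType4 n t (ConeGraph.reducedSeq n t π)) ∧
    (ConeGraph.IsType1 n t (ConeGraph.reducedSeq n t π) →
      ∀ G, ConeGraph.IsThetaMaximal α (ConeGraph.coneClass n t 2 π) G ↔
        Nonempty (G ≃g ConeGraph.cone t (ConeGraph.twoCycles 3 (n - t - 2)))) ∧
    (ConeGraph.IsType2 n t (ConeGraph.reducedSeq n t π) →
      ∀ G, ConeGraph.IsThetaMaximal α (ConeGraph.coneClass n t 2 π) G ↔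
        Nonempty (G ≃g ConeGraph.cone t (ConeGraph.thetaGraph (n - t - 2) 1 2))) ∧
    (ConeGraph.IsType3 n t (ConeGraph.reducedSeq n t π) →
      ∀ G, ConeGraph.IsThetaMaximal α (ConeGraph.coneClass n t 2 π) G ↔
        Nonempty (G ≃g ConeGraph.cone t
          (ConeGraph.bouquetWithPaths (ConeGraph.reducedSeq n t π 0 - 4) (n - t - 5)))) ∧
    (ConeGraph.IsType4 n t (ConeGraph.reducedSeq n t π) →
      (ConeGraph.IsBFSGraph (ConeGraph.bfsBicyclic (n - t) (ConeGraph.reducedSeq n t π)) ∧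
        ConeGraph.IsCyclic 2 (ConeGraph.bfsBicyclic (n - t) (ConeGraph.reducedSeq n t π)) ∧
        Nonempty (ConeGraph.basicGraph
          (ConeGraph.bfsBicyclic (n - t) (ConeGraph.reducedSeq n t π)) ≃g
            ConeGraph.thetaGraph 2 1 2)) ∧
      ∀ G, ConeGraph.IsThetaMaximal α (ConeGraph.coneClass n t 2 π) G ↔
        Nonempty (G ≃g ConeGraph.cone t
          (ConeGraph.bfsBicyclic (n - t) (ConeGraph.reducedSeq n t π)))) := by
  obtain ⟨M, hM⟩ := ConeGraph.exists_isThetaMaximal α hne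
  -- It suffices to show that every maximal graph is isomorphic to the model. A maximal graph `M`
  -- exists, so any graph isomorphic to the model is isomorphic to `M`, and maximality is invariant.
  have hiff : ∀ {W : Type} {T : SimpleGraph W}, (∀ G, ConeGraph.IsThetaMaximal α (ConeGraph.coneClass n t 2 π) G →
      Nonempty (G ≃g T)) → ∀ G, ConeGraph.IsThetaMaximal α (ConeGraph.coneClass n t 2 π) G ↔ Nonempty (G ≃g T) := by
    intro W T hT G
    refine ⟨hT G, ?_⟩
    rintro ⟨φ⟩
    obtain ⟨ψ⟩ := hT M hM
    exact hM.of_iso (ψ.trans φ.symm)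
  have huniq : ∀ {W : Type} {T : SimpleGraph W}, (∀ G, ConeGraph.IsThetaMaximal α (ConeGraph.coneClass n t 2 π) G →
      Nonempty (G ≃g T)) → ∀ G G', ConeGraph.IsThetaMaximal α (ConeGraph.coneClass n t 2 π) G →
      ConeGraph.IsThetaMaximal α (ConeGraph.coneClass n t 2 π) G' → Nonempty (G ≃g G') := by
    intro W T hT G G' hG hG'
    obtain ⟨φ⟩ := hT G hG
    obtain ⟨ψ⟩ := hT G' hG'
    exact ⟨φ.trans ψ.symm⟩
  have h1 := fun hT G hG => ConeGraph.IsThetaMaximal.iso_of_isType1 (G := G) hα ht hπ hG hT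
  have h2 := fun hT G hG => ConeGraph.IsThetaMaximal.iso_of_isType2 (G := G) hα ht hπ hG hT
  have h3 := fun hT G hG => ConeGraph.IsThetaMaximal.iso_of_isType3 (G := G) hα ht hπ hG hT
  have h4 := fun hT G hG => (ConeGraph.IsThetaMaximal.of_isType4 (G := G) hα ht hπ hG hT).2
  refine ⟨⟨M, hM⟩, ?_, hM.types hα ht hπ, fun hT => hiff (h1 hT), fun hT => hiff (h2 hT),
    fun hT => hiff (h3 hT), fun hT => ⟨(hM.of_isType4 hα ht hπ hT).1, hiff (h4 hT)⟩⟩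
  rcases hM.types hα ht hπ with hT | hT | hT | hT
  · exact huniq (h1 hT)
  · exact huniq (h2 hT)
  · exact huniq (h3 hT)
  · exact huniq (h4 hT)
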